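/- All graphs are finite and simple; $\alpha(G)$ is the independence number, $N(v)$ the neighbourhood of $v$. A tripartition $(A,B,R)$ of $V(G)$ is non-trivial if $A,B\neq\emptyset$ and $|R|<\min(|A|,|B|)$. For $g,d:\mathbb N\to\mathbb N$ and $k\in\mathbb N$, a non-trivial tripartition $(A,B,R)$ of $V(G)$ with $|R|\le g(k)$ is called, at parameter $k$, a witness of - $(g,d)$-almost bicompleteness if $|B\setminus N(v)|\le d(k)$ for all $v\in A$ and $|A\setminus N(v)|\le d(k)$ for all $v\in B$; - $(g,d)$-almost disconnectedness if $|N(v)\cap B|\le d(k)$ for all $v\in A$ and $|N(v)\cap A|\le d(k)$ for all $v\in B$; - one-sided $(g,d)$-almost disconnectedness if $|B|>k\,d(k)$ and $|N(v)\cap B|\le d(k)$ for all $v\in A$; - $(g,d)$-weak connectedness if $|A|,|B|>d(k)^{d(k)}k^{2d(k)-1}+1$ and the bipartite graph between $A$ and $B$ is $K_{d(k),d(k)}$-free. Fix one of the last three notions and call it "sparse". Let $g_1,d_1,g_2,d_2$ be computable functions. A class $\mathcal C$ of graphs is a class of co-graphs with parameterized noise (for this notion and these functions) if it is closed under induced subgraphs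 and if, for every $G\in\mathcal C$ with at least two vertices and every $k\ge\alpha(G)$, $V(G)$ has a tripartition that is, at parameter $k$, a witness of $(g_1,d_1)$-almost bicompleteness or a sparse witness for $(g_2,d_2)$. Theorem. Let $\mathcal C$ be a class of co-graphs with parameterized noise, and suppose that, possibly with the help of an oracle, such tripartitions can be found in FPT time: some algorithm, given $G\in\mathcal C$ with $|V(G)|\ge 2$ and $k\ge\alpha(G)$, outputs one of these witnesses in time at most $h(k)|V(G)|^{\gamma}$, for some computable $h$ and some constant $\gamma$. Then (with the same oracle, if any) Maximum Independent Set parameterized by the solution size is FPT on $\mathcal C$: there are an algorithm, a computable function $f$ and a constant $c$ such that for all $G\in\mathcal C$ and all $k\in\mathbb N$ the algorithm decides in time at most $f(k)(|V(G)|+1)^{c}$ whether $G$ has an independent set of size $k$. This holds for each of the three sparse notions. Time is the number of elementary steps of a first-order functional programming language with recursion over binary trees (atom test, pairing, projections, composition, branching, function calls), in which a query to the oracle costs the charge set by the oracle plus one; graphs are given by adjacency matrices and $k$ in unary. -/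

import Mathlib

namespace NoisyCographs

/-! ### A first-order functional language over binary trees, with a step count -/

/-- Data values: finite binary trees, that is, S-expressions over the single atom `nil`. -/
inductive Data : Type
  | nil : Data
  | cons : Data → Data → Data

/-- Programs. Every program maps one tree to one tree. -/
inductive Prog : Type
  /-- return the input -/
  | id : Prog
  /-- return `nil` -/
  | nil : Prog
  /-- left component of the input -/
  | hd : Prog
  /-- right component of the input -/
  | tl : Prog
  /-- build a pair from the results of two programs on the same input -/
  | cons : Prog → Prog → Prog
  /-- `comp p q` runs `q`, then `p` on the result -/
  | comp : Prog → Prog → Prog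
  /-- `cond c p q` runs `c`; it continues with `q` if the result is `nil`, with `p` otherwise -/
  | cond : Prog → Prog → Prog → Prog
  /-- recursive call: run the body of the innermost enclosing function on the input -/
  | self : Prog
  /-- `fn p` calls the function with body `p`; inside `p`, `self` refers to `p` -/
  | fn : Prog → Prog
  /-- query the oracle on the input -/
  | oracle : Prog

/-- An oracle: its answers, and the time charged for each query. -/
structure Oracle where
  answer : Data → Data
  cost : Data → ℕ

/-- The oracle that carries no information; programs with this oracle are ordinary programs. -/
def Oracle.trivial : Oracle := ⟨fun _ => Data.nil, fun _ => 0⟩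

/-- `Eval O F p x y t`: inside the function with body `F`, and with oracle `O`, the program `p`
on input `x` halts with result `y` after exactly `t` elementary steps. Every syntactic construct
that is executed costs one step, and a query costs one step more than the charge of the oracle. -/
inductive Eval (O : Oracle) : Prog → Prog → Data → Data → ℕ → Prop
  | id (F : Prog) (x : Data) : Eval O F Prog.id x x 1
  | nil (F : Prog) (x : Data) : Eval O F Prog.nil x Data.nil 1
  | hd_nil (F : Prog) : Eval O F Prog.hd Data.nil Data.nil 1
  | hd_cons (F : Prog) (a b : Data) : Eval O F Prog.hd (Data.cons a b) a 1
  | tl_nil (F : Prog) : Eval O F Prog.tl Data.nil Data.nil 1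
  | tl_cons (F : Prog) (a b : Data) : Eval O F Prog.tl (Data.cons a b) b 1
  | cons (F p q : Prog) (x y z : Data) (s t : ℕ) :
      Eval O F p x y s → Eval O F q x z t →
        Eval O F (Prog.cons p q) x (Data.cons y z) (s + t + 1)
  | comp (F p q : Prog) (x y z : Data) (s t : ℕ) :
      Eval O F q x y s → Eval O F p y z t → Eval O F (Prog.comp p q) x z (s + t + 1)
  | cond_true (F c p q : Prog) (x a b y : Data) (s t : ℕ) :
      Eval O F c x (Data.cons a b) s → Eval O F p x y t →
        Eval O F (Prog.cond c p q) x y (s + t + 1)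
  | cond_false (F c p q : Prog) (x y : Data) (s t : ℕ) :
      Eval O F c x Data.nil s → Eval O F q x y t →
        Eval O F (Prog.cond c p q) x y (s + t + 1)
  | self (F : Prog) (x y : Data) (t : ℕ) :
      Eval O F F x y t → Eval O F Prog.self x y (t + 1)
  | fn (F p : Prog) (x y : Data) (t : ℕ) :
      Eval O p p x y t → Eval O F (Prog.fn p) x y (t + 1)
  | oracle (F : Prog) (x : Data) : Eval O F Prog.oracle x (O.answer x) (O.cost x + 1)

/-- The program `p` with oracle `O` on input `x` halts with output `y` after `t` steps
(at top level, `self` refers to the whole program). -/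
def Runs (O : Oracle) (p : Prog) (x y : Data) (t : ℕ) : Prop := Eval O p p x y t

/-! ### Encodings -/

/-- Unary numerals. -/
def Data.ofNat : ℕ → Data
  | 0 => Data.nil
  | n + 1 => Data.cons Data.nil (Data.ofNat n)

def Data.ofList : List Data → Data
  | [] => Data.nil
  | a :: l => Data.cons a (Data.ofList l)

open Classical in
/-- A truth value: `nil` for false, `cons nil nil` for true. -/
noncomputable def Data.ofProp (P : Prop) : Data :=
  if P then Data.cons Data.nil Data.nil else Data.nil

/-- A graph on `{0, …, n - 1}` is given by its adjacency matrix, as the list of its rows. -/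
noncomputable def encodeGraph {n : ℕ} (G : SimpleGraph (Fin n)) : Data :=
  Data.ofList (List.ofFn fun i : Fin n =>
    Data.ofList (List.ofFn fun j : Fin n => Data.ofProp (G.Adj i j)))

/-- The instance `(G, k)`. -/
noncomputable def encodeInstance {n : ℕ} (G : SimpleGraph (Fin n)) (k : ℕ) : Data :=
  Data.cons (encodeGraph G) (Data.ofNat k)

/-! ### Tripartitions and their properties -/

/-- An ordered partition of the vertex set into three (possibly empty) parts. -/
structure Tripartition (V : Type) [Fintype V] [DecidableEq V] where
  A : Finset V
  B : Finset V
  R : Finset V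
  disjoint_AB : Disjoint A B
  disjoint_AR : Disjoint A R
  disjoint_BR : Disjoint B R
  cover : A ∪ B ∪ R = Finset.univ

namespace Tripartition

/-- A tripartition is written as the list of the labels of the vertices: `0` for vertices of `A`,
`1` for vertices of `B`, `2` for vertices of `R`. -/
def encode {n : ℕ} (T : Tripartition (Fin n)) : Data :=
  Data.ofList (List.ofFn fun v : Fin n =>
    Data.ofNat (if v ∈ T.A then 0 else if v ∈ T.B then 1 else 2))

variable {V : Type} [Fintype V] [DecidableEq V]

def Nontrivial (T : Tripartition V) : Prop :=
  T.A.Nonempty ∧ T.B.Nonempty ∧ T.R.card < min T.A.card T.B.card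

open Classical in
/-- Witness of `(g, d)`-almost bicompleteness, for the values `g = g(k)`, `d = d(k)`. -/
def AlmostBicomplete (G : SimpleGraph V) (T : Tripartition V) (g d : ℕ) : Prop :=
  T.Nontrivial ∧ T.R.card ≤ g ∧
    (∀ v ∈ T.A, (T.B.filter fun w => ¬ G.Adj v w).card ≤ d) ∧
    (∀ v ∈ T.B, (T.A.filter fun w => ¬ G.Adj v w).card ≤ d)

open Classical in
/-- Witness of `(g, d)`-almost disconnectedness, for the values `g = g(k)`, `d = d(k)`. -/
def AlmostDisconnected (G : SimpleGraph V) (T : Tripartition V) (g d : ℕ) : Prop :=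
  T.Nontrivial ∧ T.R.card ≤ g ∧
    (∀ v ∈ T.A, (T.B.filter fun w => G.Adj v w).card ≤ d) ∧
    (∀ v ∈ T.B, (T.A.filter fun w => G.Adj v w).card ≤ d)

open Classical in
/-- Witness of one-sided `(g, d)`-almost disconnectedness, for the parameter `k` and the values
`g = g(k)`, `d = d(k)`. -/
def OneSidedAlmostDisconnected (G : SimpleGraph V) (T : Tripartition V) (k g d : ℕ) : Prop :=
  T.Nontrivial ∧ T.R.card ≤ g ∧ k * d < T.B.card ∧
    (∀ v ∈ T.A, (T.B.filter fun w => G.Adj v w).card ≤ d)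

/-- Witness of `(g, d)`-weak connectedness, for the parameter `k` and the values `g = g(k)`,
`d = d(k)`. The last clause says that the bipartite graph between `A` and `B` is `K_{d,d}`-free;
it excludes `d = 0`, so that the exponent `2 * d - 1` is not truncated. -/
def WeaklyConnected (G : SimpleGraph V) (T : Tripartition V) (k g d : ℕ) : Prop :=
  T.Nontrivial ∧ T.R.card ≤ g ∧
    d ^ d * k ^ (2 * d - 1) + 1 < T.A.card ∧ d ^ d * k ^ (2 * d - 1) + 1 < T.B.card ∧
    ¬ ∃ X Y : Finset V, X ⊆ T.A ∧ Y ⊆ T.B ∧ X.card = d ∧ Y.card = d ∧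
      ∀ x ∈ X, ∀ y ∈ Y, G.Adj x y

end Tripartition

/-- The three notions of a sparse separation. -/
inductive Sparsity : Type
  | almostDisconnected : Sparsity
  | oneSidedAlmostDisconnected : Sparsity
  | weaklyConnected : Sparsity

/-- `T` is a witness of sparse separation of `G`, in the sense of the given notion. -/
def IsSparseWitness {n : ℕ} (S : Sparsity) (G : SimpleGraph (Fin n)) (T : Tripartition (Fin n))
    (k g d : ℕ) : Prop :=
  match S with
  | Sparsity.almostDisconnected => T.AlmostDisconnected G g d
  | Sparsity.oneSidedAlmostDisconnected => T.OneSidedAlmostDisconnected G k g d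
  | Sparsity.weaklyConnected => T.WeaklyConnected G k g d

/-! ### Classes of graphs -/

/-- A class of finite graphs, given by its members on the vertex sets `{0, …, n - 1}`. -/
abbrev GraphClass : Type := (n : ℕ) → Set (SimpleGraph (Fin n))

/-- Closed under induced subgraphs (in particular, under isomorphism). -/
def GraphClass.Hereditary (C : GraphClass) : Prop :=
  ∀ (m n : ℕ) (H : SimpleGraph (Fin m)) (G : SimpleGraph (Fin n)),
    G ∈ C n → H.IsIndContained G → H ∈ C m

/-- The noise functions of a class: `g₁`, `d₁` for almost bicomplete tripartitions, and
`g₂`, `d₂` for the sparse ones. -/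
structure Noise where
  g₁ : ℕ → ℕ
  d₁ : ℕ → ℕ
  g₂ : ℕ → ℕ
  d₂ : ℕ → ℕ
  computable_g₁ : Computable g₁
  computable_d₁ : Computable d₁
  computable_g₂ : Computable g₂
  computable_d₂ : Computable d₂

/-- `T` is one of the tripartitions of `G` that the noise allows at the parameter `k`. -/
def IsWitness {n : ℕ} (S : Sparsity) (N : Noise) (G : SimpleGraph (Fin n)) (k : ℕ)
    (T : Tripartition (Fin n)) : Prop :=
  T.AlmostBicomplete G (N.g₁ k) (N.d₁ k) ∨ IsSparseWitness S G T k (N.g₂ k) (N.d₂ k)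

/-- Co-graphs with parameterized noise: a hereditary class in which every graph is almost
bicomplete or separated in the sense of `S`. Graphs with fewer than two vertices have no
non-trivial tripartition at all, and nothing is required of them. -/
def IsNoisyCographClass (S : Sparsity) (N : Noise) (C : GraphClass) : Prop :=
  C.Hereditary ∧ ∀ (n : ℕ) (G : SimpleGraph (Fin n)) (k : ℕ),
    2 ≤ n → G ∈ C n → G.indepNum ≤ k → ∃ T : Tripartition (Fin n), IsWitness S N G k T

/-! ### Fixed-parameter tractability -/

/-- With oracle `O`, the tripartitions of the graphs in `C` can be found in FPT time: some program
returns, for all `G ∈ C` with at least two vertices and all `k ≥ α(G)`, an allowed tripartition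
of `G` within `h(k) |V(G)|^γ` steps. Nothing is required on other inputs. -/
def FindsTripartitionsFPT (O : Oracle) (S : Sparsity) (N : Noise) (C : GraphClass) : Prop :=
  ∃ (q : Prog) (h : ℕ → ℕ) (γ : ℕ), Computable h ∧
    ∀ (n : ℕ) (G : SimpleGraph (Fin n)) (k : ℕ), 2 ≤ n → G ∈ C n → G.indepNum ≤ k →
      ∃ T : Tripartition (Fin n), IsWitness S N G k T ∧
        ∃ t : ℕ, t ≤ h k * n ^ γ ∧ Runs O q (encodeInstance G k) T.encode t

/-- With oracle `O`, Maximum Independent Set is FPT on `C`: some program decides, for all `G ∈ C`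
and all `k`, whether `G` has an independent set of size `k`, within `f(k) (|V(G)| + 1)^c` steps. -/
def MISIsFPT (O : Oracle) (C : GraphClass) : Prop :=
  ∃ (p : Prog) (f : ℕ → ℕ) (c : ℕ), Computable f ∧
    ∀ (n : ℕ) (G : SimpleGraph (Fin n)) (k : ℕ), G ∈ C n →
      ∃ t : ℕ, t ≤ f k * (n + 1) ^ c ∧
        Runs O p (encodeInstance G k)
          (Data.ofProp (∃ I : Finset (Fin n), G.IsNIndepSet k I)) t

end NoisyCographs

namespace NoisyCographs

/-! ### Polynomially bounded quantities -/

def Data.size : Data → ℕ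
  | Data.nil => 0
  | Data.cons a b => a.size + b.size + 1

/-- Types whose values are represented by trees. -/
class Enc (α : Type) where
  enc : α → Data

open Enc

/-- The size of the representation of a value. -/
def sz {α : Type} [Enc α] (x : α) : ℕ := (enc x).size

instance : Enc Bool := ⟨fun b => if b then Data.cons Data.nil Data.nil else Data.nil⟩
instance : Enc ℕ := ⟨Data.ofNat⟩
instance : Enc Unit := ⟨fun _ => Data.nil⟩
instance {α β : Type} [Enc α] [Enc β] : Enc (α × β) := ⟨fun x => Data.cons (enc x.1) (enc x.2)⟩
instance {α : Type} [Enc α] : Enc (List α) := ⟨fun l => Data.ofList (l.map enc)⟩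
instance {α : Type} [Enc α] : Enc (Option α) :=
  ⟨fun o => o.elim Data.nil fun a => Data.cons Data.nil (enc a)⟩

section Basic

variable {α β γ δ σ : Type} [Enc α] [Enc β] [Enc γ] [Enc δ] [Enc σ]

theorem enc_pair (a : α) (b : β) : enc (a, b) = Data.cons (enc a) (enc b) := rfl
theorem enc_true : enc true = Data.cons Data.nil Data.nil := rfl
theorem enc_false : enc false = Data.nil := rfl
theorem enc_list_cons (a : α) (l : List α) : enc (a :: l) = Data.cons (enc a) (enc l) := rfl
theorem enc_nat_succ (n : ℕ) : enc (n + 1) = Data.cons Data.nil (enc n) := rfl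

theorem sz_pair (a : α) (b : β) : sz (a, b) = sz a + sz b + 1 := rfl
theorem sz_nil : sz ([] : List α) = 0 := rfl
theorem sz_cons (a : α) (l : List α) : sz (a :: l) = sz a + sz l + 1 := rfl
theorem sz_none : sz (none : Option α) = 0 := rfl
theorem sz_some (a : α) : sz (some a) = 0 + sz a + 1 := rfl
theorem sz_nat (n : ℕ) : sz n = n := by
  induction n with
  | zero => rfl
  | succ n ih =>
    have : sz (n + 1) = 0 + sz n + 1 := rfl
    omega
theorem sz_bool_le (b : Bool) : sz b ≤ 1 := by cases b <;> decide

theorem sz_le_of_mem {a : α} {l : List α} (h : a ∈ l) : sz a + 1 ≤ sz l := by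
  induction l with
  | nil => simp at h
  | cons b l ih =>
    rw [sz_cons]
    rcases List.mem_cons.1 h with rfl | h
    · omega
    · have := ih h; omega

theorem length_le_sz (l : List α) : l.length ≤ sz l := by
  induction l with
  | nil => simp
  | cons b l ih => rw [sz_cons, List.length_cons]; omega

theorem sz_list_le {l : List α} {m : ℕ} (h : ∀ a ∈ l, sz a ≤ m) : sz l ≤ l.length * (m + 1) := by
  induction l with
  | nil => simp [sz_nil]
  | cons b l ih =>
    have h1 := ih fun a ha => h a (by simp [ha])
    have h2 := h b (by simp)
    rw [sz_cons, List.length_cons]; nlinarith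

theorem sz_append (l m : List α) : sz (l ++ m) = sz l + sz m := by
  induction l with
  | nil => simp [sz_nil]
  | cons b l ih => rw [List.cons_append, sz_cons, sz_cons, ih]; omega

theorem sz_sublist {l m : List α} (h : l.Sublist m) : sz l ≤ sz m := by
  induction h with
  | slnil => rfl
  | cons a _ ih => rw [sz_cons]; omega
  | cons_cons a _ ih => rw [sz_cons, sz_cons]; omega

/-- Polynomially bounded in the size of the argument. -/
def PB (T : α → ℕ) : Prop := ∃ c, ∀ x, T x ≤ (sz x + 2) ^ c

theorem PB.mono {T U : α → ℕ} (hU : PB U) (h : ∀ x, T x ≤ U x) : PB T :=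
  let ⟨c, hc⟩ := hU
  ⟨c, fun x => (h x).trans (hc x)⟩

theorem PB.size : PB (fun x : α => sz x) := ⟨1, fun x => by simp⟩

theorem pow_le_pow_size {c d : ℕ} (s : ℕ) (h : c ≤ d) : (s + 2) ^ c ≤ (s + 2) ^ d :=
  Nat.pow_le_pow_right (by omega) h

theorem PB.const (n : ℕ) : PB (fun _ : α => n) :=
  ⟨n, fun x => (Nat.lt_two_pow_self.le).trans (Nat.pow_le_pow_left (by omega) _)⟩

theorem PB.mul {T U : α → ℕ} (hT : PB T) (hU : PB U) : PB (fun x => T x * U x) := by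
  obtain ⟨c, hc⟩ := hT
  obtain ⟨d, hd⟩ := hU
  exact ⟨c + d, fun x => by rw [pow_add]; exact Nat.mul_le_mul (hc x) (hd x)⟩

theorem PB.add {T U : α → ℕ} (hT : PB T) (hU : PB U) : PB (fun x => T x + U x) := by
  obtain ⟨c, hc⟩ := hT
  obtain ⟨d, hd⟩ := hU
  refine ⟨max c d + 1, fun x => ?_⟩
  have h1 := (hc x).trans (pow_le_pow_size (sz x) (le_max_left c d))
  have h2 := (hd x).trans (pow_le_pow_size (sz x) (le_max_right c d))
  rw [pow_succ]
  nlinarith [Nat.zero_le ((sz x + 2) ^ max c d * sz x)]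

theorem PB.pow {T : α → ℕ} (hT : PB T) (n : ℕ) : PB (fun x => T x ^ n) := by
  induction n with
  | zero => simpa using PB.const 1
  | succ n ih => simpa [pow_succ] using ih.mul hT

theorem PB.comp {T : β → ℕ} {f : α → β} (hT : PB T) (hf : PB fun x => sz (f x)) :
    PB fun x => T (f x) := by
  obtain ⟨c, hc⟩ := hT
  exact ((hf.add (PB.const 2)).pow c).mono fun x => hc _

/-! ### Functions computed by programs in polynomial time -/

/-- `p` computes `f` within time `T`, whatever the oracle and the enclosing function are. -/
def Computes (p : Prog) (f : α → β) (T : α → ℕ) : Prop :=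
  ∀ O F x, ∃ t ≤ T x, Eval O F p (enc x) (enc (f x)) t

/-- `f` is computed by a program in polynomial time and has values of polynomial size. -/
@[fun_prop]
def PT (f : α → β) : Prop :=
  (∃ p T, PB T ∧ Computes p f T) ∧ PB fun x => sz (f x)

theorem PT.of_enc {f : α → β} {f' : γ → δ} (hf : PT f') (i : α → γ) (h : ∀ x, enc x = enc (i x))
    (h' : ∀ x, enc (f x) = enc (f' (i x))) : PT f := by
  obtain ⟨⟨p, T, ⟨c, hc⟩, hp⟩, ⟨d, hd⟩⟩ := hf
  refine ⟨⟨p, fun x => T (i x), ⟨c, fun x => ?_⟩, fun O F x => ?_⟩, d, fun x => ?_⟩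
  · have : sz x = sz (i x) := congrArg Data.size (h x)
    rw [this]; exact hc _
  · rw [h, h']; exact hp O F (i x)
  · have h1 : sz x = sz (i x) := congrArg Data.size (h x)
    have h2 : sz (f x) = sz (f' (i x)) := congrArg Data.size (h' x)
    dsimp only; rw [h1, h2]; exact hd _

@[fun_prop]
theorem PT.id : PT (fun x : α => x) :=
  ⟨⟨Prog.id, fun _ => 1, PB.const 1, fun _ F _ => ⟨1, le_rfl, Eval.id F _⟩⟩, PB.size⟩

@[fun_prop]
theorem PT.comp {f : β → γ} {g : α → β} (hf : PT f) (hg : PT g) : PT fun x => f (g x) := by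
  obtain ⟨⟨p, T, hT, hp⟩, hs⟩ := hf
  obtain ⟨⟨q, U, hU, hq⟩, hr⟩ := hg
  refine ⟨⟨Prog.comp p q, fun x => U x + T (g x) + 1,
    (hU.add (hT.comp hr)).add (PB.const 1), fun O F x => ?_⟩, hs.comp hr⟩
  obtain ⟨s, hs, h1⟩ := hq O F x
  obtain ⟨t, ht, h2⟩ := hp O F (g x)
  exact ⟨_, by dsimp only; omega, Eval.comp F p q _ _ _ s t h1 h2⟩

@[fun_prop]
theorem PT.pair {f : α → β} {g : α → γ} (hf : PT f) (hg : PT g) : PT fun x => (f x, g x) := by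
  obtain ⟨⟨p, T, hT, hp⟩, hs⟩ := hf
  obtain ⟨⟨q, U, hU, hq⟩, hr⟩ := hg
  refine ⟨⟨Prog.cons p q, fun x => T x + U x + 1,
    (hT.add hU).add (PB.const 1), fun O F x => ?_⟩, (hs.add hr).add (PB.const 1)⟩
  obtain ⟨s, hs, h1⟩ := hp O F x
  obtain ⟨t, ht, h2⟩ := hq O F x
  exact ⟨_, by dsimp only; omega, Eval.cons F p q _ _ _ s t h1 h2⟩

@[fun_prop]
theorem PT.fst : PT (fun x : α × β => x.1) :=
  ⟨⟨Prog.hd, fun _ => 1, PB.const 1, fun _ F _ => ⟨1, le_rfl, Eval.hd_cons F _ _⟩⟩,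
    PB.size.mono fun x => by obtain ⟨a, b⟩ := x; rw [sz_pair]; dsimp only; omega⟩

@[fun_prop]
theorem PT.snd : PT (fun x : α × β => x.2) :=
  ⟨⟨Prog.tl, fun _ => 1, PB.const 1, fun _ F _ => ⟨1, le_rfl, Eval.tl_cons F _ _⟩⟩,
    PB.size.mono fun x => by obtain ⟨a, b⟩ := x; rw [sz_pair]; dsimp only; omega⟩

theorem exists_const_prog (d : Data) : ∃ (p : Prog) (t : ℕ), ∀ (O : Oracle) (F : Prog)
    (x : Data), Eval O F p x d t := by
  induction d with
  | nil => exact ⟨Prog.nil, 1, fun O F x => Eval.nil F x⟩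
  | cons a b iha ihb =>
    obtain ⟨p, s, hp⟩ := iha
    obtain ⟨q, t, hq⟩ := ihb
    exact ⟨Prog.cons p q, _, fun O F x => Eval.cons F p q _ _ _ _ _ (hp O F x) (hq O F x)⟩

@[fun_prop]
theorem PT.const (b : β) : PT (fun _ : α => b) := by
  obtain ⟨p, t, hp⟩ := exists_const_prog (enc b)
  exact ⟨⟨p, fun _ => t, PB.const t, fun O F _ => ⟨t, le_rfl, hp O F _⟩⟩, PB.const _⟩

/-- Branching on a list. -/
theorem PT.ite_nil {l : α → List β} {f g : α → γ} (hl : PT l) (hf : PT f) (hg : PT g) :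
    PT fun x => if l x = [] then f x else g x := by
  obtain ⟨⟨r, R, hR, hr⟩, -⟩ := hl
  obtain ⟨⟨p, T, hT, hp⟩, hs⟩ := hf
  obtain ⟨⟨q, U, hU, hq⟩, hs'⟩ := hg
  refine ⟨⟨Prog.cond r q p, fun x => R x + (T x + U x) + 1,
    (hR.add (hT.add hU)).add (PB.const 1), fun O F x => ?_⟩,
    (hs.add hs').mono fun x => by dsimp only; split_ifs <;> omega⟩
  obtain ⟨s, hs, h1⟩ := hr O F x
  cases h : l x with
  | nil =>
    obtain ⟨t, ht, h2⟩ := hp O F x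
    rw [h] at h1
    exact ⟨s + t + 1, by dsimp only; omega, Eval.cond_false F r q p _ _ s t h1
        (by simpa [h] using h2)⟩
  | cons b l' =>
    obtain ⟨t, ht, h2⟩ := hq O F x
    rw [h] at h1
    exact ⟨s + t + 1, by dsimp only; omega,
      Eval.cond_true F r q p _ _ _ _ s t h1 (by simpa [h] using h2)⟩

@[fun_prop]
theorem PT.ite {c : α → Bool} {f g : α → γ} (hc : PT c) (hf : PT f) (hg : PT g) :
    PT fun x => if c x = true then f x else g x := by
  have hc' : PT fun x => (if c x then [()] else [] : List Unit) :=
    hc.of_enc (γ := α) (f' := c) (fun x => x) (fun _ => rfl) (fun x => by cases c x <;> rfl)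
  have := PT.ite_nil hc' hg hf
  convert this using 2 with x
  cases c x <;> simp

@[fun_prop]
theorem PT.list_cons {f : α → β} {g : α → List β} (hf : PT f) (hg : PT g) :
    PT fun x => f x :: g x :=
  (hf.pair hg).of_enc (fun x => x) (fun _ => rfl) (fun _ => rfl)

@[fun_prop]
theorem PT.some {f : α → β} (hf : PT f) : PT fun x => Option.some (f x) :=
  ((PT.const (α := α) ()).pair hf).of_enc (fun x => x) (fun _ => rfl) (fun _ => rfl)

@[fun_prop]
theorem PT.tail {f : α → List β} (hf : PT f) : PT fun x => (f x).tail := by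
  have : PT (fun l : List β => l.tail) :=
    ⟨⟨Prog.tl, fun _ => 1, PB.const 1, fun O F x => ⟨1, le_rfl, by
      cases x with
      | nil => exact Eval.tl_nil F
      | cons b l => exact Eval.tl_cons F _ _⟩⟩,
      PB.size.mono fun x => sz_sublist x.tail_sublist⟩
  exact this.comp hf

@[fun_prop]
theorem PT.headD {f : α → List β} {g : α → β} (hf : PT f) (hg : PT g) :
    PT fun x => (f x).headD (g x) := by
  obtain ⟨⟨p, T, hT, hp⟩, hs⟩ := hf
  obtain ⟨⟨q, U, hU, hq⟩, hs'⟩ := hg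
  refine ⟨⟨Prog.cond p (Prog.comp Prog.hd p) q, fun x => 2 * T x + U x + 3,
    (((PB.const 2).mul hT).add hU).add (PB.const 3), fun O F x => ?_⟩,
    (hs.add hs').mono fun x => ?_⟩
  · obtain ⟨s, hs, h1⟩ := hp O F x
    cases h : f x with
    | nil =>
      obtain ⟨t, ht, h2⟩ := hq O F x
      rw [h] at h1
      exact ⟨s + t + 1, by dsimp only; omega, Eval.cond_false F _ _ _ _ _ s t h1
          (by simpa [h] using h2)⟩
    | cons b l' =>
      rw [h] at h1
      exact ⟨s + (s + 1 + 1) + 1, by dsimp only; omega,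
        Eval.cond_true F _ _ _ _ _ _ _ _ _ h1 (Eval.comp F _ _ _ _ _ _ _ h1
            (by simp only [h]; exact Eval.hd_cons F (enc b) (enc l')))⟩
  · cases h : f x with
    | nil => simp [h]
    | cons b l' => rw [sz_cons]; dsimp only; rw [h, List.headD_cons]; omega

/-- Recursion over a list. -/
theorem PT.foldr {l : α → List β} {h : α → σ} {g : α → β → σ → σ} {B : α → ℕ}
    (hl : PT l) (hh : PT h) (hg : PT fun x : α × β × σ => g x.1 x.2.1 x.2.2) (hB : PB B)
    (hs : ∀ a l', l' <:+ l a → sz (l'.foldr (g a) (h a)) ≤ B a) :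
    PT fun a => (l a).foldr (g a) (h a) := by
  obtain ⟨⟨pl, Tl, hTl, hpl⟩, hsl⟩ := hl
  obtain ⟨⟨ph, Th, hTh, hph⟩, hsh⟩ := hh
  obtain ⟨⟨pg, Tg, ⟨c, hTg⟩, hpg⟩, hsg⟩ := hg
  set body : Prog := Prog.cond Prog.tl
    (Prog.comp pg (Prog.cons Prog.hd (Prog.cons (Prog.comp Prog.hd Prog.tl)
      (Prog.comp Prog.self (Prog.cons Prog.hd (Prog.comp Prog.tl Prog.tl))))))
    (Prog.comp ph Prog.hd)
  have key : ∀ O a G (l' : List β),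
      (∀ b l'', (b :: l'') <:+ l' → Tg (a, b, l''.foldr (g a) (h a)) ≤ G) →
      ∃ t ≤ l'.length * (G + 20) + Th a + 4,
        Eval O body body (Data.cons (enc a) (enc l')) (enc (l'.foldr (g a) (h a))) t := by
    intro O a G l'
    induction l' with
    | nil =>
      intro _
      obtain ⟨t, ht, h1⟩ := hph O body a
      exact ⟨1 + (1 + t + 1) + 1, by simp only [List.length_nil]; omega,
        Eval.cond_false _ _ _ _ _ _ _ _ (Eval.tl_cons _ _ _)
          (Eval.comp _ _ _ _ _ _ _ _ (Eval.hd_cons _ _ _) h1)⟩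
    | cons b l' ih =>
      intro hG
      obtain ⟨t, ht, h1⟩ := ih fun b' l'' h' => hG b' l'' (h'.trans (List.suffix_cons _ _))
      obtain ⟨s, hs, h2⟩ := hpg O body (a, b, l'.foldr (g a) (h a))
      have hs' := hs.trans (hG b l' (List.suffix_refl _))
      refine ⟨_, ?_, Eval.cond_true _ _ _ _ _ _ _ _ _ _ (Eval.tl_cons _ _ _)
        (Eval.comp _ _ _ _ _ _ _ _ (Eval.cons _ _ _ _ _ _ _ _ (Eval.hd_cons _ _ _)
          (Eval.cons _ _ _ _ _ _ _ _
            (Eval.comp _ _ _ _ _ _ _ _ (Eval.tl_cons _ _ _) (Eval.hd_cons _ _ _))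
            (Eval.comp _ _ _ _ _ _ _ _ (Eval.cons _ _ _ _ _ _ _ _ (Eval.hd_cons _ _ _)
              (Eval.comp _ _ _ _ _ _ _ _ (Eval.tl_cons _ _ _) (Eval.tl_cons _ _ _)))
              (Eval.self _ _ _ _ h1)))) h2)⟩
      rw [List.length_cons]
      have : (l'.length + 1) * (G + 20) = l'.length * (G + 20) + G + 20 := by ring
      omega
  refine ⟨⟨Prog.comp (Prog.fn body) (Prog.cons Prog.id pl),
    fun a => Tl a + (sz (l a) * ((sz a + sz (l a) + B a + 4) ^ c + 20) + Th a) + 10, ?_, ?_⟩, ?_⟩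
  · exact (hTl.add ((hsl.mul (((((PB.size.add hsl).add hB).add (PB.const 4)).pow c).add
      (PB.const 20))).add hTh)).add (PB.const 10)
  · intro O F a
    obtain ⟨s, hs1, h1⟩ := hpl O F a
    obtain ⟨t, ht, h2⟩ := key O a ((sz a + sz (l a) + B a + 4) ^ c) (l a) (by
      intro b l'' hsuf
      refine (hTg _).trans (Nat.pow_le_pow_left ?_ c)
      have e1 := hs a l'' ((List.suffix_cons _ _).trans hsuf)
      have e2 := sz_le_of_mem (hsuf.subset (List.mem_cons_self (a := b) (l := l'')))
      rw [sz_pair, sz_pair]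
      omega)
    refine ⟨_, ?_, Eval.comp _ _ _ _ _ _ _ _
      (Eval.cons _ _ _ _ _ _ _ _ (Eval.id _ _) h1) (Eval.fn _ _ _ _ _ h2)⟩
    have := Nat.mul_le_mul_right ((sz a + sz (l a) + B a + 4) ^ c + 20) (length_le_sz (l a))
    dsimp only
    omega
  · exact hB.mono fun a => hs a _ (List.suffix_refl _)

end Basic

end NoisyCographs

namespace NoisyCographs
open Enc

section Lists

theorem filter_eq_foldr_ite {β : Type} (p : β → Bool) (l : List β) :
    l.filter p = l.foldr (fun b s => if p b = true then b :: s else s) [] := by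
  induction l with
  | nil => rfl
  | cons b l ih => rw [List.filter_cons, List.foldr_cons, ← ih]

theorem foldr_succ {β : Type} (l : List β) : l.foldr (fun _ s => s + 1) 0 = l.length := by
  induction l with
  | nil => rfl
  | cons b l ih => rw [List.foldr_cons, ih, List.length_cons]

variable {α β γ δ σ : Type} [Enc α] [Enc β] [Enc γ] [Enc δ] [Enc σ]

@[fun_prop]
theorem PT.append {f g : α → List β} (hf : PT f) (hg : PT g) : PT fun x => f x ++ g x := by
  have h : PT fun a => (f a).foldr ((fun (_ : α) b s => b :: s) a) (g a) := by
    refine PT.foldr hf hg (by fun_prop) (hf.2.add hg.2) fun a l' hl' => ?_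
    rw [List.foldr_cons_eq_append, List.map_id', sz_append]
    have := sz_sublist hl'.sublist
    omega
  simpa using h

@[fun_prop]
theorem PT.map {l : α → List β} {f : α → β → γ} (hl : PT l)
    (hf : PT fun x : α × β => f x.1 x.2) : PT fun a => (l a).map (f a) := by
  obtain ⟨c, hc⟩ := hf.2
  have h : PT fun a => (l a).foldr (fun b s => f a b :: s) [] := by
    refine PT.foldr (g := fun a b s => f a b :: s)
      (B := fun a => sz (l a) * ((sz a + sz (l a) + 3) ^ c + 1)) hl (PT.const _) ?_ ?_ ?_
    · exact (PT.comp hf (PT.pair PT.fst (PT.comp PT.fst PT.snd))).list_cons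
        (PT.comp PT.snd PT.snd)
    · exact hl.2.mul ((((PB.size.add hl.2).add (PB.const 3)).pow c).add (PB.const 1))
    · intro a l' hl'
      rw [List.foldr_cons_eq_append, List.append_nil]
      refine (sz_list_le (m := (sz a + sz (l a) + 3) ^ c) fun y hy => ?_).trans
        (Nat.mul_le_mul_right _ ?_)
      · obtain ⟨b, hb, rfl⟩ := List.mem_map.1 hy
        refine (hc (a, b)).trans (Nat.pow_le_pow_left ?_ _)
        have := sz_le_of_mem (hl'.subset hb)
        rw [sz_pair]; omega
      · rw [List.length_map]
        exact (length_le_sz l').trans (sz_sublist hl'.sublist)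
  simpa using h

@[fun_prop]
theorem PT.filter {l : α → List β} {p : α → β → Bool} (hl : PT l)
    (hp : PT fun x : α × β => p x.1 x.2) : PT fun a => (l a).filter (p a) := by
  have h : PT fun a => (l a).foldr (fun b s => if p a b = true then b :: s else s) [] := by
    refine PT.foldr (g := fun a b s => if p a b = true then b :: s else s)
      (B := fun a => sz (l a)) hl (PT.const _) ?_ hl.2 ?_
    · exact PT.ite (PT.comp hp (PT.pair PT.fst (PT.comp PT.fst PT.snd))) (by fun_prop)
        (by fun_prop)
    · intro a l' hl'
      rw [← filter_eq_foldr_ite]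
      exact sz_sublist (List.filter_sublist.trans hl'.sublist)
  simpa only [← filter_eq_foldr_ite] using h

@[fun_prop]
theorem PT.any {l : α → List β} {p : α → β → Bool} (hl : PT l)
    (hp : PT fun x : α × β => p x.1 x.2) : PT fun a => (l a).any (p a) := by
  have h : PT fun a => (l a).foldr (fun b s => if p a b = true then true else s) false := by
    refine PT.foldr (g := fun a b s => if p a b = true then true else s)
      (B := fun _ => 1) hl (PT.const _) ?_ (PB.const 1) fun _ _ _ => sz_bool_le _
    exact PT.ite (PT.comp hp (PT.pair PT.fst (PT.comp PT.fst PT.snd))) (by fun_prop)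
      (by fun_prop)
  convert h using 2 with a
  induction l a with
  | nil => rfl
  | cons b l ih => rw [List.any_cons, List.foldr_cons, ← ih]; cases p a b <;> simp

@[fun_prop]
theorem PT.not {p : α → Bool} (hp : PT p) : PT fun a => !(p a) := by
  have : PT fun a => if p a = true then false else true := by fun_prop
  convert this using 2 with a
  cases p a <;> rfl

@[fun_prop]
theorem PT.and {p q : α → Bool} (hp : PT p) (hq : PT q) : PT fun a => p a && q a := by
  have : PT fun a => if p a = true then q a else false := by fun_prop
  convert this using 2 with a
  cases p a <;> rfl

@[fun_prop]
theorem PT.all {l : α → List β} {p : α → β → Bool} (hl : PT l)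
    (hp : PT fun x : α × β => p x.1 x.2) : PT fun a => (l a).all (p a) := by
  have : PT fun a => !((l a).any fun b => !(p a b)) := by fun_prop
  convert this using 2 with a
  rw [List.not_any_eq_all_not]; simp

@[fun_prop]
theorem PT.flatten {l : α → List (List β)} (hl : PT l) : PT fun a => (l a).flatten := by
  have h : PT fun a => (l a).foldr (fun b s => b ++ s) [] := by
    refine PT.foldr (g := fun _ b s => b ++ s)
      (B := fun a => sz (l a)) hl (PT.const _) (by fun_prop) hl.2 ?_
    intro a l' hl'
    refine le_trans ?_ (sz_sublist hl'.sublist)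
    clear hl'
    induction l' with
    | nil => exact le_rfl
    | cons b l' ih => rw [List.foldr_cons, sz_append, sz_cons]; omega
  convert h using 2 with a
  induction l a with
  | nil => rfl
  | cons b l ih => rw [List.flatten_cons, List.foldr_cons, ih]

@[fun_prop]
theorem PT.flatMap {l : α → List β} {f : α → β → List γ} (hl : PT l)
    (hf : PT fun x : α × β => f x.1 x.2) : PT fun a => (l a).flatMap (f a) := by
  have : PT fun a => ((l a).map (f a)).flatten := by fun_prop
  simpa only [← List.flatMap_def] using this

@[fun_prop]
theorem PT.succ {f : α → ℕ} (hf : PT f) : PT fun x => f x + 1 :=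
  ((PT.const (α := α) ()).pair hf).of_enc (fun x => x) (fun _ => rfl) (fun _ => rfl)

@[fun_prop]
theorem PT.length {l : α → List β} (hl : PT l) : PT fun a => (l a).length := by
  have h : PT fun a => (l a).foldr (fun _ s => s + 1) 0 := by
    refine PT.foldr (g := fun _ _ s => s + 1)
      (B := fun a => sz (l a)) hl (PT.const _) (by fun_prop) hl.2 ?_
    intro a l' hl'
    rw [foldr_succ, sz_nat]
    exact (length_le_sz l').trans (sz_sublist hl'.sublist)
  simpa only [foldr_succ] using h

theorem enc_replicate_unit (n : ℕ) : enc n = enc (List.replicate n ()) := by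
  induction n with
  | zero => rfl
  | succ n ih => rw [enc_nat_succ, List.replicate_succ, enc_list_cons, ← ih]; rfl

theorem PT.replicate {f : α → ℕ} (hf : PT f) : PT fun a => List.replicate (f a) () :=
  hf.of_enc (fun x => x) (fun _ => rfl) fun _ => (enc_replicate_unit _).symm

theorem PT.list_drop {l : α → List β} {f : α → ℕ} (hl : PT l) (hf : PT f) :
    PT fun a => (l a).drop (f a) := by
  have h : PT fun a => (List.replicate (f a) ()).foldr (fun _ s => s.tail) (l a) := by
    refine PT.foldr (g := fun _ _ s => s.tail)
      (B := fun a => sz (l a)) hf.replicate hl (by fun_prop) hl.2 ?_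
    intro a l' _
    rw [List.foldr_const]
    refine sz_sublist ?_
    induction l'.length with
    | zero => simp
    | succ n ih => rw [Function.iterate_succ_apply']; exact (List.tail_sublist _).trans ih
  convert h using 2 with a
  rw [List.foldr_const, List.length_replicate]
  induction f a with
  | zero => simp
  | succ n ih => rw [Function.iterate_succ_apply', ← ih, List.tail_drop]

attribute [fun_prop] PT.list_drop

@[fun_prop]
theorem PT.sub {f g : α → ℕ} (hf : PT f) (hg : PT g) : PT fun a => f a - g a := by
  have h : PT fun a => ((List.replicate (f a) ()).drop (g a)).length :=
    (hf.replicate.list_drop hg).length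
  simpa using h

@[fun_prop]
theorem PT.lt {f g : α → ℕ} (hf : PT f) (hg : PT g) : PT fun a => decide (f a < g a) := by
  have h : PT fun a => if List.replicate (g a - f a) () = [] then false else true :=
    PT.ite_nil (hg.sub hf).replicate (PT.const _) (PT.const _)
  convert h using 2 with a
  by_cases h : f a < g a
  · rw [if_neg (by simp; omega)]; simpa using h
  · rw [if_pos (by simp; omega)]; simpa using h

@[fun_prop]
theorem PT.natEq {f g : α → ℕ} (hf : PT f) (hg : PT g) : PT fun a => decide (f a = g a) := by
  have h : PT fun a => !(decide (f a < g a)) && !(decide (g a < f a)) := by fun_prop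
  convert h using 2 with a
  by_cases h : f a = g a
  · simp [h]
  · rcases Nat.lt_or_gt_of_ne h with h | h <;> simp [h, h.ne, h.ne']

@[fun_prop]
theorem PT.add {f g : α → ℕ} (hf : PT f) (hg : PT g) : PT fun a => f a + g a := by
  have h : PT fun a => (List.replicate (f a) () ++ List.replicate (g a) ()).length :=
    (hf.replicate.append hg.replicate).length
  simpa using h

@[fun_prop]
theorem PT.isSome {o : α → Option β} (ho : PT o) : PT fun a => (o a).isSome := by
  have h : PT (fun o : Option β => o.isSome) := by
    refine ⟨⟨Prog.cond Prog.id (Prog.cons Prog.nil Prog.nil) Prog.nil, fun _ => 5, PB.const 5,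
      fun O F x => ?_⟩, (PB.const 1).mono fun _ => sz_bool_le _⟩
    cases x with
    | none => exact ⟨_, by norm_num, Eval.cond_false F _ _ _ _ _ _ _ (Eval.id F _) (Eval.nil F _)⟩
    | some b => exact ⟨_, by norm_num, Eval.cond_true F _ _ _ _ _ _ _ _ _ (Eval.id F _)
        (Eval.cons F _ _ _ _ _ _ _ (Eval.nil F _) (Eval.nil F _))⟩
  exact h.comp ho

@[fun_prop]
theorem PT.optionGetD {o : α → Option β} {g : α → β} (ho : PT o) (hg : PT g) :
    PT fun a => (o a).getD (g a) := by
  have h : PT fun a => ((o a).elim [] fun b => [b]).headD (g a) := by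
    refine PT.headD ?_ hg
    have h : PT (fun o : Option β => (o.elim [] fun b => [b])) := by
      refine ⟨⟨Prog.cond Prog.id (Prog.cons Prog.tl Prog.nil) Prog.nil, fun _ => 5, PB.const 5,
        fun O F x => ?_⟩, PB.size.mono fun o => ?_⟩
      · cases x with
        | none =>
          exact ⟨_, by norm_num, Eval.cond_false F _ _ _ _ _ _ _ (Eval.id F _) (Eval.nil F _)⟩
        | some b => exact ⟨_, by norm_num, Eval.cond_true F _ _ _ _ _ _ _ _ _ (Eval.id F _)
            (Eval.cons F _ _ _ _ _ _ _ (Eval.tl_cons F _ _) (Eval.nil F _))⟩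
      · cases o with
        | none => exact Nat.zero_le _
        | some b => simp only [Option.elim_some, sz_cons, sz_some, sz_nil]; omega
    exact h.comp ho
  convert h using 2 with a
  cases o a <;> rfl

@[fun_prop]
theorem PT.head? {l : α → List β} (hl : PT l) : PT fun a => (l a).head? := by
  have h : PT (fun l : List β => l.head?) := by
    refine ⟨⟨Prog.cond Prog.id (Prog.cons Prog.nil Prog.hd) Prog.nil, fun _ => 5, PB.const 5,
      fun O F x => ?_⟩, PB.size.mono fun o => ?_⟩
    · cases x with
      | nil =>
        exact ⟨_, by norm_num, Eval.cond_false F _ _ _ _ _ _ _ (Eval.id F _) (Eval.nil F _)⟩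
      | cons b l => exact ⟨_, by norm_num, Eval.cond_true F _ _ _ _ _ _ _ _ _ (Eval.id F _)
          (Eval.cons F _ _ _ _ _ _ _ (Eval.nil F _) (Eval.hd_cons F _ _))⟩
    · cases o with
      | nil => exact Nat.zero_le _
      | cons b l => simp only [List.head?_cons, sz_cons, sz_some]; omega
  exact h.comp hl

/-- The numbers `n - 1, …, 0`. -/
def downFrom : ℕ → List ℕ
  | 0 => []
  | n + 1 => n :: downFrom n

theorem mem_downFrom {n i : ℕ} : i ∈ downFrom n ↔ i < n := by
  induction n with
  | zero => simp [downFrom]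
  | succ n ih => rw [downFrom, List.mem_cons, ih]; omega

theorem length_downFrom (n : ℕ) : (downFrom n).length = n := by
  induction n with
  | zero => rfl
  | succ n ih => rw [downFrom, List.length_cons, ih]

theorem nodup_downFrom (n : ℕ) : (downFrom n).Nodup := by
  induction n with
  | zero => simp [downFrom]
  | succ n ih => rw [downFrom, List.nodup_cons, mem_downFrom]; exact ⟨by omega, ih⟩

@[fun_prop]
theorem PT.downFrom {f : α → ℕ} (hf : PT f) : PT fun a => downFrom (f a) := by
  have key : ∀ n, (List.replicate n ()).foldr (fun _ s => s.length :: s) ([] : List ℕ)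
      = NoisyCographs.downFrom n := by
    intro n
    induction n with
    | zero => rfl
    | succ n ih =>
      rw [List.replicate_succ, List.foldr_cons, ih, length_downFrom]; rfl
  have h : PT fun a => (List.replicate (f a) ()).foldr (fun _ s => s.length :: s)
      ([] : List ℕ) := by
    refine PT.foldr (g := fun _ _ s => s.length :: s)
      (B := fun a => sz (f a) * (sz (f a) + 1)) hf.replicate (PT.const _) (by fun_prop)
      (hf.2.mul (hf.2.add (PB.const 1))) fun a l' hl' => ?_
    have e : l' = List.replicate l'.length () := List.eq_replicate_of_mem fun _ _ => rfl
    have e' := hl'.length_le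
    rw [List.length_replicate] at e'
    rw [e, key, sz_nat]
    refine (sz_list_le (m := f a) fun i hi => ?_).trans ?_
    · rw [sz_nat]; rw [mem_downFrom] at hi; omega
    · rw [length_downFrom]; exact Nat.mul_le_mul_right _ e'
  simpa only [key] using h

end Lists

end NoisyCographs

namespace NoisyCographs
open Enc

/-! ### The elementary functions used by the algorithm -/

/-- Position of `x` in `l` (the length of `l` if `x` does not occur). -/
def pos (x : ℕ) (l : List ℕ) : ℕ :=
  l.foldr (fun y s => if decide (y = x) = true then 0 else s + 1) 0

/-- Adjacency, read off the adjacency matrix. -/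
def adjM (M : List (List Bool)) (u v : ℕ) : Bool := (((M.drop u).headD []).drop v).headD false

/-- The vertices of `l` that are not adjacent to `u`. -/
def nonAdj (M : List (List Bool)) (u : ℕ) (l : List ℕ) : List ℕ := l.filter fun w => !adjM M u w

/-- The vertices of `l` that are different from `u` and not adjacent to `u`. -/
def away (M : List (List Bool)) (u : ℕ) (l : List ℕ) : List ℕ :=
  l.filter fun w => !adjM M u w && !decide (w = u)

/-- The vertices of `l` that lie in none of the sets in `P`. -/
def avoid (l : List ℕ) (P : List (List ℕ)) : List ℕ :=
  l.filter fun u => !(P.flatten.any fun v => decide (v = u))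

/-- There are no edges between `p` and `q`. -/
def compat (M : List (List Bool)) (p q : List ℕ) : Bool := p.all fun u => q.all fun v => !adjM M u v

/-- The first `n` sublists of `Z`, in a certain order. -/
def subs (Z : List ℕ) (n : ℕ) : List (List ℕ) :=
  Z.foldr (fun z L => (L ++ L.map fun s => z :: s).drop ((L ++ L.map fun s => z :: s).length - n))
    [[]]

/-- The vertices that an independent set containing `v ∈ A` and `w ∈ B` may have. -/
def cross (M : List (List Bool)) (A B R : List ℕ) (v w : ℕ) : List ℕ :=
  nonAdj M w A ++ nonAdj M v B ++ R

/-- The vertices of `X` with label `a`. -/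
def part (X L : List ℕ) (a : ℕ) : List ℕ :=
  X.filter fun x => decide ((L.drop (pos x X)).headD 3 = a)

/-- A state of the search in a sparse tripartition: `S` is the partial solution, `A`, `B` and `R`
are the vertices that are still available; we look for `i` vertices in `A` and `j` vertices in `B`;
`P` and `Q` are the independent sets found in `A` and in `B` so far. -/
structure Item where
  A : List ℕ
  B : List ℕ
  R : List ℕ
  S : List ℕ
  i : ℕ
  j : ℕ
  P : List (List ℕ)
  Q : List (List ℕ)

instance : Enc Item := ⟨fun x => enc (x.A, x.B, x.R, x.S, x.i, x.j, x.P, x.Q)⟩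

/-- An adjacency matrix and a parameter. -/
abbrev Env : Type := List (List Bool) × ℕ

/-- Arguments of the main function: look for an independent set of a given size in a given set of
vertices. -/
abbrev MIn : Type := Bool × Env × List ℕ × ℕ

/-- Arguments of the search function. -/
abbrev WIn : Type := Bool × Env × List Item

/-- The states with partial solution `S` and target `r`, before any query. -/
def fresh (A B R S : List ℕ) (r : ℕ) : List Item :=
  (downFrom (r + 1)).map fun i => ⟨A, B, R, S, i, r - i, [], []⟩

/-- The states in which one more vertex has been chosen. -/
def children (M : List (List Bool)) (it : Item) : List Item :=
  (it.P.flatten ++ it.Q.flatten ++ it.R).flatMap fun u =>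
    fresh (away M u it.A) (away M u it.B) (away M u it.R) (u :: it.S) (it.i + it.j - 1)

/-- The solutions that combine one of the sets found in `A` with one of the sets found in `B`. -/
def combos (M : List (List Bool)) (S : List ℕ) (P Q : List (List ℕ)) : List (List ℕ) :=
  P.flatMap fun p => (Q.filter fun q => compat M p q).map fun q => S ++ p ++ q

def Item.extend (it : Item) (p q : List ℕ) : Item :=
  ⟨it.A, it.B, it.R, it.S, it.i, it.j, p :: it.P, q :: it.Q⟩

section ItemPT

variable {α : Type} [Enc α]

/-- The components of a state. -/
def Item.toProd (x : Item) : List ℕ × List ℕ × List ℕ × List ℕ × ℕ × ℕ × List (List ℕ) ×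
    List (List ℕ) := (x.A, x.B, x.R, x.S, x.i, x.j, x.P, x.Q)

theorem PT.toProd {f : α → Item} (hf : PT f) : PT fun x => (f x).toProd :=
  hf.of_enc (fun x => x) (fun _ => rfl) (fun _ => rfl)

@[fun_prop] theorem PT.itemA {f : α → Item} (hf : PT f) : PT fun x => (f x).A :=
  PT.fst.comp (hf.toProd)
@[fun_prop] theorem PT.itemB {f : α → Item} (hf : PT f) : PT fun x => (f x).B :=
  PT.fst.comp (PT.snd.comp hf.toProd)
@[fun_prop] theorem PT.itemR {f : α → Item} (hf : PT f) : PT fun x => (f x).R :=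
  PT.fst.comp (PT.snd.comp (PT.snd.comp hf.toProd))
@[fun_prop] theorem PT.itemS {f : α → Item} (hf : PT f) : PT fun x => (f x).S :=
  PT.fst.comp (PT.snd.comp (PT.snd.comp (PT.snd.comp hf.toProd)))
@[fun_prop] theorem PT.itemi {f : α → Item} (hf : PT f) : PT fun x => (f x).i :=
  PT.fst.comp (PT.snd.comp (PT.snd.comp (PT.snd.comp (PT.snd.comp hf.toProd))))
@[fun_prop] theorem PT.itemj {f : α → Item} (hf : PT f) : PT fun x => (f x).j :=
  PT.fst.comp (PT.snd.comp (PT.snd.comp (PT.snd.comp (PT.snd.comp (PT.snd.comp hf.toProd)))))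
@[fun_prop] theorem PT.itemP {f : α → Item} (hf : PT f) : PT fun x => (f x).P :=
  PT.fst.comp (PT.snd.comp (PT.snd.comp (PT.snd.comp (PT.snd.comp (PT.snd.comp
      (PT.snd.comp hf.toProd))))))
@[fun_prop] theorem PT.itemQ {f : α → Item} (hf : PT f) : PT fun x => (f x).Q :=
  PT.snd.comp (PT.snd.comp (PT.snd.comp (PT.snd.comp (PT.snd.comp (PT.snd.comp
      (PT.snd.comp hf.toProd))))))

@[fun_prop]
theorem PT.itemMk {A B R S : α → List ℕ} {i j : α → ℕ} {P Q : α → List (List ℕ)} (hA : PT A)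
    (hB : PT B) (hR : PT R) (hS : PT S) (hi : PT i) (hj : PT j) (hP : PT P) (hQ : PT Q) :
    PT fun x => Item.mk (A x) (B x) (R x) (S x) (i x) (j x) (P x) (Q x) := by
  have : PT fun x => (A x, B x, R x, S x, i x, j x, P x, Q x) := by fun_prop
  exact this.of_enc (fun x => x) (fun _ => rfl) (fun _ => rfl)

end ItemPT

section FunctionsPT

variable {α : Type} [Enc α]

@[fun_prop]
theorem PT.pos {f : α → ℕ} {l : α → List ℕ} (hf : PT f) (hl : PT l) :
    PT fun a => pos (f a) (l a) := by
  unfold NoisyCographs.pos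
  refine PT.foldr (g := fun a y s => if decide (y = f a) = true then 0 else s + 1)
    (B := fun a => sz (l a)) hl (PT.const _) ?_ hl.2 fun a l' hl' => ?_
  · exact PT.ite (by fun_prop) (by fun_prop) (by fun_prop)
  · refine le_trans ?_ (sz_sublist hl'.sublist)
    clear hl'
    induction l' with
    | nil => exact le_rfl
    | cons b l' ih =>
      rw [List.foldr_cons, sz_cons]
      split_ifs
      · exact Nat.zero_le _
      · rw [sz_nat] at ih ⊢; omega

@[fun_prop]
theorem PT.adjM {M : α → List (List Bool)} {u v : α → ℕ} (hM : PT M) (hu : PT u) (hv : PT v) :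
    PT fun a => adjM (M a) (u a) (v a) := by unfold NoisyCographs.adjM; fun_prop

@[fun_prop]
theorem PT.nonAdj {M : α → List (List Bool)} {u : α → ℕ} {l : α → List ℕ} (hM : PT M) (hu : PT u)
    (hl : PT l) : PT fun a => nonAdj (M a) (u a) (l a) := by unfold NoisyCographs.nonAdj; fun_prop

@[fun_prop]
theorem PT.away {M : α → List (List Bool)} {u : α → ℕ} {l : α → List ℕ} (hM : PT M) (hu : PT u)
    (hl : PT l) : PT fun a => away (M a) (u a) (l a) := by unfold NoisyCographs.away; fun_prop

@[fun_prop]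
theorem PT.avoid {l : α → List ℕ} {P : α → List (List ℕ)} (hl : PT l) (hP : PT P) :
    PT fun a => avoid (l a) (P a) := by unfold NoisyCographs.avoid; fun_prop

@[fun_prop]
theorem PT.compat {M : α → List (List Bool)} {p q : α → List ℕ} (hM : PT M) (hp : PT p)
    (hq : PT q) : PT fun a => compat (M a) (p a) (q a) := by
  unfold NoisyCographs.compat; fun_prop

theorem subs_cons (z : ℕ) (Z : List ℕ) (n : ℕ) : subs (z :: Z) n =
    (subs Z n ++ (subs Z n).map fun s => z :: s).drop
      ((subs Z n ++ (subs Z n).map fun s => z :: s).length - n) := rfl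

theorem length_subs_le (Z : List ℕ) (n : ℕ) : (subs Z n).length ≤ n + 1 := by
  cases Z with
  | nil => simp [subs]
  | cons z Z => rw [subs_cons, List.length_drop]; omega

theorem sublist_of_mem_subs {Z s : List ℕ} {n : ℕ} (h : s ∈ subs Z n) : s.Sublist Z := by
  induction Z generalizing s with
  | nil => simp [subs] at h; simp [h]
  | cons z Z ih =>
    rw [subs_cons] at h
    rcases List.mem_append.1 (List.mem_of_mem_drop h) with h | h
    · exact (ih h).cons z
    · obtain ⟨s', hs', rfl⟩ := List.mem_map.1 h
      exact (ih hs').cons_cons z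

@[fun_prop]
theorem PT.subs {Z : α → List ℕ} {n : α → ℕ} (hZ : PT Z) (hn : PT n) :
    PT fun a => subs (Z a) (n a) := by
  refine PT.foldr (g := fun a z L => (L ++ L.map fun s => z :: s).drop
    ((L ++ L.map fun s => z :: s).length - n a)) (h := fun _ => ([[]] : List (List ℕ)))
    (B := fun a => (sz (n a) + 1) * (sz (Z a) + 1)) hZ (PT.const _) (by fun_prop)
    ((hn.2.add (PB.const 1)).mul (hZ.2.add (PB.const 1))) fun a l' hl' => ?_
  refine (sz_list_le (m := sz (Z a)) fun s hs => ?_).trans (Nat.mul_le_mul_right _ ?_)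
  · exact sz_sublist ((sublist_of_mem_subs (n := n a) hs).trans hl'.sublist)
  · rw [sz_nat]; exact length_subs_le l' (n a)

@[fun_prop]
theorem PT.cross {M : α → List (List Bool)} {A B R : α → List ℕ} {v w : α → ℕ} (hM : PT M)
    (hA : PT A) (hB : PT B) (hR : PT R) (hv : PT v) (hw : PT w) :
    PT fun a => cross (M a) (A a) (B a) (R a) (v a) (w a) := by
  unfold NoisyCographs.cross; fun_prop

@[fun_prop]
theorem PT.part {X L : α → List ℕ} {c : α → ℕ} (hX : PT X) (hL : PT L) (hc : PT c) :
    PT fun a => part (X a) (L a) (c a) := by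
  unfold NoisyCographs.part; fun_prop

@[fun_prop]
theorem PT.fresh {A B R S : α → List ℕ} {r : α → ℕ} (hA : PT A) (hB : PT B) (hR : PT R)
    (hS : PT S) (hr : PT r) : PT fun a => fresh (A a) (B a) (R a) (S a) (r a) := by
  unfold NoisyCographs.fresh; fun_prop

@[fun_prop]
theorem PT.children {M : α → List (List Bool)} {it : α → Item} (hM : PT M) (hi : PT it) :
    PT fun a => children (M a) (it a) := by
  unfold NoisyCographs.children; fun_prop

@[fun_prop]
theorem PT.combos {M : α → List (List Bool)} {S : α → List ℕ} {P Q : α → List (List ℕ)}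
    (hM : PT M) (hS : PT S) (hP : PT P) (hQ : PT Q) :
    PT fun a => combos (M a) (S a) (P a) (Q a) := by
  unfold NoisyCographs.combos; fun_prop

@[fun_prop]
theorem PT.extend {it : α → Item} {p q : α → List ℕ} (hi : PT it) (hp : PT p) (hq : PT q) :
    PT fun a => (it a).extend (p a) (q a) := by
  unfold Item.extend; fun_prop

end FunctionsPT

/-! ### The steps of the algorithm -/

/-- The call of the main function for vertex set `X` and target `t`. -/
def mIn (e : Env) (X : List ℕ) (t : ℕ) : MIn := (false, e, X, t)

/-- The call of the search function. -/
def wIn (e : Env) (l : List Item) : WIn := (true, e, l)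

def baseFlag (x : MIn) : Bool :=
  if decide (x.2.2.2 = 0) = true then true else decide (x.2.2.1.length < 2)

def baseResult (x : MIn) : Option (List ℕ) :=
  if decide (x.2.2.2 = 0) = true then some []
  else if decide (x.2.2.2 = x.2.2.1.length) = true then some x.2.2.1 else none

/-- The induced subgraph for which a tripartition is requested. -/
def subInstance (x : MIn) : Env :=
  (x.2.2.1.map fun u => x.2.2.1.map fun v => adjM x.2.1.1 u v, x.2.1.2)

/-- Do all independent sets that meet both `A` and `B` lie in logarithmically small sets? -/
def bicFlag (y : MIn × List ℕ) : Bool :=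
  (part y.1.2.2.1 y.2 0).all fun v => (part y.1.2.2.1 y.2 1).all fun w =>
    decide ((subs (cross y.1.2.1.1 (part y.1.2.2.1 y.2 0) (part y.1.2.2.1 y.2 1)
      (part y.1.2.2.1 y.2 2) v w) y.1.2.2.1.length).length < y.1.2.2.1.length)

/-- Exhaustive search for an independent set that meets both `A` and `B`. -/
def brute (y : MIn × List ℕ) : Option (List ℕ) :=
  ((part y.1.2.2.1 y.2 0).flatMap fun v => (part y.1.2.2.1 y.2 1).flatMap fun w =>
    (subs (cross y.1.2.1.1 (part y.1.2.2.1 y.2 0) (part y.1.2.2.1 y.2 1)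
      (part y.1.2.2.1 y.2 2) v w) y.1.2.2.1.length).filter fun I =>
        decide (I.length = y.1.2.2.2) && compat y.1.2.1.1 I I).head?

/-- The recursive call for one of the two sides, together with `R`. -/
def side (c : ℕ) (y : MIn × List ℕ) : MIn :=
  mIn y.1.2.1 (part y.1.2.2.1 y.2 c ++ part y.1.2.2.1 y.2 2) y.1.2.2.2

/-- The search in a sparse tripartition. -/
def startSearch (y : MIn × List ℕ) : WIn :=
  wIn y.1.2.1 (fresh (part y.1.2.2.1 y.2 0) (part y.1.2.2.1 y.2 1) (part y.1.2.2.1 y.2 2) []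
    y.1.2.2.2)

def queryA (y : Env × Item) : MIn := mIn y.1 (avoid y.2.A y.2.P) y.2.i
def queryB (y : Env × Item) : MIn := mIn y.1 (avoid y.2.B y.2.Q) y.2.j

/-- A state of the search together with the answers to its two queries. -/
abbrev Answered : Type := (Env × Item) × Option (List ℕ) × Option (List ℕ)

/-- A solution obtained from the answers to the two queries. -/
def foundNow (y : Answered) : Option (List ℕ) :=
  if y.2.1.isSome && y.2.2.isSome then
    (combos y.1.1.1 y.1.2.S (y.2.1.getD [] :: y.1.2.P) (y.2.2.getD [] :: y.1.2.Q)).head?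
  else none

/-- The states to be explored after the answers to the two queries. -/
def exploreNext (y : Answered) : WIn :=
  wIn y.1.1 (if y.2.1.isSome && y.2.2.isSome then
    [y.1.2.extend (y.2.1.getD []) (y.2.2.getD [])]
  else children y.1.1.1 y.1.2)

theorem PT.baseFlag : PT baseFlag := by unfold NoisyCographs.baseFlag; fun_prop
theorem PT.baseResult : PT baseResult := by unfold NoisyCographs.baseResult; fun_prop
theorem PT.subInstance : PT subInstance := by unfold NoisyCographs.subInstance; fun_prop
theorem PT.bicFlag : PT bicFlag := by unfold NoisyCographs.bicFlag; fun_prop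
theorem PT.brute : PT brute := by unfold NoisyCographs.brute; fun_prop
theorem PT.side (c : ℕ) : PT (side c) := by
  unfold NoisyCographs.side NoisyCographs.mIn; fun_prop
theorem PT.startSearch : PT startSearch := by
  unfold NoisyCographs.startSearch NoisyCographs.wIn; fun_prop
theorem PT.queryA : PT queryA := by
  unfold NoisyCographs.queryA NoisyCographs.mIn; fun_prop
theorem PT.queryB : PT queryB := by
  unfold NoisyCographs.queryB NoisyCographs.mIn; fun_prop
theorem PT.foundNow : PT foundNow := by unfold NoisyCographs.foundNow; fun_prop
theorem PT.exploreNext : PT exploreNext := by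
  unfold NoisyCographs.exploreNext NoisyCographs.wIn; fun_prop

end NoisyCographs

namespace NoisyCographs
open Finset

/-! ### Sparse pairs of vertex sets -/

section Sparse

variable {V : Type} (Γ : SimpleGraph V)

/-- The bipartite graph between `A` and `B` contains no `K_{d,d}`. -/
def BicliqueFree (d : ℕ) (A B : Finset V) : Prop :=
  ¬ ∃ X Y : Finset V, X ⊆ A ∧ Y ⊆ B ∧ #X = d ∧ #Y = d ∧ ∀ x ∈ X, ∀ y ∈ Y, Γ.Adj x y

variable {Γ}

theorem BicliqueFree.symm {d : ℕ} {A B : Finset V} (h : BicliqueFree Γ d A B) :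
    BicliqueFree Γ d B A := by
  rintro ⟨X, Y, hX, hY, hXc, hYc, hadj⟩
  exact h ⟨Y, X, hY, hX, hYc, hXc, fun x hx y hy => (hadj y hy x hx).symm⟩

theorem BicliqueFree.mono {d d' : ℕ} {A B A' B' : Finset V} (h : BicliqueFree Γ d A B)
    (hd : d ≤ d') (hA : A' ⊆ A) (hB : B' ⊆ B) : BicliqueFree Γ d' A' B' := by
  rintro ⟨X, Y, hX, hY, hXc, hYc, hadj⟩
  obtain ⟨X', hX', hXc'⟩ := exists_subset_card_eq (hd.trans hXc.ge)
  obtain ⟨Y', hY', hYc'⟩ := exists_subset_card_eq (hd.trans hYc.ge)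
  exact h ⟨X', Y', hX'.trans (hX.trans hA), hY'.trans (hY.trans hB), hXc', hYc',
    fun x hx y hy => hadj x (hX' hx) y (hY' hy)⟩

/-- In a `K_{d,d}`-free pair, few vertices have `d` neighbours in a small set. -/
theorem BicliqueFree.card_le [DecidableRel Γ.Adj] [DecidableEq V] {d : ℕ} {Z W : Finset V}
    (h : BicliqueFree Γ d Z W) :
    #(W.filter fun w => d ≤ #(Z.filter (Γ.Adj w))) ≤ d * 2 ^ #Z := by
  by_contra! hlt
  have hex : ∀ w, d ≤ #(Z.filter (Γ.Adj w)) → ∃ X ⊆ Z.filter (Γ.Adj w), #X = d :=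
    fun w hw => exists_subset_card_eq hw
  choose! f hf hfc using hex
  obtain ⟨X, -, hX⟩ := exists_lt_card_fiber_of_mul_lt_card_of_maps_to
    (s := W.filter fun w => d ≤ #(Z.filter (Γ.Adj w))) (t := Z.powerset) (f := f) (n := d)
    (fun w hw => mem_powerset.2 ((hf w (mem_filter.1 hw).2).trans (filter_subset _ _)))
    (by rw [card_powerset, mul_comm]; exact hlt)
  obtain ⟨Y, hY, hYc⟩ := exists_subset_card_eq hX.le
  have hY' : ∀ y ∈ Y, (y ∈ W ∧ d ≤ #(Z.filter (Γ.Adj y))) ∧ f y = X := fun y hy => by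
    simpa using hY hy
  rcases Y.eq_empty_or_nonempty with rfl | ⟨y, hy⟩
  · rw [card_empty] at hYc
    exact h ⟨∅, ∅, by simp, by simp, by simpa using hYc, by simpa using hYc, by simp⟩
  · have hsub : ∀ y ∈ Y, X ⊆ Z.filter (Γ.Adj y) := fun y hy => by
      have := hf y (hY' y hy).1.2
      rwa [(hY' y hy).2] at this
    refine h ⟨X, Y, (hsub y hy).trans (filter_subset _ _), fun y hy => (hY' y hy).1.1, ?_, hYc,
      fun x hx z hz => ((mem_filter.1 (hsub z hz hx)).2).symm⟩
    rw [← (hY' y hy).2]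
    exact hfc y (hY' y hy).1.2

/-- Two families of disjoint small sets in a `K_{d,d}`-free pair cannot be both long if there are
edges between any two of their members. -/
theorem BicliqueFree.card_family_le [DecidableRel Γ.Adj] [DecidableEq V]
    {ι κ : Type} [Fintype ι] [Fintype κ] {d k : ℕ}
    {A B : Finset V} (h : BicliqueFree Γ d A B) (hk : 1 ≤ k) (P : ι → Finset V) (Q : κ → Finset V)
    (hP : ∀ i, P i ⊆ A) (hQ : ∀ j, Q j ⊆ B) (hPk : ∀ i, #(P i) ≤ k) (hQk : ∀ j, #(Q j) ≤ k)
    (hPd : Pairwise fun i j => Disjoint (P i) (P j))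
    (hQd : Pairwise fun i j => Disjoint (Q i) (Q j))
    (hadj : ∀ i j, ∃ u ∈ P i, ∃ v ∈ Q j, Γ.Adj u v) (hι : Fintype.card ι = d * k) :
    Fintype.card κ ≤ d * 2 ^ (d * k * k) := by
  have hd : d ≠ 0 := by
    rintro rfl
    exact h ⟨∅, ∅, by simp, by simp, by simp, by simp, by simp⟩
  set Z : Finset V := univ.biUnion P with hZ
  have hZA : Z ⊆ A := biUnion_subset.2 fun i _ => hP i
  have hZc : #Z ≤ d * k * k := by
    refine (card_biUnion_le_card_mul _ _ k fun i _ => hPk i).trans ?_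
    rw [card_univ, hι]
  have key : ∀ j, ∃ y ∈ Q j, d ≤ #(Z.filter (Γ.Adj y)) := by
    intro j
    choose u hu v hv huv using fun i => hadj i j
    have hpos : 0 < Fintype.card ι := by rw [hι]; positivity
    obtain ⟨i0⟩ := Fintype.card_pos_iff.1 hpos
    obtain ⟨y, hy, hyc⟩ := exists_le_card_fiber_of_mul_le_card_of_maps_to
      (s := (univ : Finset ι)) (t := Q j) (f := v) (n := d) (fun i _ => hv i) ⟨v i0, hv i0⟩
      (by rw [card_univ, hι, mul_comm]; exact Nat.mul_le_mul_left _ (hQk j))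
    refine ⟨y, hy, hyc.trans ?_⟩
    refine card_le_card_of_injOn u (fun i hi => ?_) fun i _ i' _ hii => ?_
    · have hi' : v i = y := by simpa using hi
      simp only [coe_filter, Set.mem_ofPred_eq]
      exact ⟨mem_biUnion.2 ⟨i, mem_univ _, hu i⟩, hi' ▸ (huv i).symm⟩
    · by_contra hne
      exact (disjoint_left.1 (hPd hne)) (hu i) (hii ▸ hu i')
  choose y hy hyd using key
  have hinj : Function.Injective y := by
    intro j j' hjj
    by_contra hne
    exact (disjoint_left.1 (hQd hne)) (hy j) (hjj ▸ hy j')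
  have := (h.mono le_rfl hZA Subset.rfl).card_le
  rw [← card_univ]
  refine (card_le_card_of_injOn y (fun j _ => ?_) hinj.injOn).trans
    (this.trans (Nat.mul_le_mul_left _ (Nat.pow_le_pow_right (by norm_num) hZc)))
  simp only [coe_filter, Set.mem_ofPred_eq]
  exact ⟨hQ j (hy j), hyd j⟩

variable (Γ)

/-- Below `X` there is a descending chain of `l` sparse separations: from each set of the chain we
split off a set `Z` to which all but `e` vertices of the next set are weakly attached. -/
def DownChain [DecidableRel Γ.Adj] (k e : ℕ) : ℕ → Finset V → Prop
  | 0, _ => True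
  | l + 1, X => ∃ (Z E Y : Finset V) (c : ℕ), Z ⊆ X ∧ Y ⊆ X ∧ Disjoint Z Y ∧ k * c < #Z ∧
      #E ≤ e ∧ (∀ x ∈ Y, x ∉ E → #(Z.filter (Γ.Adj x)) ≤ c) ∧ DownChain k e l Y

variable {Γ}

theorem DownChain.mono [DecidableRel Γ.Adj] {k e l : ℕ} {X X' : Finset V}
    (h : DownChain Γ k e l X) (hX : X ⊆ X') :
    DownChain Γ k e l X' := by
  cases l with
  | zero => trivial
  | succ l =>
    obtain ⟨Z, E, Y, c, hZ, hY, h'⟩ := h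
    exact ⟨Z, E, Y, c, hZ.trans hX, hY.trans hX, h'⟩

theorem DownChain.exists_indep [DecidableRel Γ.Adj] [DecidableEq V] {k e l : ℕ} : ∀
    {X W : Finset V} {j : ℕ}, DownChain Γ k e l X →
    j * (e + 1) + #W ≤ l → j ≤ k + 1 →
    ∃ I : Finset V, I ⊆ X ∧ Disjoint I W ∧ #I = j ∧ ∀ u ∈ I, ∀ v ∈ I, ¬ Γ.Adj u v := by
  induction l with
  | zero =>
    intro X W j _ hl _
    have : j = 0 := by
      rcases Nat.eq_zero_or_pos j with h | h
      · exact h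
      · have := Nat.mul_le_mul h (Nat.le_add_left 1 e); omega
    exact ⟨∅, by simp, by simp, by simp [this], by simp⟩
  | succ l ih =>
    intro X W j h hl hj
    rcases Nat.eq_zero_or_pos j with rfl | hj0
    · exact ⟨∅, by simp, by simp, by simp, by simp⟩
    obtain ⟨Z, E, Y, c, hZ, hY, hZY, hc, hE, hdeg, hch⟩ := h
    by_cases hZW : Disjoint Z W
    · obtain ⟨j, rfl⟩ : ∃ j', j = j' + 1 := ⟨j - 1, by omega⟩
      have hcard : #(W ∪ E) ≤ #W + e := (card_union_le _ _).trans (by omega)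
      obtain ⟨I, hI, hIW, hIc, hind⟩ := ih (W := W ∪ E) (j := j) hch
        (by rw [Nat.add_mul] at hl; omega) (by omega)
      have hIE : ∀ x ∈ I, x ∉ E := fun x hx hxE =>
        disjoint_left.1 hIW hx (mem_union_right _ hxE)
      have hbad : #(I.biUnion fun x => Z.filter (Γ.Adj x)) < #Z := by
        refine lt_of_le_of_lt (card_biUnion_le_card_mul I _ c fun x hx =>
          hdeg x (hI hx) (hIE x hx)) (lt_of_le_of_lt (Nat.mul_le_mul_right c ?_) hc)
        omega
      obtain ⟨z, hz, hzn⟩ := exists_mem_notMem_of_card_lt_card hbad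
      have hzn' : ∀ x ∈ I, ¬ Γ.Adj x z := fun x hx hxz =>
        hzn (mem_biUnion.2 ⟨x, hx, mem_filter.2 ⟨hz, hxz⟩⟩)
      have hzI : z ∉ I := fun hzI => disjoint_left.1 hZY hz (hI hzI)
      refine ⟨insert z I, insert_subset (hZ hz) (hI.trans hY), ?_, ?_, ?_⟩
      · rw [disjoint_insert_left]
        exact ⟨disjoint_left.1 hZW hz, hIW.mono_right subset_union_left⟩
      · rw [card_insert_of_notMem hzI, hIc]
      · intro u hu v hv
        rcases mem_insert.1 hu with rfl | hu <;> rcases mem_insert.1 hv with h | hv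
        · exact h ▸ Γ.loopless.irrefl _
        · exact fun h => hzn' v hv h.symm
        · exact h ▸ hzn' u hu
        · exact hind u hu v hv
    · obtain ⟨w, hwZ, hwW⟩ := not_disjoint_iff.1 hZW
      have hlt : #(W.filter (· ∈ Y)) < #W := by
        refine card_lt_card ((ssubset_iff_of_subset (filter_subset _ _)).2 ⟨w, hwW, ?_⟩)
        intro hw
        exact disjoint_left.1 hZY hwZ (mem_filter.1 hw).2
      obtain ⟨I, hI, hIW, hIc, hind⟩ := ih (W := W.filter (· ∈ Y)) (j := j) hch (by omega) hj
      refine ⟨I, hI.trans hY, ?_, hIc, hind⟩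
      rw [disjoint_left] at hIW ⊢
      exact fun x hx hxW => hIW hx (mem_filter.2 ⟨hxW, hI hx⟩)

variable (Γ)

/-- The sparse separations of two sets of vertices. -/
def SparseCond [DecidableRel Γ.Adj] (k d : ℕ) (A B : Finset V) : Sparsity → Prop
  | Sparsity.almostDisconnected => (∀ v ∈ A, #(B.filter (Γ.Adj v)) ≤ d) ∧
      ∀ v ∈ B, #(A.filter (Γ.Adj v)) ≤ d
  | Sparsity.oneSidedAlmostDisconnected => k * d < #B ∧ ∀ v ∈ A, #(B.filter (Γ.Adj v)) ≤ d
  | Sparsity.weaklyConnected => d ^ d * k ^ (2 * d - 1) + 1 < #A ∧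
      d ^ d * k ^ (2 * d - 1) + 1 < #B ∧ BicliqueFree Γ d A B

variable {Γ}

theorem SparseCond.bicliqueFree [DecidableRel Γ.Adj] {k d : ℕ} {A B : Finset V} {S : Sparsity}
    (h : SparseCond Γ k d A B S) : BicliqueFree Γ (d + 1) A B := by
  have key : (∀ v ∈ A, #(B.filter (Γ.Adj v)) ≤ d) → BicliqueFree Γ (d + 1) A B := by
    rintro hd ⟨X, Y, hX, hY, hXc, hYc, hadj⟩
    obtain ⟨x, hx⟩ : X.Nonempty := card_pos.1 (by omega)
    have : Y ⊆ B.filter (Γ.Adj x) := fun y hy => mem_filter.2 ⟨hY hy, hadj x hx y hy⟩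
    have := (card_le_card this).trans (hd x (hX hx))
    omega
  cases S with
  | almostDisconnected => exact key h.1
  | oneSidedAlmostDisconnected => exact key h.2
  | weaklyConnected => exact h.2.2.mono (Nat.le_succ d) Subset.rfl Subset.rfl

theorem downChain_of_vertex [DecidableRel Γ.Adj] {k d e l : ℕ} {X Y : Finset V} {u : V}
    (hu : u ∈ X) (hY : Y ⊆ X)
    (huY : u ∉ Y) (hd : #(Y.filter (Γ.Adj u)) ≤ d) (he : d ≤ e) (h : DownChain Γ k e l Y) :
    DownChain Γ k e (l + 1) X := by
  refine ⟨{u}, Y.filter (Γ.Adj u), Y, 0, by simpa using hu, hY, by simpa using huY, by simp,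
    hd.trans he, fun x hx hxE => ?_, h⟩
  rw [nonpos_iff_eq_zero, card_eq_zero, filter_eq_empty_iff]
  intro z hz hxz
  rw [mem_singleton] at hz
  subst hz
  exact hxE (mem_filter.2 ⟨hx, hxz.symm⟩)

theorem downChain_of_bicliqueFree [DecidableRel Γ.Adj] [DecidableEq V] {k d l : ℕ}
    {X Y Z : Finset V} (hZ : Z ⊆ X) (hY : Y ⊆ X)
    (hZY : Disjoint Z Y) (hk : 1 ≤ k) (hc : k * d ≤ #Z) (hf : BicliqueFree Γ d Z Y)
    (h : DownChain Γ k (d * 2 ^ (k * d)) l Y) : DownChain Γ k (d * 2 ^ (k * d)) (l + 1) X := by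
  obtain ⟨Z', hZ', hZc⟩ := exists_subset_card_eq hc
  have hd : d ≠ 0 := by
    rintro rfl
    exact hf ⟨∅, ∅, by simp, by simp, by simp, by simp, by simp⟩
  refine ⟨Z', Y.filter fun w => d ≤ #(Z'.filter (Γ.Adj w)), Y, d - 1, hZ'.trans hZ, hY,
    hZY.mono_left hZ', ?_, ?_, fun x hx hxE => ?_, h⟩
  · rw [hZc]
    exact Nat.mul_lt_mul_of_pos_left (by omega) (by omega)
  · rw [← hZc]
    exact (hf.mono le_rfl hZ' Subset.rfl).card_le
  · by_contra! hlt
    exact hxE (mem_filter.2 ⟨hx, by omega⟩)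

theorem mul_le_weak_bound {k d : ℕ} (hd : d ≠ 0) :
    k * d ≤ d ^ d * k ^ (2 * d - 1) + 1 := by
  have h1 : d ≤ d ^ d := Nat.le_self_pow hd d
  have h2 : k ≤ k ^ (2 * d - 1) := Nat.le_self_pow (by omega) k
  have := Nat.mul_le_mul h1 h2
  rw [mul_comm]; omega

theorem SparseCond.downChain [DecidableRel Γ.Adj] [DecidableEq V] {k d l : ℕ}
    {A B X Y : Finset V} {S : Sparsity}
    (h : SparseCond Γ k d A B S) (hk : 1 ≤ k) (hA : A.Nonempty) (hB : B.Nonempty)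
    (hAB : Disjoint A B) (hAX : A ⊆ X) (hBX : B ⊆ X) (hY : Y ⊆ A ∨ Y ⊆ B)
    (hch : DownChain Γ k (d * 2 ^ (k * d)) l Y) :
    DownChain Γ k (d * 2 ^ (k * d)) (l + 1) X := by
  have he : d ≤ d * 2 ^ (k * d) := Nat.le_mul_of_pos_right _ (by positivity)
  have hlow : ∀ {A B Y : Finset V}, A ⊆ X → B ⊆ X → A.Nonempty → Disjoint A B → Y ⊆ B →
      (∀ v ∈ A, #(B.filter (Γ.Adj v)) ≤ d) → DownChain Γ k (d * 2 ^ (k * d)) l Y →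
      DownChain Γ k (d * 2 ^ (k * d)) (l + 1) X := by
    intro A B Y hAX hBX hA hAB hY hd hch
    obtain ⟨u, hu⟩ := hA
    exact downChain_of_vertex (hAX hu) (hY.trans hBX) (fun h => disjoint_left.1 hAB hu (hY h))
      ((card_le_card (filter_subset_filter _ hY)).trans (hd u hu)) he hch
  cases S with
  | almostDisconnected =>
    rcases hY with hY | hY
    · exact hlow hBX hAX hB hAB.symm hY h.2 hch
    · exact hlow hAX hBX hA hAB hY h.1 hch
  | oneSidedAlmostDisconnected =>
    rcases hY with hY | hY
    · exact ⟨B, ∅, Y, d, hBX, hY.trans hAX, hAB.symm.mono_right hY, h.1, by simp,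
        fun x hx _ => h.2 x (hY hx), hch⟩
    · exact hlow hAX hBX hA hAB hY h.2 hch
  | weaklyConnected =>
    obtain ⟨h1, h2, h3⟩ := h
    have hd : d ≠ 0 := by
      rintro rfl
      exact h3 ⟨∅, ∅, by simp, by simp, by simp, by simp, by simp⟩
    have h4 := mul_le_weak_bound (k := k) hd
    rcases hY with hY | hY
    · exact downChain_of_bicliqueFree hBX (hY.trans hAX) (hAB.symm.mono_right hY) hk (by omega)
        (h3.symm.mono le_rfl Subset.rfl hY) hch
    · exact downChain_of_bicliqueFree hAX (hY.trans hBX) (hAB.mono_right hY) hk (by omega)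
        (h3.mono le_rfl Subset.rfl hY) hch

end Sparse

end NoisyCographs

namespace NoisyCographs
open Enc

/-! ### The program -/

/-- Evaluation within a given number of steps. -/
def Ev (O : Oracle) (F p : Prog) (x y : Data) (b : ℕ) : Prop := ∃ t ≤ b, Eval O F p x y t

section Ev

variable {O : Oracle} {F p q c : Prog} {x y z a b : Data} {s t : ℕ}

theorem Ev.mono (h : Ev O F p x y s) (hst : s ≤ t) : Ev O F p x y t :=
  let ⟨r, hr, h⟩ := h
  ⟨r, hr.trans hst, h⟩

theorem Ev.id : Ev O F Prog.id x x 1 := ⟨1, le_rfl, Eval.id F x⟩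
theorem Ev.hd : Ev O F Prog.hd (Data.cons a b) a 1 := ⟨1, le_rfl, Eval.hd_cons F a b⟩
theorem Ev.tl : Ev O F Prog.tl (Data.cons a b) b 1 := ⟨1, le_rfl, Eval.tl_cons F a b⟩

theorem Ev.cons (hp : Ev O F p x y s) (hq : Ev O F q x z t) :
    Ev O F (Prog.cons p q) x (Data.cons y z) (s + t + 1) :=
  let ⟨s', hs, hp⟩ := hp
  let ⟨t', ht, hq⟩ := hq
  ⟨s' + t' + 1, by omega, Eval.cons F p q x y z s' t' hp hq⟩

theorem Ev.comp (hq : Ev O F q x y s) (hp : Ev O F p y z t) :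
    Ev O F (Prog.comp p q) x z (s + t + 1) :=
  let ⟨s', hs, hq⟩ := hq
  let ⟨t', ht, hp⟩ := hp
  ⟨s' + t' + 1, by omega, Eval.comp F p q x y z s' t' hq hp⟩

theorem Ev.cond_true (hc : Ev O F c x (Data.cons a b) s) (hp : Ev O F p x y t) :
    Ev O F (Prog.cond c p q) x y (s + t + 1) :=
  let ⟨s', hs, hc⟩ := hc
  let ⟨t', ht, hp⟩ := hp
  ⟨s' + t' + 1, by omega, Eval.cond_true F c p q x a b y s' t' hc hp⟩

theorem Ev.cond_false (hc : Ev O F c x Data.nil s) (hq : Ev O F q x y t) :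
    Ev O F (Prog.cond c p q) x y (s + t + 1) :=
  let ⟨s', hs, hc⟩ := hc
  let ⟨t', ht, hq⟩ := hq
  ⟨s' + t' + 1, by omega, Eval.cond_false F c p q x y s' t' hc hq⟩

theorem Ev.self (h : Ev O F F x y t) : Ev O F Prog.self x y (t + 1) :=
  let ⟨t', ht, h⟩ := h
  ⟨t' + 1, by omega, Eval.self F x y t' h⟩

theorem Ev.fn (h : Ev O p p x y t) : Ev O F (Prog.fn p) x y (t + 1) :=
  let ⟨t', ht, h⟩ := h
  ⟨t' + 1, by omega, Eval.fn F p x y t' h⟩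

/-- Run `p`; if it fails (that is, returns `nil`), run `q`. -/
def Prog.orElse (p q : Prog) : Prog :=
  Prog.comp (Prog.cond Prog.hd Prog.hd (Prog.comp q Prog.tl)) (Prog.cons p Prog.id)

theorem Ev.orElse {r r' : Option (List ℕ)} (hp : Ev O F p x (enc r) s)
    (hq : r = none → Ev O F q x (enc r') t) :
    Ev O F (Prog.orElse p q) x (enc (r.or r')) (s + t + 10) := by
  cases r with
  | none =>
    rw [Option.none_or]
    exact ((hp.cons Ev.id).comp (Ev.cond_false Ev.hd (Ev.tl.comp (hq rfl)))).mono (by omega)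
  | some l =>
    rw [Option.some_or]
    exact ((hp.cons Ev.id).comp (Ev.cond_true Ev.hd Ev.hd)).mono (by omega)

end Ev

theorem PT.exists_prog {α β : Type} [Enc α] [Enc β] {f : α → β} (hf : PT f) :
    ∃ (p : Prog) (c : ℕ), ∀ c' ≥ c, ∀ O F x, Ev O F p (enc x) (enc (f x)) ((sz x + 2) ^ c') := by
  obtain ⟨⟨p, T, ⟨c, hc⟩, hp⟩, -⟩ := hf
  refine ⟨p, c, fun c' hc' O F x => ?_⟩
  obtain ⟨t, ht, h⟩ := hp O F x
  exact ⟨t, (ht.trans (hc x)).trans (pow_le_pow_size _ hc'), h⟩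

/-- The behaviour of the body `F` of the main recursive function: `c` is the exponent of the
polynomial overhead, and `q` is the program that finds tripartitions. -/
structure IsBody (O : Oracle) (q F : Prog) (c : ℕ) : Prop where
  base : ∀ e X t, baseFlag (mIn e X t) = true →
    Ev O F F (enc (mIn e X t)) (enc (baseResult (mIn e X t))) ((sz (mIn e X t) + 2) ^ c)
  bic : ∀ e X t (L : List ℕ) rA rB bq bA bB, baseFlag (mIn e X t) = false →
    Ev O q q (enc (subInstance (mIn e X t))) (enc L) bq → bicFlag (mIn e X t, L) = true →
    Ev O F F (enc (side 0 (mIn e X t, L))) (enc (rA : Option (List ℕ))) bA →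
    Ev O F F (enc (side 1 (mIn e X t, L))) (enc (rB : Option (List ℕ))) bB →
    Ev O F F (enc (mIn e X t)) (enc (rA.or (rB.or (brute (mIn e X t, L)))))
      (bq + bA + bB + (sz (mIn e X t, L) + 2) ^ c)
  sparse : ∀ e X t (L : List ℕ) r bq b, baseFlag (mIn e X t) = false →
    Ev O q q (enc (subInstance (mIn e X t))) (enc L) bq → bicFlag (mIn e X t, L) = false →
    Ev O F F (enc (startSearch (mIn e X t, L))) (enc (r : Option (List ℕ))) b →
    Ev O F F (enc (mIn e X t)) (enc r) (bq + b + (sz (mIn e X t, L) + 2) ^ c)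
  search_nil : ∀ e, Ev O F F (enc (wIn e [])) (enc (none : Option (List ℕ))) 20
  search_cons : ∀ e it rest rA rB rN rR bA bB bN bR,
    Ev O F F (enc (queryA (e, it))) (enc (rA : Option (List ℕ))) bA →
    Ev O F F (enc (queryB (e, it))) (enc (rB : Option (List ℕ))) bB →
    (foundNow ((e, it), rA, rB) = none →
      Ev O F F (enc (exploreNext ((e, it), rA, rB))) (enc (rN : Option (List ℕ))) bN) →
    (rN = none → Ev O F F (enc (wIn e rest)) (enc (rR : Option (List ℕ))) bR) →
    Ev O F F (enc (wIn e (it :: rest))) (enc ((foundNow ((e, it), rA, rB)).or (rN.or rR)))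
      (bA + bB + bN + bR + (sz ((e, it), rA, rB) + 2) ^ c)

theorem four_mul_pow_le (s c : ℕ) : 4 * (s + 2) ^ c ≤ (s + 2) ^ (c + 2) := by
  rw [pow_add, mul_comm]
  exact Nat.mul_le_mul_left _ (Nat.pow_le_pow_left (Nat.le_add_left 2 s) 2)

theorem exists_isBody (O : Oracle) (q : Prog) : ∃ F c, IsBody O q F c := by
  obtain ⟨p1, c1, h1⟩ := PT.baseFlag.exists_prog
  obtain ⟨p2, c2, h2⟩ := PT.baseResult.exists_prog
  obtain ⟨p3, c3, h3⟩ := PT.subInstance.exists_prog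
  obtain ⟨p4, c4, h4⟩ := PT.bicFlag.exists_prog
  obtain ⟨p5, c5, h5⟩ := PT.brute.exists_prog
  obtain ⟨p6, c6, h6⟩ := (PT.side 0).exists_prog
  obtain ⟨p7, c7, h7⟩ := (PT.side 1).exists_prog
  obtain ⟨p8, c8, h8⟩ := PT.startSearch.exists_prog
  obtain ⟨p9, c9, h9⟩ := PT.queryA.exists_prog
  obtain ⟨p10, c10, h10⟩ := PT.queryB.exists_prog
  obtain ⟨p11, c11, h11⟩ := PT.foundNow.exists_prog
  obtain ⟨p12, c12, h12⟩ := PT.exploreNext.exists_prog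
  set c := c1 + c2 + c3 + c4 + c5 + c6 + c7 + c8 + c9 + c10 + c11 + c12 with hc
  clear_value c
  replace h1 := h1 c (by omega) O
  replace h2 := h2 c (by omega) O
  replace h3 := h3 c (by omega) O
  replace h4 := h4 c (by omega) O
  replace h5 := h5 c (by omega) O
  replace h6 := h6 c (by omega) O
  replace h7 := h7 c (by omega) O
  replace h8 := h8 c (by omega) O
  replace h9 := h9 c (by omega) O
  replace h10 := h10 c (by omega) O
  replace h11 := h11 c (by omega) O
  replace h12 := h12 c (by omega) O
  set node : Prog := Prog.cond p4 (Prog.orElse (Prog.comp Prog.self p6)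
    (Prog.orElse (Prog.comp Prog.self p7) p5)) (Prog.comp Prog.self p8) with hnode
  set mainBody : Prog := Prog.cond p1 p2
    (Prog.comp node (Prog.cons Prog.id (Prog.comp (Prog.fn q) p3))) with hmain
  set answers : Prog := Prog.comp
    (Prog.cons Prog.id (Prog.cons (Prog.comp Prog.self p9) (Prog.comp Prog.self p10)))
    (Prog.cons (Prog.comp Prog.hd Prog.tl) (Prog.comp Prog.hd (Prog.comp Prog.tl Prog.tl)))
    with hans
  set restProg : Prog := Prog.cons Prog.hd (Prog.cons (Prog.comp Prog.hd Prog.tl)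
    (Prog.comp Prog.tl (Prog.comp Prog.tl Prog.tl))) with hrest
  set searchBody : Prog := Prog.cond (Prog.comp Prog.tl Prog.tl)
    (Prog.comp (Prog.orElse (Prog.comp p11 Prog.hd)
      (Prog.orElse (Prog.comp Prog.self (Prog.comp p12 Prog.hd))
        (Prog.comp Prog.self (Prog.comp restProg Prog.tl)))) (Prog.cons answers Prog.id))
    Prog.nil with hsearch
  set F : Prog := Prog.cond Prog.hd searchBody mainBody with hF
  have hle : ∀ e X t (L : List ℕ), (sz (mIn e X t) + 2) ^ c ≤ (sz (mIn e X t, L) + 2) ^ c :=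
    fun e X t L => Nat.pow_le_pow_left (by rw [sz_pair (mIn e X t)]; omega) c
  have hpos : ∀ s : ℕ, 1 ≤ (s + 2) ^ c := fun s => Nat.one_le_pow _ _ (by omega)
  have hbig : ∀ s : ℕ, 256 * (s + 2) ^ c ≤ (s + 2) ^ (c + 8) := fun s => by
    have e1 := four_mul_pow_le s c
    have e2 := four_mul_pow_le s (c + 2)
    have e3 := four_mul_pow_le s (c + 2 + 2)
    have e4 : 4 * (s + 2) ^ (c + 6) ≤ (s + 2) ^ (c + 8) := four_mul_pow_le s (c + 2 + 2 + 2)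
    have : c + 2 + 2 + 2 = c + 6 := rfl
    rw [this] at e3
    omega
  refine ⟨F, c + 8, ?_, ?_, ?_, ?_, ?_⟩
  · intro e X t hb
    have e1 := h1 F (mIn e X t)
    rw [hb, enc_true] at e1
    refine (Ev.cond_false (Ev.hd) (Ev.cond_true e1 (h2 F (mIn e X t)))).mono ?_
    have := hbig (sz (mIn e X t)); have := hpos (sz (mIn e X t))
    omega
  · intro e X t L rA rB bq bA bB hb hq hbic hA hB
    have e1 := h1 F (mIn e X t)
    rw [hb, enc_false] at e1
    have e4 := h4 F (mIn e X t, L)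
    rw [hbic, enc_true] at e4
    refine (Ev.cond_false Ev.hd (Ev.cond_false e1 (Ev.comp (Ev.cons Ev.id
      (Ev.comp (h3 F (mIn e X t)) (Ev.fn hq))) (Ev.cond_true e4 (Ev.orElse (Ev.comp (h6 F
          (mIn e X t, L)) hA.self)
        fun _ => Ev.orElse (Ev.comp (h7 F (mIn e X t, L)) hB.self) fun _ => h5 F
            (mIn e X t, L)))))).mono ?_
    have := hbig (sz (mIn e X t, L)); have := hpos (sz (mIn e X t, L)); have := hle e X t L
    omega
  · intro e X t L r bq b hb hq hbic hr
    have e1 := h1 F (mIn e X t)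
    rw [hb, enc_false] at e1
    have e4 := h4 F (mIn e X t, L)
    rw [hbic, enc_false] at e4
    refine (Ev.cond_false Ev.hd (Ev.cond_false e1 (Ev.comp (Ev.cons Ev.id
      (Ev.comp (h3 F (mIn e X t)) (Ev.fn hq))) (Ev.cond_false e4 (Ev.comp (h8 F
          (mIn e X t, L)) hr.self))))).mono ?_
    have := hbig (sz (mIn e X t, L)); have := hpos (sz (mIn e X t, L)); have := hle e X t L
    omega
  · intro e
    exact (Ev.cond_true Ev.hd (Ev.cond_false (Ev.comp Ev.tl Ev.tl)
      ⟨1, le_rfl, Eval.nil _ _⟩)).mono (by norm_num)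
  · intro e it rest rA rB rN rR bA bB bN bR hA hB hN hR
    have hprj : Ev O F (Prog.cons (Prog.comp Prog.hd Prog.tl)
        (Prog.comp Prog.hd (Prog.comp Prog.tl Prog.tl))) (enc (wIn e (it :: rest)))
        (enc (e, it)) 9 := (Ev.cons (Ev.comp Ev.tl Ev.hd) (Ev.comp (Ev.comp Ev.tl Ev.tl) Ev.hd))
    have hrst : Ev O F restProg (enc (wIn e (it :: rest))) (enc (wIn e rest)) 11 :=
      (Ev.cons Ev.hd (Ev.cons (Ev.comp Ev.tl Ev.hd) (Ev.comp (Ev.comp Ev.tl Ev.tl) Ev.tl)))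
    have hans' : Ev O F answers (enc (wIn e (it :: rest))) (enc ((e, it), rA, rB)) _ :=
      Ev.comp hprj (Ev.cons Ev.id (Ev.cons (Ev.comp (h9 F _) hA.self) (Ev.comp (h10 F _) hB.self)))
    refine (Ev.cond_true (F := F) Ev.hd (Ev.cond_true (Ev.comp Ev.tl Ev.tl) (Ev.comp
      (Ev.cons hans' Ev.id) (Ev.orElse (Ev.comp Ev.hd (h11 F ((e, it), rA, rB))) fun h =>
        Ev.orElse (Ev.comp (Ev.comp Ev.hd (h12 F ((e, it), rA, rB))) (hN h).self) fun h' =>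
          Ev.comp (Ev.comp Ev.tl hrst) (hR h').self)))).mono ?_
    have := hbig (sz ((e, it), rA, rB)); have := hpos (sz ((e, it), rA, rB))
    have : (sz (e, it) + 2) ^ c ≤ (sz ((e, it), rA, rB) + 2) ^ c :=
      Nat.pow_le_pow_left (by rw [sz_pair (e, it)]; omega) c
    omega

end NoisyCographs

namespace NoisyCographs
open Enc

/-! ### The search in sparse tripartitions -/

/-- `I` lists an independent set of size `t` in `X`. -/
structure Sol (Γ : SimpleGraph ℕ) (X : List ℕ) (t : ℕ) (I : List ℕ) : Prop where
  nodup : I.Nodup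
  length : I.length = t
  subset : ∀ v ∈ I, v ∈ X
  indep : ∀ u ∈ I, ∀ v ∈ I, ¬ Γ.Adj u v

/-- `r` is a correct answer to the question for an independent set of size `t` in `X`. -/
structure Correct (Γ : SimpleGraph ℕ) (X : List ℕ) (t : ℕ) (r : Option (List ℕ)) : Prop where
  sound : ∀ I, r = some I → Sol Γ X t I
  complete : r = none → ∀ I, ¬ Sol Γ X t I

theorem Sol.mono {Γ : SimpleGraph ℕ} {X Y : List ℕ} {t : ℕ} {I : List ℕ} (h : Sol Γ X t I)
    (hXY : ∀ v ∈ X, v ∈ Y) : Sol Γ Y t I :=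
  ⟨h.nodup, h.length, fun v hv => hXY v (h.subset v hv), h.indep⟩

theorem Sol.nil (Γ : SimpleGraph ℕ) (X : List ℕ) : Sol Γ X 0 [] :=
  ⟨by simp, by simp, by simp, by simp⟩

theorem Correct.pos_of_none {Γ : SimpleGraph ℕ} {X : List ℕ} {t : ℕ} (h : Correct Γ X t none) :
    0 < t := by
  rcases Nat.eq_zero_or_pos t with rfl | h0
  · exact absurd (Sol.nil Γ X) (h.complete rfl _)
  · exact h0

/-- `M` is an adjacency matrix of `Γ`. -/
def IsMatrix (M : List (List Bool)) (Γ : SimpleGraph ℕ) : Prop :=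
  ∀ u v, adjM M u v = true ↔ Γ.Adj u v

section Specs

variable {M : List (List Bool)} {Γ : SimpleGraph ℕ}

theorem mem_nonAdj (hM : IsMatrix M Γ) {u w : ℕ} {l : List ℕ} :
    w ∈ nonAdj M u l ↔ w ∈ l ∧ ¬ Γ.Adj u w := by
  rw [nonAdj, List.mem_filter, ← hM u w]; simp

theorem mem_away (hM : IsMatrix M Γ) {u w : ℕ} {l : List ℕ} :
    w ∈ away M u l ↔ w ∈ l ∧ ¬ Γ.Adj u w ∧ w ≠ u := by
  rw [away, List.mem_filter, ← hM u w]; simp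

theorem mem_avoid {u : ℕ} {l : List ℕ} {P : List (List ℕ)} :
    u ∈ avoid l P ↔ u ∈ l ∧ ∀ p ∈ P, u ∉ p := by
  rw [avoid, List.mem_filter]
  simp

theorem compat_iff (hM : IsMatrix M Γ) {p q : List ℕ} :
    compat M p q = true ↔ ∀ u ∈ p, ∀ v ∈ q, ¬ Γ.Adj u v := by
  simp only [compat, List.all_eq_true, Bool.not_eq_true', ← hM _ _, Bool.not_eq_true]

theorem mem_combos {S I : List ℕ} {P Q : List (List ℕ)} :
    I ∈ combos M S P Q ↔ ∃ p ∈ P, ∃ q ∈ Q, compat M p q = true ∧ S ++ p ++ q = I := by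
  simp [combos, and_assoc]

theorem mem_fresh {A B R S : List ℕ} {r : ℕ} {it : Item} :
    it ∈ fresh A B R S r ↔ ∃ i ≤ r, it = ⟨A, B, R, S, i, r - i, [], []⟩ := by
  simp only [fresh, List.mem_map, mem_downFrom, Nat.lt_succ_iff]
  exact ⟨fun ⟨i, hi, h⟩ => ⟨i, hi, h.symm⟩, fun ⟨i, hi, h⟩ => ⟨i, hi, h.symm⟩⟩

theorem length_fresh (A B R S : List ℕ) (r : ℕ) : (fresh A B R S r).length = r + 1 := by
  rw [fresh, List.length_map, length_downFrom]

end Specs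

/-- The state `it` occurs in the search for an independent set of size `t` in `A ∪ B ∪ R`. -/
structure Item.OK (Γ : SimpleGraph ℕ) (A B R : List ℕ) (t : ℕ) (it : Item) : Prop where
  subA : it.A.Sublist A
  subB : it.B.Sublist B
  subR : it.R.Sublist R
  solS : Sol Γ (A ++ B ++ R) it.S.length it.S
  farS : ∀ u ∈ it.S, ∀ v ∈ it.A ++ it.B ++ it.R, v ≠ u ∧ ¬ Γ.Adj u v
  size : it.S.length + (it.i + it.j) = t
  solP : ∀ p ∈ it.P, Sol Γ it.A it.i p
  solQ : ∀ q ∈ it.Q, Sol Γ it.B it.j q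
  disjP : it.P.Pairwise List.Disjoint
  disjQ : it.Q.Pairwise List.Disjoint
  length_eq : it.P.length = it.Q.length
  edge : ∀ p ∈ it.P, ∀ q ∈ it.Q, ∃ u ∈ p, ∃ v ∈ q, Γ.Adj u v

/-- `I` is a completion of the partial solution of `it` that the search starting in `it` is
responsible for. -/
def Item.Covers (Γ : SimpleGraph ℕ) (it : Item) (I : List ℕ) : Prop :=
  Sol Γ (it.A ++ it.B ++ it.R) (it.i + it.j) I ∧
    ((∃ u ∈ I, u ∈ it.R) ∨
      ((I.filter (· ∈ it.A)).length = it.i ∧ (I.filter (· ∈ it.B)).length = it.j))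

theorem exists_fresh_covers {Γ : SimpleGraph ℕ} {A B R S I : List ℕ} {r : ℕ}
    (hAB : List.Disjoint A B) (hI : Sol Γ (A ++ B ++ R) r I) :
    ∃ it ∈ fresh A B R S r, it.Covers Γ I := by
  by_cases hR : ∃ u ∈ I, u ∈ R
  · exact ⟨_, mem_fresh.2 ⟨0, Nat.zero_le _, rfl⟩, by simpa using hI, Or.inl hR⟩
  · have hle : (I.filter (· ∈ A)).length ≤ r := hI.length ▸ List.length_filter_le _ _
    refine ⟨_, mem_fresh.2 ⟨_, hle, rfl⟩, ?_, Or.inr ⟨rfl, ?_⟩⟩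
    · dsimp only
      rwa [Nat.add_sub_cancel' hle]
    · dsimp only
      have h1 := List.length_eq_length_filter_add (l := I) (fun u => decide (u ∈ A))
      have h2 : I.filter (· ∈ B) = I.filter (fun u => !decide (u ∈ A)) := by
        refine List.filter_congr fun u hu => ?_
        have h3 := hI.subset u hu
        simp only [List.mem_append] at h3
        by_cases huA : u ∈ A
        · have : u ∉ B := fun h => hAB huA h
          simp [huA, this]
        · have : u ∈ B := by
            rcases h3 with (h | h) | h
            · exact absurd h huA
            · exact h
            · exact absurd ⟨u, hu, h⟩ hR
          simp [huA, this]
      rw [h2]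
      have := hI.length
      omega

theorem fresh_ok {Γ : SimpleGraph ℕ} {A B R A' B' R' S : List ℕ} {t r : ℕ}
    (hA : A'.Sublist A) (hB : B'.Sublist B) (hR : R'.Sublist R)
    (hS : Sol Γ (A ++ B ++ R) S.length S)
    (hfar : ∀ u ∈ S, ∀ v ∈ A' ++ B' ++ R', v ≠ u ∧ ¬ Γ.Adj u v) (hr : S.length + r = t) :
    ∀ it ∈ fresh A' B' R' S r, it.OK Γ A B R t := by
  intro it hit
  obtain ⟨i, hi, rfl⟩ := mem_fresh.1 hit
  exact ⟨hA, hB, hR, hS, hfar, by dsimp only; omega, by simp, by simp, by simp, by simp, rfl,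
    by simp⟩

section Step

variable {M : List (List Bool)} {Γ : SimpleGraph ℕ} {A B R : List ℕ} {t : ℕ} {it : Item}

theorem Item.OK.extend (h : it.OK Γ A B R t) {p q : List ℕ}
    (hp : Sol Γ (avoid it.A it.P) it.i p) (hq : Sol Γ (avoid it.B it.Q) it.j q)
    (hedge : ∀ p' ∈ p :: it.P, ∀ q' ∈ q :: it.Q, ∃ u ∈ p', ∃ v ∈ q', Γ.Adj u v) :
    (it.extend p q).OK Γ A B R t := by
  refine ⟨h.subA, h.subB, h.subR, h.solS, h.farS, h.size, ?_, ?_, ?_, ?_, ?_, hedge⟩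
  · intro p' hp'
    rcases List.mem_cons.1 hp' with rfl | hp'
    · exact hp.mono fun v hv => (mem_avoid.1 hv).1
    · exact h.solP p' hp'
  · intro q' hq'
    rcases List.mem_cons.1 hq' with rfl | hq'
    · exact hq.mono fun v hv => (mem_avoid.1 hv).1
    · exact h.solQ q' hq'
  · exact List.pairwise_cons.2 ⟨fun p' hp' u hu hu' =>
      (mem_avoid.1 (hp.subset u hu)).2 p' hp' hu', h.disjP⟩
  · exact List.pairwise_cons.2 ⟨fun q' hq' u hu hu' =>
      (mem_avoid.1 (hq.subset u hu)).2 q' hq' hu', h.disjQ⟩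
  · simp [Item.extend, h.length_eq]

theorem Item.OK.mem_pool (h : it.OK Γ A B R t) {u : ℕ}
    (hu : u ∈ it.P.flatten ++ it.Q.flatten ++ it.R) : u ∈ it.A ++ it.B ++ it.R := by
  simp only [List.mem_append, List.mem_flatten] at hu ⊢
  rcases hu with (⟨p, hp, hup⟩ | ⟨q, hq, huq⟩) | hu
  · exact Or.inl (Or.inl ((h.solP p hp).subset u hup))
  · exact Or.inl (Or.inr ((h.solQ q hq).subset u huq))
  · exact Or.inr hu

theorem Item.OK.mem_all (h : it.OK Γ A B R t) {u : ℕ} (hu : u ∈ it.A ++ it.B ++ it.R) :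
    u ∈ A ++ B ++ R := by
  simp only [List.mem_append] at hu ⊢
  exact hu.imp (Or.imp (fun h' => h.subA.subset h') fun h' => h.subB.subset h')
    fun h' => h.subR.subset h'

theorem Item.OK.ok_children (h : it.OK Γ A B R t) (hM : IsMatrix M Γ) (hpos : 0 < it.i + it.j) :
    ∀ it' ∈ children M it, it'.OK Γ A B R t := by
  intro it' hit'
  obtain ⟨u, hu, hit'⟩ := List.mem_flatMap.1 hit'
  have hu' := h.mem_pool hu
  refine fresh_ok (List.filter_sublist.trans h.subA) (List.filter_sublist.trans h.subB)
    (List.filter_sublist.trans h.subR) ⟨?_, rfl, ?_, ?_⟩ ?_ ?_ it' hit'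
  · exact List.nodup_cons.2 ⟨fun hS => (h.farS u hS u hu').1 rfl, h.solS.nodup⟩
  · intro v hv
    rcases List.mem_cons.1 hv with rfl | hv
    · exact h.mem_all hu'
    · exact h.solS.subset v hv
  · intro v hv w hw
    rcases List.mem_cons.1 hv with rfl | hv <;> rcases List.mem_cons.1 hw with hw | hw
    · exact hw ▸ Γ.loopless.irrefl _
    · exact fun hh => (h.farS w hw v hu').2 hh.symm
    · exact hw ▸ (h.farS v hv u hu').2
    · exact h.solS.indep v hv w hw
  · intro v hv w hw
    have hw' : w ∈ it.A ++ it.B ++ it.R ∧ ¬ Γ.Adj u w ∧ w ≠ u := by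
      change w ∈ away M u it.A ++ away M u it.B ++ away M u it.R at hw
      simp only [List.mem_append, mem_away hM] at hw ⊢
      tauto
    rcases List.mem_cons.1 hv with rfl | hv
    · exact ⟨hw'.2.2, hw'.2.1⟩
    · exact h.farS v hv w hw'.1
  · have := h.size
    rw [List.length_cons]; omega

theorem Item.OK.sol_combos (h : it.OK Γ A B R t) (hM : IsMatrix M Γ) (hAB : List.Disjoint A B)
    {P Q : List (List ℕ)} (hP : ∀ p ∈ P, Sol Γ it.A it.i p) (hQ : ∀ q ∈ Q, Sol Γ it.B it.j q)
    {I : List ℕ} (hI : I ∈ combos M it.S P Q) : Sol Γ (A ++ B ++ R) t I := by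
  obtain ⟨p, hp, q, hq, hc, rfl⟩ := mem_combos.1 hI
  rw [compat_iff hM] at hc
  have hp' := hP p hp
  have hq' := hQ q hq
  have hpm : ∀ v ∈ p, v ∈ it.A ++ it.B ++ it.R := fun v hv => by simp [hp'.subset v hv]
  have hqm : ∀ v ∈ q, v ∈ it.A ++ it.B ++ it.R := fun v hv => by simp [hq'.subset v hv]
  refine ⟨?_, ?_, ?_, ?_⟩
  · rw [List.nodup_append', List.nodup_append']
    refine ⟨⟨h.solS.nodup, hp'.nodup, fun v hv hv' => (h.farS v hv v (hpm v hv')).1 rfl⟩,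
      hq'.nodup, fun v hv hv' => ?_⟩
    rcases List.mem_append.1 hv with hv | hv
    · exact (h.farS v hv v (hqm v hv')).1 rfl
    · exact hAB (h.subA.subset (hp'.subset v hv)) (h.subB.subset (hq'.subset v hv'))
  · have := h.size
    rw [List.length_append, List.length_append, hp'.length, hq'.length]; omega
  · intro v hv
    simp only [List.mem_append] at hv
    rcases hv with (hv | hv) | hv
    · exact h.solS.subset v hv
    · exact h.mem_all (hpm v hv)
    · exact h.mem_all (hqm v hv)
  · intro v hv w hw
    simp only [List.mem_append] at hv hw
    rcases hv with (hv | hv) | hv <;> rcases hw with (hw | hw) | hw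
    · exact h.solS.indep v hv w hw
    · exact (h.farS v hv w (hpm w hw)).2
    · exact (h.farS v hv w (hqm w hw)).2
    · exact fun hh => (h.farS w hw v (hpm v hv)).2 hh.symm
    · exact hp'.indep v hv w hw
    · exact hc v hv w hw
    · exact fun hh => (h.farS w hw v (hqm v hv)).2 hh.symm
    · exact fun hh => hc w hw v hv hh.symm
    · exact hq'.indep v hv w hw

theorem exists_mem_of_no_sol {L I : List ℕ} {P : List (List ℕ)} {i r : ℕ} {X : List ℕ}
    (hI : Sol Γ X r I) (hi : (I.filter (· ∈ L)).length = i)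
    (hno : ∀ J, ¬ Sol Γ (avoid L P) i J) : ∃ u ∈ I, u ∈ P.flatten := by
  by_contra! hcon
  refine hno (I.filter (· ∈ L)) ⟨hI.nodup.filter _, hi, fun v hv => ?_, fun u hu v hv =>
    hI.indep u (List.mem_of_mem_filter hu) v (List.mem_of_mem_filter hv)⟩
  rw [List.mem_filter, decide_eq_true_eq] at hv
  exact mem_avoid.2 ⟨hv.2, fun p hp hvp => hcon v hv.1 (List.mem_flatten.2 ⟨p, hp, hvp⟩)⟩

theorem Item.OK.covers_children (h : it.OK Γ A B R t) (hM : IsMatrix M Γ)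
    (hAB : List.Disjoint A B)
    (hno : (∀ J, ¬ Sol Γ (avoid it.A it.P) it.i J) ∨ ∀ J, ¬ Sol Γ (avoid it.B it.Q) it.j J)
    {I : List ℕ} (hI : it.Covers Γ I) : ∃ it' ∈ children M it, ∃ I', it'.Covers Γ I' := by
  obtain ⟨hsol, hI⟩ := hI
  have key : ∃ u ∈ I, u ∈ it.P.flatten ++ it.Q.flatten ++ it.R := by
    rcases hI with ⟨u, hu, huR⟩ | ⟨hi, hj⟩
    · exact ⟨u, hu, List.mem_append_right _ huR⟩
    · rcases hno with hno | hno
      · obtain ⟨u, hu, hu'⟩ := exists_mem_of_no_sol hsol hi hno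
        exact ⟨u, hu, List.mem_append_left _ (List.mem_append_left _ hu')⟩
      · obtain ⟨u, hu, hu'⟩ := exists_mem_of_no_sol hsol hj hno
        exact ⟨u, hu, List.mem_append_left _ (List.mem_append_right _ hu')⟩
  obtain ⟨u, hu, hupool⟩ := key
  have hsol' : Sol Γ (away M u it.A ++ away M u it.B ++ away M u it.R) (it.i + it.j - 1)
      (I.erase u) := by
    refine ⟨hsol.nodup.erase u, by rw [List.length_erase_of_mem hu, hsol.length], fun v hv => ?_,
      fun v hv w hw => hsol.indep v (List.mem_of_mem_erase hv) w (List.mem_of_mem_erase hw)⟩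
    have hv' := (hsol.nodup.mem_erase_iff).1 hv
    have h1 := hsol.subset v hv'.2
    have h2 := hsol.indep u hu v hv'.2
    simp only [List.mem_append, mem_away hM] at h1 ⊢
    tauto
  obtain ⟨it', hit', hc⟩ := exists_fresh_covers (S := u :: it.S)
    (fun v hv hv' => hAB (h.subA.subset (List.mem_of_mem_filter hv))
      (h.subB.subset (List.mem_of_mem_filter hv'))) hsol'
  exact ⟨it', List.mem_flatMap.2 ⟨u, hupool, hit'⟩, _, hc⟩

end Step

end NoisyCographs

namespace NoisyCographs
open Enc

/-- Families of disjoint independent sets of size at most `k` in `A` and in `B`, with edges between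
any two members of different families, have at most `m` members. -/
def FamBound (Γ : SimpleGraph ℕ) (A B : List ℕ) (k m : ℕ) : Prop :=
  ∀ (i j : ℕ) (P Q : List (List ℕ)), i ≤ k → j ≤ k → (∀ p ∈ P, Sol Γ A i p) →
    (∀ q ∈ Q, Sol Γ B j q) → P.Pairwise List.Disjoint → Q.Pairwise List.Disjoint →
    P.length = Q.length → (∀ p ∈ P, ∀ q ∈ Q, ∃ u ∈ p, ∃ v ∈ q, Γ.Adj u v) → P.length ≤ m

/-- An upper bound for the number of states explored from `it` on. -/
def Item.weight (m K : ℕ) (it : Item) : ℕ := (m - it.P.length) + K ^ (it.i + it.j)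

theorem length_flatten_le {l : List (List ℕ)} {k : ℕ} (h : ∀ p ∈ l, p.length ≤ k) :
    l.flatten.length ≤ l.length * k := by
  rw [List.length_flatten]
  have := List.sum_le_card_nsmul (l.map List.length) k (by simpa using h)
  simpa using this

section Search

variable {M : List (List Bool)} {Γ : SimpleGraph ℕ} {A B R : List ℕ} {t k m g : ℕ} {it : Item}

theorem Item.OK.length_le (h : it.OK Γ A B R t) (hfam : FamBound Γ A B k m) (ht : t ≤ k) :
    it.P.length ≤ m :=
  have hs := h.size
  hfam it.i it.j it.P it.Q (by omega) (by omega)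
    (fun p hp => (h.solP p hp).mono fun _ hv => h.subA.subset hv)
    (fun q hq => (h.solQ q hq).mono fun _ hv => h.subB.subset hv) h.disjP h.disjQ h.length_eq h.edge

theorem Item.OK.sum_weight_children (h : it.OK Γ A B R t) (hfam : FamBound Γ A B k m) (ht : t ≤ k)
    (hR : R.length ≤ g) (hpos : 0 < it.i + it.j) {K : ℕ}
    (hK : (2 * m * k + g) * k * (m + 1) + 1 ≤ K) :
    ((children M it).map (Item.weight m K)).sum + 1 ≤ it.weight m K := by
  have hs := h.size
  have hm := h.length_le hfam ht
  obtain ⟨r, hr⟩ : ∃ r, it.i + it.j = r + 1 := ⟨it.i + it.j - 1, by omega⟩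
  have hK1 : 1 ≤ K ^ r := Nat.one_le_pow _ _ (by omega)
  have hpool : (it.P.flatten ++ it.Q.flatten ++ it.R).length ≤ 2 * m * k + g := by
    have h1 := length_flatten_le (l := it.P) (k := k) fun p hp => by
      rw [(h.solP p hp).length]; omega
    have h2 := length_flatten_le (l := it.Q) (k := k) fun q hq => by
      rw [(h.solQ q hq).length]; omega
    have h3 := h.subR.length_le
    have h4 := Nat.mul_le_mul_right k hm
    rw [← h.length_eq] at h2
    rw [List.length_append, List.length_append]
    linarith
  have hlen : (children M it).length ≤ (2 * m * k + g) * k := by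
    rw [children, List.length_flatMap]
    simp only [length_fresh, List.map_const', List.sum_replicate, smul_eq_mul]
    exact Nat.mul_le_mul hpool (by omega)
  have hw : ∀ w ∈ (children M it).map (Item.weight m K), w ≤ m + K ^ r := by
    intro w hw
    obtain ⟨it', hit', rfl⟩ := List.mem_map.1 hw
    obtain ⟨u, -, hit'⟩ := List.mem_flatMap.1 hit'
    obtain ⟨i', hi', rfl⟩ := mem_fresh.1 hit'
    simp only [Item.weight, List.length_nil, Nat.sub_zero]
    rw [Nat.add_sub_cancel' hi', hr, Nat.add_sub_cancel]
  have hsum := List.sum_le_card_nsmul _ _ hw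
  rw [List.length_map, smul_eq_mul] at hsum
  calc ((children M it).map (Item.weight m K)).sum + 1
      ≤ (2 * m * k + g) * k * (m + K ^ r) + 1 :=
        Nat.add_le_add_right (hsum.trans (Nat.mul_le_mul_right _ hlen)) 1
    _ ≤ (2 * m * k + g) * k * ((m + 1) * K ^ r) + K ^ r := by
        refine Nat.add_le_add (Nat.mul_le_mul_left _ ?_) hK1
        have := Nat.mul_le_mul_left m hK1
        rw [Nat.add_mul]; omega
    _ = ((2 * m * k + g) * k * (m + 1) + 1) * K ^ r := by ring
    _ ≤ K * K ^ r := Nat.mul_le_mul_right _ hK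
    _ = K ^ (it.i + it.j) := by rw [hr, pow_succ, mul_comm]
    _ ≤ it.weight m K := Nat.le_add_left _ _

theorem search_spec {O : Oracle} {q F : Prog} {c : ℕ} (hF : IsBody O q F c) {e : Env}
    (hM : IsMatrix e.1 Γ) (hA : A.Nodup) (hB : B.Nodup) (hAB : List.Disjoint A B) (ht : t ≤ k)
    (hR : R.length ≤ g) (hfam : FamBound Γ A B k m) {K : ℕ}
    (hK : (2 * m * k + g) * k * (m + 1) + 1 ≤ K) {τ u : ℕ}
    (hcall : ∀ Y t', Y.Nodup → ((∀ v ∈ Y, v ∈ A) ∨ ∀ v ∈ Y, v ∈ B) → t' ≤ t →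
      ∃ r, Ev O F F (enc (mIn e Y t')) (enc r) τ ∧ Correct Γ Y t' r)
    (hu : ∀ (it : Item) (rA rB : Option (List ℕ)), it.OK Γ A B R t →
      (∀ I, rA = some I → Sol Γ A it.i I) → (∀ I, rB = some I → Sol Γ B it.j I) →
      (sz ((e, it), rA, rB) + 2) ^ c + 2 * τ + 20 ≤ u) :
    ∀ (W : ℕ) (items : List Item), (∀ it ∈ items, it.OK Γ A B R t) →
      (items.map (Item.weight m K)).sum ≤ W →
      ∃ r, Ev O F F (enc (wIn e items)) (enc r) (W * u + 20) ∧
        (∀ I, r = some I → Sol Γ (A ++ B ++ R) t I) ∧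
        (r = none → ∀ it ∈ items, ∀ I, ¬ it.Covers Γ I) := by
  intro W
  induction W using Nat.strong_induction_on with
  | _ W ih =>
    intro items hok hW
    cases items with
    | nil =>
      exact ⟨none, (hF.search_nil e).mono (by omega), by simp, by simp⟩
    | cons it rest =>
      have h := hok it (by simp)
      have hs := h.size
      rw [List.map_cons, List.sum_cons] at hW
      have hw1 : 1 ≤ it.weight m K :=
        le_trans (Nat.one_le_pow _ _ (by omega)) (Nat.le_add_left _ _)
      obtain ⟨rA, hevA, hcA⟩ := hcall (avoid it.A it.P) it.i
        ((h.subA.nodup hA).filter _)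
        (Or.inl fun v hv => h.subA.subset (mem_avoid.1 hv).1) (by omega)
      obtain ⟨rB, hevB, hcB⟩ := hcall (avoid it.B it.Q) it.j
        ((h.subB.nodup hB).filter _)
        (Or.inr fun v hv => h.subB.subset (mem_avoid.1 hv).1) (by omega)
      obtain ⟨rR, hevR, hsR, hnR⟩ := ih (rest.map (Item.weight m K)).sum (by omega) rest
        (fun it' hit' => hok it' (by simp [hit'])) le_rfl
      have hov := hu it rA rB h
        (fun I hI => (hcA.sound I hI).mono fun v hv => h.subA.subset (mem_avoid.1 hv).1)
        (fun I hI => (hcB.sound I hI).mono fun v hv => h.subB.subset (mem_avoid.1 hv).1)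
      set w2 := (rest.map (Item.weight m K)).sum with hw2
      -- the states explored next
      have main : ∃ rN, (foundNow ((e, it), rA, rB) = none →
            Ev O F F (enc (exploreNext ((e, it), rA, rB))) (enc (rN : Option (List ℕ)))
              ((it.weight m K - 1) * u + 20)) ∧
          (∀ I, (foundNow ((e, it), rA, rB)).or rN = some I → Sol Γ (A ++ B ++ R) t I) ∧
          ((foundNow ((e, it), rA, rB)).or rN = none → ∀ I, ¬ it.Covers Γ I) := by
        by_cases hboth : ∃ p q, rA = some p ∧ rB = some q
        · obtain ⟨p, q, rfl, rfl⟩ := hboth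
          have hp := hcA.sound p rfl
          have hq := hcB.sound q rfl
          have hfound : foundNow ((e, it), some p, some q) =
              (combos e.1 it.S (p :: it.P) (q :: it.Q)).head? := by simp [foundNow]
          have hnext : exploreNext ((e, it), some p, some q) = wIn e [it.extend p q] := by
            simp [exploreNext]
          rw [hfound, hnext]
          cases hc : (combos e.1 it.S (p :: it.P) (q :: it.Q)).head? with
          | some I =>
            refine ⟨none, by simp, fun J hJ => ?_, by simp⟩
            rw [Option.some_or, Option.some.injEq] at hJ
            subst hJ
            refine h.sol_combos hM hAB (fun p' hp' => ?_) (fun q' hq' => ?_)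
              (List.mem_of_mem_head? hc)
            · rcases List.mem_cons.1 hp' with rfl | hp'
              · exact hp.mono fun v hv => (mem_avoid.1 hv).1
              · exact h.solP p' hp'
            · rcases List.mem_cons.1 hq' with rfl | hq'
              · exact hq.mono fun v hv => (mem_avoid.1 hv).1
              · exact h.solQ q' hq'
          | none =>
            rw [List.head?_eq_none_iff] at hc
            have hext : (it.extend p q).OK Γ A B R t := by
              refine h.extend hp hq fun p' hp' q' hq' => ?_
              by_contra! hcon
              have hmem : it.S ++ p' ++ q' ∈ combos e.1 it.S (p :: it.P) (q :: it.Q) :=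
                mem_combos.2 ⟨p', hp', q', hq', (compat_iff hM).2 hcon, rfl⟩
              rw [hc] at hmem
              simp at hmem
            have hlen := hext.length_le hfam ht
            have hwt : (it.extend p q).weight m K + 1 = it.weight m K := by
              simp only [Item.weight, Item.extend, List.length_cons] at hlen ⊢
              omega
            obtain ⟨rN, hev, hsN, hnN⟩ := ih (it.weight m K - 1) (by omega) [it.extend p q]
              (by simpa using hext) (by simp; omega)
            refine ⟨rN, fun _ => hev, fun I hI => hsN I (by simpa using hI), fun hr I hI => ?_⟩
            exact hnN (by simpa using hr) (it.extend p q) (by simp) I hI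
        · have hnone : rA = none ∨ rB = none := by
            rcases rA with _ | p
            · exact Or.inl rfl
            · rcases rB with _ | q
              · exact Or.inr rfl
              · exact absurd ⟨p, q, rfl, rfl⟩ hboth
          have hflag : (rA.isSome && rB.isSome) = false := by
            rcases hnone with rfl | rfl <;> simp
          have hfound : foundNow ((e, it), rA, rB) = none := by simp [foundNow, hflag]
          have hnext : exploreNext ((e, it), rA, rB) = wIn e (children e.1 it) := by
            simp [exploreNext, hflag]
          have hpos : 0 < it.i + it.j := by
            rcases hnone with rfl | rfl
            · have := hcA.pos_of_none; omega
            · have := hcB.pos_of_none; omega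
          have hsum := h.sum_weight_children (M := e.1) hfam ht hR hpos hK
          obtain ⟨rN, hev, hsN, hnN⟩ := ih (it.weight m K - 1) (by omega) (children e.1 it)
            (h.ok_children hM hpos) (by omega)
          rw [hfound, hnext]
          refine ⟨rN, fun _ => hev, fun I hI => hsN I (by simpa using hI), fun hr I hI => ?_⟩
          obtain ⟨it', hit', I', hI'⟩ := h.covers_children hM hAB
            (hnone.imp (fun h0 => hcA.complete h0) fun h0 => hcB.complete h0) hI
          exact hnN (by simpa using hr) it' hit' I' hI'
      obtain ⟨rN, hevN, hsN, hnN⟩ := main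
      refine ⟨_, (hF.search_cons e it rest rA rB rN rR _ _ _ _ hevA hevB hevN
        fun _ => hevR).mono ?_, fun I hI => ?_, fun hr it' hit' I => ?_⟩
      · obtain ⟨w1, hw1'⟩ : ∃ w1, it.weight m K = w1 + 1 := ⟨it.weight m K - 1, by omega⟩
        rw [hw1', Nat.add_sub_cancel]
        have : (w1 + w2 + 1) * u ≤ W * u := Nat.mul_le_mul_right _ (by omega)
        have e1 : (w1 + w2 + 1) * u = w1 * u + w2 * u + u := by ring
        omega
      · rw [← Option.or_assoc] at hI
        rcases h0 : (foundNow ((e, it), rA, rB)).or rN with _ | J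
        · rw [h0, Option.none_or] at hI
          exact hsR I hI
        · rw [h0, Option.some_or] at hI
          exact hsN I (h0.trans hI)
      · rw [← Option.or_assoc, Option.or_eq_none_iff] at hr
        rcases List.mem_cons.1 hit' with rfl | hit'
        · exact hnN hr.1 I
        · exact hnR hr.2 it' hit' I

end Search

end NoisyCographs

namespace NoisyCographs
open Enc

/-! ### Exhaustive search in small sets -/

theorem length_subs_le_two_pow (Z : List ℕ) (n : ℕ) : (subs Z n).length ≤ 2 ^ Z.length := by
  induction Z with
  | nil => simp [subs]
  | cons z Z ih =>
    rw [subs_cons, List.length_drop, List.length_append, List.length_map, List.length_cons,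
        pow_succ]
    omega

theorem mem_subs {Z s : List ℕ} {n : ℕ} (hn : (subs Z n).length < n) (h : s.Sublist Z) :
    s ∈ subs Z n := by
  induction Z generalizing s with
  | nil =>
    rw [List.sublist_nil] at h
    subst h
    simp [subs]
  | cons z Z ih =>
    rw [subs_cons] at hn ⊢
    rw [List.length_drop] at hn
    have h0 : ((subs Z n ++ (subs Z n).map fun s => z :: s).length - n) = 0 := by omega
    have hlen : (subs Z n).length < n := by
      rw [List.length_append, List.length_map] at hn h0
      omega
    rw [h0, List.drop_zero, List.mem_append, List.mem_map]
    cases h with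
    | cons _ h => exact Or.inl (ih hlen h)
    | cons_cons _ h => exact Or.inr ⟨_, ih hlen h, rfl⟩

/-- The parts of the set `X` of vertices according to the labels `L`. -/
structure IsNode (X L : List ℕ) : Prop where
  cover : ∀ v ∈ X, v ∈ part X L 0 ++ part X L 1 ++ part X L 2
  lt_A : (part X L 2).length < (part X L 0).length
  lt_B : (part X L 2).length < (part X L 1).length
  length : (part X L 0).length + (part X L 1).length + (part X L 2).length = X.length

theorem mem_of_mem_part {X L : List ℕ} {a v : ℕ} (h : v ∈ part X L a) : v ∈ X :=
  List.mem_of_mem_filter h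

theorem disjoint_part {X L : List ℕ} {a b : ℕ} (hab : a ≠ b) :
    List.Disjoint (part X L a) (part X L b) := by
  intro v ha hb
  simp only [part, List.mem_filter, decide_eq_true_eq] at ha hb
  exact hab (ha.2.symm.trans hb.2)

section Brute

variable {e : Env} {Γ : SimpleGraph ℕ} {X L : List ℕ} {t : ℕ}

theorem nodup_cross (hX : X.Nodup) (v w : ℕ) :
    (cross e.1 (part X L 0) (part X L 1) (part X L 2) v w).Nodup := by
  have hs : (cross e.1 (part X L 0) (part X L 1) (part X L 2) v w).Sublist
      (part X L 0 ++ part X L 1 ++ part X L 2) :=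
    (List.filter_sublist.append List.filter_sublist).append_right _
  refine hs.nodup ?_
  rw [List.nodup_append', List.nodup_append']
  refine ⟨⟨hX.filter _, hX.filter _, disjoint_part (by norm_num)⟩, hX.filter _, ?_⟩
  intro v hv hv'
  rcases List.mem_append.1 hv with hv | hv
  · exact disjoint_part (by norm_num) hv hv'
  · exact disjoint_part (by norm_num) hv hv'

theorem mem_of_mem_cross {v w u : ℕ}
    (h : u ∈ cross e.1 (part X L 0) (part X L 1) (part X L 2) v w) : u ∈ X := by
  simp only [cross, nonAdj, List.mem_append, List.mem_filter] at h
  rcases h with (h | h) | h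
  · exact mem_of_mem_part h.1
  · exact mem_of_mem_part h.1
  · exact mem_of_mem_part h

theorem brute_sound (hM : IsMatrix e.1 Γ) (hX : X.Nodup) {I : List ℕ}
    (h : brute (mIn e X t, L) = some I) : Sol Γ X t I := by
  have h' := List.mem_of_mem_head? h
  simp only [List.mem_flatMap, List.mem_filter, Bool.and_eq_true, mIn] at h'
  obtain ⟨v, hv, w, hw, hI, hlen, hc⟩ := h'
  have hs := sublist_of_mem_subs hI
  exact ⟨hs.nodup (nodup_cross hX v w), of_decide_eq_true hlen, fun u hu => mem_of_mem_cross
      (hs.subset hu),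
    (compat_iff hM).1 hc⟩

theorem brute_complete (hM : IsMatrix e.1 Γ) (hX : X.Nodup) (hL : IsNode X L)
    (hflag : bicFlag (mIn e X t, L) = true) (h : brute (mIn e X t, L) = none) {I : List ℕ}
    (hI : Sol Γ X t I) {v w : ℕ} (hv : v ∈ I) (hw : w ∈ I) (hvA : v ∈ part X L 0)
    (hwB : w ∈ part X L 1) : False := by
  have hlen := hflag
  simp only [bicFlag, List.all_eq_true, mIn] at hlen
  replace hlen := of_decide_eq_true (hlen v hvA w hwB)
  set Z := cross e.1 (part X L 0) (part X L 1) (part X L 2) v w with hZ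
  have hIZ : ∀ u ∈ I, u ∈ Z := by
    intro u hu
    have h1 := hL.cover u (hI.subset u hu)
    have h2 := hI.indep v hv u hu
    have h3 := hI.indep w hw u hu
    simp only [hZ, cross, List.mem_append, mem_nonAdj hM] at h1 ⊢
    tauto
  have hperm : (Z.filter (· ∈ I)).Perm I := by
    rw [List.perm_ext_iff_of_nodup ((nodup_cross hX v w).filter _) hI.nodup]
    intro u
    rw [List.mem_filter, decide_eq_true_eq]
    exact ⟨fun h => h.2, fun h => ⟨hIZ u h, h⟩⟩
  have hmem : Z.filter (· ∈ I) ∈ (subs Z X.length).filter fun I =>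
      decide (I.length = t) && compat e.1 I I := by
    rw [List.mem_filter]
    refine ⟨mem_subs hlen List.filter_sublist, ?_⟩
    rw [Bool.and_eq_true, decide_eq_true_eq, compat_iff hM]
    refine ⟨hperm.length_eq.trans hI.length, fun a ha b hb => ?_⟩
    exact hI.indep a (hperm.subset ha) b (hperm.subset hb)
  have hnil := List.head?_eq_none_iff.1 h
  rw [List.flatMap_eq_nil_iff] at hnil
  have h1 := hnil v hvA
  rw [List.flatMap_eq_nil_iff] at h1
  have h2 := h1 w hwB
  exact List.ne_nil_of_mem hmem h2

theorem correct_bic (hM : IsMatrix e.1 Γ) (hX : X.Nodup) (hL : IsNode X L)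
    (hflag : bicFlag (mIn e X t, L) = true) {rA rB : Option (List ℕ)}
    (hA : Correct Γ (part X L 0 ++ part X L 2) t rA)
    (hB : Correct Γ (part X L 1 ++ part X L 2) t rB) :
    Correct Γ X t (rA.or (rB.or (brute (mIn e X t, L)))) := by
  have hsub : ∀ a, ∀ v ∈ part X L a ++ part X L 2, v ∈ X := fun a v hv => by
    rcases List.mem_append.1 hv with hv | hv <;> exact mem_of_mem_part hv
  constructor
  · intro I hI
    cases rA with
    | some J =>
      rw [Option.some_or] at hI
      exact (hA.sound I hI).mono (hsub 0)
    | none =>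
      cases rB with
      | some J =>
        rw [Option.none_or, Option.some_or] at hI
        exact (hB.sound I hI).mono (hsub 1)
      | none =>
        rw [Option.none_or, Option.none_or] at hI
        exact brute_sound hM hX hI
  · intro hr I hI
    rw [Option.or_eq_none_iff, Option.or_eq_none_iff] at hr
    obtain ⟨rfl, rfl, hb⟩ := hr
    have hcov : ∀ v ∈ I, v ∈ part X L 0 ++ part X L 1 ++ part X L 2 := fun v hv =>
      hL.cover v (hI.subset v hv)
    by_cases h0 : ∃ v ∈ I, v ∈ part X L 0
    · by_cases h1 : ∃ w ∈ I, w ∈ part X L 1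
      · obtain ⟨v, hv, hvA⟩ := h0
        obtain ⟨w, hw, hwB⟩ := h1
        exact brute_complete hM hX hL hflag hb hI hv hw hvA hwB
      · refine hA.complete rfl I ⟨hI.nodup, hI.length, fun v hv => ?_, hI.indep⟩
        have h2 := hcov v hv
        have h3 : v ∉ part X L 1 := fun h => h1 ⟨v, hv, h⟩
        simp only [List.mem_append] at h2 ⊢
        tauto
    · refine hB.complete rfl I ⟨hI.nodup, hI.length, fun v hv => ?_, hI.indep⟩
      have h2 := hcov v hv
      have h3 : v ∉ part X L 0 := fun h => h0 ⟨v, hv, h⟩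
      simp only [List.mem_append] at h2 ⊢
      tauto

end Brute

/-! ### Bounds for the families found in the search -/

theorem famBound_of_length {Γ : SimpleGraph ℕ} {A B : List ℕ} {k m : ℕ} (hm : A.length ≤ m) :
    FamBound Γ A B k m := by
  intro i j P Q _ _ hP _ hPd _ hlen hedge
  refine le_trans ?_ hm
  rcases Nat.eq_zero_or_pos P.length with h0 | h0
  · omega
  obtain ⟨q, hq⟩ := List.exists_mem_of_length_pos (hlen ▸ h0)
  have hne : ∀ p ∈ P, 1 ≤ p.length := fun p hp => by
    obtain ⟨u, hu, -⟩ := hedge p hp q hq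
    exact List.length_pos_of_mem hu
  have hnd : P.flatten.Nodup := List.nodup_flatten.2 ⟨fun p hp => (hP p hp).nodup, hPd⟩
  have hsub : P.flatten ⊆ A := fun v hv => by
    obtain ⟨p, hp, hv⟩ := List.mem_flatten.1 hv
    exact (hP p hp).subset v hv
  have h1 := (List.subperm_of_subset hnd hsub).length_le
  refine le_trans ?_ h1
  rw [List.length_flatten]
  have := List.card_nsmul_le_sum (P.map List.length) 1 (by simpa using hne)
  simpa using this

theorem famBound_of_bicliqueFree {Γ : SimpleGraph ℕ} [DecidableRel Γ.Adj] {A B : List ℕ}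
    {k d m : ℕ} (hk : 1 ≤ k) (hf : BicliqueFree Γ d A.toFinset B.toFinset)
    (hm : d * k + d * 2 ^ (d * k * k) ≤ m) : FamBound Γ A B k m := by
  intro i j P Q hi hj hP hQ hPd hQd hlen hedge
  rcases Nat.lt_or_ge P.length (d * k) with h0 | h0
  · omega
  have hmemP : ∀ x : Fin (d * k), P[x.1]'(by omega) ∈ P := fun x => List.getElem_mem _
  have hmemQ : ∀ x : Fin Q.length, Q[x.1] ∈ Q := fun x => List.getElem_mem _
  have hdis : ∀ {l : List (List ℕ)}, l.Pairwise List.Disjoint → ∀ (a b : ℕ) (ha : a < l.length)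
      (hb : b < l.length), a ≠ b → Disjoint (l[a]).toFinset (l[b]).toFinset := by
    intro l hl a b ha hb hab
    rw [List.disjoint_toFinset_iff_disjoint]
    rw [List.pairwise_iff_getElem] at hl
    rcases Nat.lt_or_gt_of_ne hab with h | h
    · exact hl a b ha hb h
    · exact (hl b a hb ha h).symm
  have := hf.card_family_le (ι := Fin (d * k)) (κ := Fin Q.length) hk
    (fun x => (P[x.1]'(by omega)).toFinset) (fun x => (Q[x.1]).toFinset) ?_ ?_ ?_ ?_ ?_ ?_ ?_
    (by simp)
  · rw [Fintype.card_fin] at this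
    omega
  · intro x v hv
    rw [List.mem_toFinset] at hv ⊢
    exact (hP _ (hmemP x)).subset v hv
  · intro x v hv
    rw [List.mem_toFinset] at hv ⊢
    exact (hQ _ (hmemQ x)).subset v hv
  · intro x
    exact (List.toFinset_card_le _).trans ((hP _ (hmemP x)).length.le.trans hi)
  · intro x
    exact (List.toFinset_card_le _).trans ((hQ _ (hmemQ x)).length.le.trans hj)
  · intro x y hxy
    exact hdis hPd _ _ _ _ fun h => hxy (Fin.ext h)
  · intro x y hxy
    exact hdis hQd _ _ _ _ fun h => hxy (Fin.ext h)
  · intro x y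
    obtain ⟨u, hu, v, hv, huv⟩ := hedge _ (hmemP x) _ (hmemQ y)
    exact ⟨u, List.mem_toFinset.2 hu, v, List.mem_toFinset.2 hv, huv⟩

end NoisyCographs

namespace NoisyCographs
open Enc

/-! ### The main recursion -/

/-- The labels `L` describe an almost bicomplete tripartition of `X`. -/
def BicNode (M : List (List Bool)) (X L : List ℕ) (g d : ℕ) : Prop :=
  (part X L 2).length ≤ g ∧ (∀ v ∈ part X L 0, (nonAdj M v (part X L 1)).length ≤ d) ∧
    ∀ w ∈ part X L 1, (nonAdj M w (part X L 0)).length ≤ d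

theorem bicFlag_of_bicNode {e : Env} {X L : List ℕ} {t g d : ℕ} (h : BicNode e.1 X L g d)
    (hX : 2 ^ (2 * d + g) < X.length) : bicFlag (mIn e X t, L) = true := by
  simp only [bicFlag, List.all_eq_true]
  intro v hv w hw
  refine decide_eq_true (lt_of_le_of_lt ((length_subs_le_two_pow _ _).trans
    (Nat.pow_le_pow_right (by norm_num) ?_)) hX)
  have h1 := h.2.1 v hv
  have h2 := h.2.2 w hw
  have h3 := h.1
  change (cross e.1 (part X L 0) (part X L 1) (part X L 2) v w).length ≤ _
  rw [cross, List.length_append, List.length_append]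
  omega

theorem sz_vertices_le {l : List ℕ} {n : ℕ} (hl : l.Nodup) (hn : ∀ v ∈ l, v < n) :
    sz l ≤ n * (n + 1) := by
  refine (sz_list_le (m := n) fun v hv => by rw [sz_nat]; exact (hn v hv).le).trans
    (Nat.mul_le_mul_right _ ?_)
  have h : l ⊆ List.range n := fun v hv => List.mem_range.2 (hn v hv)
  simpa using (List.subperm_of_subset hl h).length_le

theorem sq_recurrence {a b r x : ℕ} (ha : r < a) (hb : r < b) (hx : a + b + r = x) :
    (a + r + 1) ^ 2 + (b + r + 1) ^ 2 + 1 ≤ (x + 1) ^ 2 := by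
  subst hx
  obtain ⟨a, rfl⟩ := Nat.exists_eq_add_of_lt ha
  obtain ⟨b, rfl⟩ := Nat.exists_eq_add_of_lt hb
  ring_nf
  nlinarith [Nat.zero_le (r * a), Nat.zero_le (r * b), Nat.zero_le (a * b)]

theorem baseFlag_mIn (e : Env) (X : List ℕ) (t : ℕ) :
    baseFlag (mIn e X t) = if t = 0 then true else decide (X.length < 2) := by
  change (if decide (t = 0) = true then true else decide (X.length < 2)) = _
  simp only [decide_eq_true_eq]

theorem baseResult_mIn (e : Env) (X : List ℕ) (t : ℕ) : baseResult (mIn e X t) =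
    if t = 0 then some [] else if t = X.length then some X else none := by
  change (if decide (t = 0) = true then some [] else
    if decide (t = X.length) = true then some X else none) = _
  simp only [decide_eq_true_eq]

theorem baseResult_correct {Γ : SimpleGraph ℕ} {e : Env} {X : List ℕ} {t : ℕ} (hX : X.Nodup)
    (h : baseFlag (mIn e X t) = true) : Correct Γ X t (baseResult (mIn e X t)) := by
  rw [baseFlag_mIn] at h
  rw [baseResult_mIn]
  by_cases ht : t = 0
  · subst ht
    rw [if_pos rfl]
    exact ⟨fun I hI => by rw [← Option.some.inj hI]; exact Sol.nil Γ X, by simp⟩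
  rw [if_neg ht] at h ⊢
  have hlen : X.length < 2 := by simpa using h
  by_cases htX : t = X.length
  · rw [if_pos htX]
    refine ⟨fun I hI => ?_, by simp⟩
    rw [← Option.some.inj hI]
    refine ⟨hX, htX.symm, fun v hv => hv, fun u hu v hv => ?_⟩
    have hX1 : X.length = 1 := by omega
    obtain ⟨w, rfl⟩ := List.length_eq_one_iff.1 hX1
    rw [List.mem_singleton] at hu hv
    subst hu; subst hv
    exact Γ.loopless.irrefl _
  · rw [if_neg htX]
    refine ⟨by simp, fun _ I hI => ?_⟩
    have h1 := (List.subperm_of_subset hI.nodup hI.subset).length_le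
    have h2 := hI.length
    omega

theorem two_le_of_baseFlag {e : Env} {X : List ℕ} {t : ℕ} (h : baseFlag (mIn e X t) = false) :
    2 ≤ X.length := by
  rw [baseFlag_mIn] at h
  by_cases ht : t = 0
  · simp [ht] at h
  · rw [if_neg ht] at h
    exact Nat.succ_le_of_lt (by simpa using h)

section Main

variable {O : Oracle} {q F : Prog} {c n τ : ℕ} {e : Env} {Γ : SimpleGraph ℕ} [DecidableRel Γ.Adj]
  {S : Sparsity} {g₁ d₁ g₂ d₂ N₀ m K κ U Z : ℕ}

/-- The program `q` finds the tripartitions of all sets of vertices without large independent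
sets. -/
def FindsNodes (O : Oracle) (q : Prog) (e : Env) (Γ : SimpleGraph ℕ) [DecidableRel Γ.Adj]
    (S : Sparsity) (n τ g₁ d₁ g₂ d₂ : ℕ) : Prop :=
  ∀ X : List ℕ, X.Nodup → (∀ v ∈ X, v < n) → 2 ≤ X.length →
    (∀ t I, Sol Γ X t I → t ≤ e.2) → ∃ L : List ℕ,
      (∀ t, Ev O q q (enc (subInstance (mIn e X t))) (enc L) τ) ∧ sz L ≤ 3 * n ∧ IsNode X L ∧
      (BicNode e.1 X L g₁ d₁ ∨ (part X L 2).length ≤ g₂ ∧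
        SparseCond Γ e.2 d₂ (part X L 0).toFinset (part X L 1).toFinset S)

theorem main_spec (hF : IsBody O q F c) (hM : IsMatrix e.1 Γ)
    (hq : FindsNodes O q e Γ S n τ g₁ d₁ g₂ d₂) (hN₀ : 2 ^ (2 * d₁ + g₁) < N₀)
    (hm : N₀ + ((d₂ + 1) * e.2 + (d₂ + 1) * 2 ^ ((d₂ + 1) * e.2 * e.2)) ≤ m)
    (hK : (2 * m * e.2 + (N₀ + g₂)) * e.2 * (m + 1) + 1 ≤ K)
    (hκ : 3 * ((e.2 + 1) * (m + K ^ e.2)) + 1 ≤ κ)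
    (hZ : sz e + 2 * e.2 + (2 * m + 6) * (n * (n + 1) + 1) + 3 * n + 20 ≤ Z)
    (hU : τ + (Z + 2) ^ c + 40 ≤ U) :
    ∀ (x l : ℕ) (X : List ℕ) (t : ℕ), X.length = x → X.Nodup → (∀ v ∈ X, v < n) →
      (∀ t I, Sol Γ X t I → t ≤ e.2) → t ≤ e.2 →
      ¬ DownChain Γ e.2 (d₂ * 2 ^ (e.2 * d₂)) (l + 1) X.toFinset →
      ∃ r, Ev O F F (enc (mIn e X t)) (enc r) (U * κ ^ (l + min x N₀) * (x + 1) ^ 2) ∧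
        Correct Γ X t r := by
  have hκ1 : 1 ≤ κ := by omega
  have hN1 : 1 ≤ N₀ := (Nat.zero_le _).trans_lt hN₀
  have hpow : ∀ {a b : ℕ}, a ≤ b → κ ^ a ≤ κ ^ b := fun h => Nat.pow_le_pow_right hκ1 h
  have hvert : ∀ {l : List ℕ}, l.Nodup → (∀ v ∈ l, v < n) → sz l ≤ n * (n + 1) := sz_vertices_le
  intro x
  induction x using Nat.strong_induction_on with
  | _ x ih =>
    intro l X t hx hX hXn hα ht hch
    have hUle : U ≤ U * κ ^ (l + min x N₀) * (x + 1) ^ 2 := by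
      rw [mul_assoc]
      exact Nat.le_mul_of_pos_right _ (by positivity)
    have hszX := hvert hX hXn
    have hszM : sz (mIn e X t) ≤ Z := by
      have : sz (mIn e X t) = 0 + (sz e + (sz X + sz t + 1) + 1) + 1 := rfl
      rw [sz_nat] at this
      have : n * (n + 1) ≤ (2 * m + 6) * (n * (n + 1) + 1) := by nlinarith
      omega
    rcases hb : baseFlag (mIn e X t) with _ | _
    · have hx2 := two_le_of_baseFlag hb
      obtain ⟨L, hL, hszL, hnode, hcase⟩ := hq X hX hXn hx2 hα
      have hk : 1 ≤ e.2 := by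
        obtain ⟨v, hv⟩ := List.exists_mem_of_length_pos (show 0 < X.length by omega)
        refine hα 1 [v] ⟨by simp, by simp, by simpa using hv, fun a ha b hb => ?_⟩
        rw [List.mem_singleton] at ha hb
        subst ha; subst hb
        exact Γ.loopless.irrefl _
      have hszML : sz (mIn e X t, L) ≤ Z := by
        have h1 : sz (mIn e X t, L) = 0 + (sz e + (sz X + sz t + 1) + 1) + 1 + sz L + 1 := rfl
        rw [sz_nat] at h1
        have : n * (n + 1) ≤ (2 * m + 6) * (n * (n + 1) + 1) := by nlinarith
        omega
      have hov : (sz (mIn e X t, L) + 2) ^ c ≤ (Z + 2) ^ c :=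
        Nat.pow_le_pow_left (by omega) c
      have hlen := hnode.length
      have hltA := hnode.lt_A
      have hltB := hnode.lt_B
      rcases hflag : bicFlag (mIn e X t, L) with _ | _
      · -- a sparse tripartition
        set E := l + min x N₀ with hE
        have hcall : ∀ Y t', Y.Nodup →
            ((∀ v ∈ Y, v ∈ part X L 0) ∨ ∀ v ∈ Y, v ∈ part X L 1) → t' ≤ t →
            ∃ r, Ev O F F (enc (mIn e Y t')) (enc r) (U * κ ^ (E - 1) * (x + 1) ^ 2) ∧
              Correct Γ Y t' r := by
          intro Y t' hY hYsub ht'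
          have hYX : ∀ v ∈ Y, v ∈ X := fun v hv => by
            rcases hYsub with h | h <;> exact mem_of_mem_part (h v hv)
          have hYlen : Y.length < x := by
            rcases hYsub with h | h
            · have := (List.subperm_of_subset hY h).length_le; omega
            · have := (List.subperm_of_subset hY h).length_le; omega
          have hYα : ∀ t I, Sol Γ Y t I → t ≤ e.2 := fun t I hI => hα t I (hI.mono hYX)
          have hYn : ∀ v ∈ Y, v < n := fun v hv => hXn v (hYX v hv)
          have hYX' : Y.toFinset ⊆ X.toFinset := fun v hv => by
            rw [List.mem_toFinset] at hv ⊢; exact hYX v hv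
          have hfin : ∀ l', ¬ DownChain Γ e.2 (d₂ * 2 ^ (e.2 * d₂)) (l' + 1) Y.toFinset →
              l' + min Y.length N₀ ≤ E - 1 →
              ∃ r, Ev O F F (enc (mIn e Y t')) (enc r) (U * κ ^ (E - 1) * (x + 1) ^ 2) ∧
                Correct Γ Y t' r := by
            intro l' hl' hle
            obtain ⟨r, hev, hc⟩ := ih Y.length hYlen l' Y t' rfl hY hYn hYα (by omega) hl'
            exact ⟨r, hev.mono (Nat.mul_le_mul (Nat.mul_le_mul_left _ (hpow hle))
              (Nat.pow_le_pow_left (by omega) 2)), hc⟩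
          rcases Nat.lt_or_ge x N₀ with hxN | hxN
          · refine hfin l (fun h => hch (h.mono hYX')) ?_
            rw [hE, min_eq_left hxN.le, min_eq_left (by omega)]
            omega
          · have hsp := hcase.resolve_left fun hbic => by
              rw [bicFlag_of_bicNode hbic (by omega)] at hflag
              exact Bool.noConfusion hflag
            have hne : ∀ a, 0 < (part X L a).length → (part X L a).toFinset.Nonempty :=
              fun a ha => by
                obtain ⟨v, hv⟩ := List.exists_mem_of_length_pos ha
                exact ⟨v, List.mem_toFinset.2 hv⟩
            have hpart : ∀ a, (part X L a).toFinset ⊆ X.toFinset := fun a v hv => by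
              rw [List.mem_toFinset] at hv ⊢; exact mem_of_mem_part hv
            have hstep : ¬ DownChain Γ e.2 (d₂ * 2 ^ (e.2 * d₂)) l Y.toFinset := fun h =>
              hch (hsp.2.downChain hk (hne 0 (by omega)) (hne 1 (by omega))
                (List.disjoint_toFinset_iff_disjoint.2 (disjoint_part (by norm_num))) (hpart 0)
                (hpart 1) (hYsub.imp (fun h v hv => by
                  rw [List.mem_toFinset] at hv ⊢; exact h v hv) fun h v hv => by
                  rw [List.mem_toFinset] at hv ⊢; exact h v hv) h)
            obtain _ | l' := l
            · exact absurd trivial hstep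
            · refine hfin l' hstep ?_
              rw [hE, min_eq_right hxN]
              have := min_le_right Y.length N₀
              omega
        have hfam : FamBound Γ (part X L 0) (part X L 1) e.2 m := by
          rcases Nat.lt_or_ge x N₀ with hxN | hxN
          · exact famBound_of_length (by omega)
          · have hsp := hcase.resolve_left fun hbic => by
              rw [bicFlag_of_bicNode hbic (by omega)] at hflag
              exact Bool.noConfusion hflag
            exact famBound_of_bicliqueFree hk hsp.2.bicliqueFree (by omega)
        have hR : (part X L 2).length ≤ N₀ + g₂ := by
          rcases Nat.lt_or_ge x N₀ with hxN | hxN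
          · omega
          · have hsp := hcase.resolve_left fun hbic => by
              rw [bicFlag_of_bicNode hbic (by omega)] at hflag
              exact Bool.noConfusion hflag
            have := hsp.1
            omega
        have hEpos : 1 ≤ E := by
          have : 1 ≤ min x N₀ := le_min (by omega) (by omega)
          omega
        set τ' := U * κ ^ (E - 1) * (x + 1) ^ 2 with hτ'
        have hUτ' : U ≤ τ' := by
          rw [hτ', mul_assoc]
          exact Nat.le_mul_of_pos_right _ (by positivity)
        have hszI : ∀ (it : Item) (rA rB : Option (List ℕ)),
            it.OK Γ (part X L 0) (part X L 1) (part X L 2) t →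
            (∀ I, rA = some I → Sol Γ (part X L 0) it.i I) →
            (∀ I, rB = some I → Sol Γ (part X L 1) it.j I) →
            (sz ((e, it), rA, rB) + 2) ^ c + 2 * τ' + 20 ≤ U + 2 * τ' := by
          intro it rA rB hit hA hB
          have hpn : ∀ a, ∀ v ∈ part X L a, v < n := fun a v hv => hXn v (mem_of_mem_part hv)
          have hsub : ∀ a, ∀ l : List ℕ, l.Sublist (part X L a) → sz l ≤ n * (n + 1) :=
            fun a l hl => hvert (hl.nodup (hX.filter _)) fun v hv => hpn a v (hl.subset hv)
          have hsol : ∀ a s I, Sol Γ (part X L a) s I → sz I ≤ n * (n + 1) := fun a s I hI =>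
            hvert hI.nodup fun v hv => hpn a v (hI.subset v hv)
          have h1 := hsub 0 _ hit.subA
          have h2 := hsub 1 _ hit.subB
          have h3 := hsub 2 _ hit.subR
          have h4 : sz it.S ≤ n * (n + 1) := hvert hit.solS.nodup fun v hv => by
            have := hit.solS.subset v hv
            simp only [List.mem_append] at this
            rcases this with (h | h) | h <;> exact hpn _ v h
          have hPl := hit.length_le hfam ht
          have h5 : sz it.P ≤ m * (n * (n + 1) + 1) :=
            (sz_list_le fun p hp => hsol 0 _ p ((hit.solP p hp).mono
              fun v hv => hit.subA.subset hv)).trans (Nat.mul_le_mul_right _ hPl)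
          have h6 : sz it.Q ≤ m * (n * (n + 1) + 1) :=
            (sz_list_le fun p hp => hsol 1 _ p ((hit.solQ p hp).mono
              fun v hv => hit.subB.subset hv)).trans
                (Nat.mul_le_mul_right _ (hit.length_eq ▸ hPl))
          have h7 : sz rA ≤ n * (n + 1) + 1 := by
            cases rA with
            | none => exact Nat.zero_le _
            | some I => have := hsol 0 _ I (hA I rfl); rw [sz_some]; omega
          have h8 : sz rB ≤ n * (n + 1) + 1 := by
            cases rB with
            | none => exact Nat.zero_le _
            | some I => have := hsol 1 _ I (hB I rfl); rw [sz_some]; omega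
          have h9 : sz ((e, it), rA, rB) = sz e + (sz it.A + (sz it.B + (sz it.R + (sz it.S +
              (sz it.i + (sz it.j + (sz it.P + sz it.Q + 1) + 1) + 1) + 1) + 1) + 1) + 1) + 1 +
              (sz rA + sz rB + 1) + 1 := rfl
          rw [sz_nat, sz_nat] at h9
          have h10 := hit.size
          have h11 : (2 * m + 6) * (n * (n + 1) + 1) = 2 * (m * (n * (n + 1) + 1)) +
            6 * (n * (n + 1)) + 6 := by ring
          have h12 : (sz ((e, it), rA, rB) + 2) ^ c ≤ (Z + 2) ^ c :=
            Nat.pow_le_pow_left (by omega) c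
          omega
        have hok : ∀ it ∈ fresh (part X L 0) (part X L 1) (part X L 2) [] t,
            it.OK Γ (part X L 0) (part X L 1) (part X L 2) t :=
          fresh_ok (List.Sublist.refl _) (List.Sublist.refl _) (List.Sublist.refl _)
            (Sol.nil Γ _) (by simp) (by simp)
        have hweight : ((fresh (part X L 0) (part X L 1) (part X L 2) [] t).map
            (Item.weight m K)).sum ≤ (e.2 + 1) * (m + K ^ e.2) := by
          have := List.sum_le_card_nsmul ((fresh (part X L 0) (part X L 1) (part X L 2) [] t).map
            (Item.weight m K)) (m + K ^ e.2) fun w hw => by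
              obtain ⟨it, hit, rfl⟩ := List.mem_map.1 hw
              obtain ⟨i, hi, rfl⟩ := mem_fresh.1 hit
              simp only [Item.weight, List.length_nil, Nat.sub_zero]
              rw [Nat.add_sub_cancel' hi]
              exact Nat.add_le_add_left (Nat.pow_le_pow_right (by omega) ht) _
          rw [List.length_map, length_fresh, smul_eq_mul] at this
          exact this.trans (Nat.mul_le_mul_right _ (by omega))
        obtain ⟨r, hev, hsound, hcomp⟩ := search_spec hF hM (hX.filter _) (hX.filter _)
          (disjoint_part (by norm_num)) ht hR hfam hK hcall hszI _ _ hok hweight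
        refine ⟨r, (hF.sparse e X t L r _ _ hb (hL t) hflag hev).mono ?_, fun I hI => ?_,
          fun hr I hI => ?_⟩
        · have e1 : U * κ ^ E * (x + 1) ^ 2 = κ * τ' := by
            obtain ⟨E', hE'⟩ : ∃ E', E = E' + 1 := ⟨E - 1, by omega⟩
            rw [hτ', hE', Nat.add_sub_cancel, pow_succ]; ring
          have e2 := Nat.mul_le_mul_right τ' hκ
          have e3 : (3 * ((e.2 + 1) * (m + K ^ e.2)) + 1) * τ' =
            (e.2 + 1) * (m + K ^ e.2) * (3 * τ') + τ' := by ring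
          have e4 : (e.2 + 1) * (m + K ^ e.2) * (U + 2 * τ') ≤
            (e.2 + 1) * (m + K ^ e.2) * (3 * τ') := Nat.mul_le_mul_left _ (by omega)
          rw [e1]
          omega
        · exact (hsound I hI).mono fun v hv => by
            simp only [List.mem_append] at hv
            rcases hv with (h | h) | h <;> exact mem_of_mem_part h
        · obtain ⟨it, hit, hcov⟩ := exists_fresh_covers (S := []) (disjoint_part (by norm_num))
            (hI.mono hnode.cover)
          exact hcomp hr it hit I hcov
      · -- an almost bicomplete tripartition
        have hside : ∀ a, a ≠ 2 → (part X L a).length + (part X L 2).length < x →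
            ∃ r, Ev O F F (enc (mIn e (part X L a ++ part X L 2) t)) (enc r)
              (U * κ ^ (l + min x N₀) * ((part X L a).length + (part X L 2).length + 1) ^ 2) ∧
            Correct Γ (part X L a ++ part X L 2) t r := by
          intro a ha hlt
          have hsub : ∀ v ∈ part X L a ++ part X L 2, v ∈ X := fun v hv => by
            rcases List.mem_append.1 hv with hv | hv <;> exact mem_of_mem_part hv
          obtain ⟨r, hev, hc⟩ := ih _ hlt l (part X L a ++ part X L 2) t (by simp)
            (List.nodup_append'.2 ⟨hX.filter _, hX.filter _, disjoint_part ha⟩)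
            (fun v hv => hXn v (hsub v hv)) (fun s I hI => hα s I (hI.mono hsub)) ht
            (fun h => hch (h.mono fun v hv => by
              rw [List.mem_toFinset] at hv ⊢; exact hsub v hv))
          refine ⟨r, hev.mono (Nat.mul_le_mul_right _ (Nat.mul_le_mul_left _ (hpow ?_))), hc⟩
          exact Nat.add_le_add_left (min_le_min_right _ hlt.le) _
        obtain ⟨rA, hevA, hcA⟩ := hside 0 (by norm_num) (by omega)
        obtain ⟨rB, hevB, hcB⟩ := hside 1 (by norm_num) (by omega)
        refine ⟨_, (hF.bic e X t L rA rB _ _ _ hb (hL t) hflag hevA hevB).mono ?_,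
          correct_bic hM hX hnode hflag hcA hcB⟩
        have hrec := sq_recurrence hltA hltB (hlen.trans hx)
        have h1 := Nat.mul_le_mul_left (U * κ ^ (l + min x N₀)) hrec
        rw [Nat.mul_add, Nat.mul_add, mul_one] at h1
        have h2 : U ≤ U * κ ^ (l + min x N₀) := Nat.le_mul_of_pos_right _ (by positivity)
        omega
    · refine ⟨_, (hF.base e X t hb).mono ?_, baseResult_correct hX hb⟩
      have : (sz (mIn e X t) + 2) ^ c ≤ (Z + 2) ^ c := Nat.pow_le_pow_left (by omega) c
      omega

end Main

end NoisyCographs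

namespace NoisyCographs
open Enc

/-! ### Graphs on initial segments of the natural numbers -/

/-- A graph on `Fin n`, as a graph on `ℕ`. -/
def natGraph {n : ℕ} (G : SimpleGraph (Fin n)) : SimpleGraph ℕ where
  Adj u v := ∃ (hu : u < n) (hv : v < n), G.Adj ⟨u, hu⟩ ⟨v, hv⟩
  symm := ⟨fun _ _ ⟨hu, hv, h⟩ => ⟨hv, hu, h.symm⟩⟩
  loopless := ⟨fun _ ⟨_, _, h⟩ => G.loopless.irrefl _ h⟩

open Classical in
/-- The adjacency matrix of a graph. -/
noncomputable def matrixOf {n : ℕ} (G : SimpleGraph (Fin n)) : List (List Bool) :=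
  List.ofFn fun i => List.ofFn fun j => decide (G.Adj i j)

theorem enc_ofFn {α : Type} [Enc α] {n : ℕ} (f : Fin n → α) :
    enc (List.ofFn f) = Data.ofList (List.ofFn fun i => enc (f i)) := by
  change Data.ofList ((List.ofFn f).map enc) = _
  rw [List.map_ofFn]; rfl

open Classical in
theorem enc_decide (P : Prop) : enc (decide P) = Data.ofProp P := by
  unfold Data.ofProp
  by_cases h : P
  · rw [if_pos h, decide_eq_true h]; rfl
  · rw [if_neg h, decide_eq_false h]; rfl

theorem enc_matrixOf {n : ℕ} (G : SimpleGraph (Fin n)) : enc (matrixOf G) = encodeGraph G := by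
  rw [matrixOf, enc_ofFn]
  simp only [enc_ofFn, enc_decide]
  rfl

theorem enc_instance {n : ℕ} (G : SimpleGraph (Fin n)) (k : ℕ) :
    enc ((matrixOf G, k) : Env) = encodeInstance G k := by
  rw [enc_pair, enc_matrixOf]; rfl

theorem headD_drop {α : Type} (l : List α) (i : ℕ) (d : α) :
    (l.drop i).headD d = (l[i]?).getD d := by
  rw [List.headD_eq_head?_getD, List.head?_drop]

theorem isMatrix_matrixOf {n : ℕ} (G : SimpleGraph (Fin n)) :
    IsMatrix (matrixOf G) (natGraph G) := by
  intro u v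
  rw [adjM, headD_drop, headD_drop, matrixOf, List.getElem?_ofFn]
  by_cases hu : u < n
  · by_cases hv : v < n
    · simp [hu, hv, natGraph]
    · simp [hu, hv, natGraph]
  · simp [hu, natGraph]

theorem pos_eq_idxOf (x : ℕ) (l : List ℕ) : pos x l = l.idxOf x := by
  induction l with
  | nil => rfl
  | cons y l ih =>
    change (if decide (y = x) = true then 0 else pos x l + 1) = _
    rw [List.idxOf_cons, ih]
    by_cases h : y = x
    · simp [h]
    · rw [beq_false_of_ne h]; simp [h]

section Transfer

variable {V W : Type} {H : SimpleGraph V} {Γ : SimpleGraph W}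

theorem filter_adj_map [DecidableRel H.Adj] [DecidableRel Γ.Adj] (f : V ↪ W)
    (hf : ∀ u v, Γ.Adj (f u) (f v) ↔ H.Adj u v) (v : V)
    (B : Finset V) : (B.map f).filter (Γ.Adj (f v)) = (B.filter (H.Adj v)).map f := by
  rw [Finset.filter_map]
  congr 1
  exact Finset.filter_congr fun u _ => hf v u

theorem BicliqueFree.map {d : ℕ} {A B : Finset V} (h : BicliqueFree H d A B) (f : V ↪ W)
    (hf : ∀ u v, Γ.Adj (f u) (f v) ↔ H.Adj u v) : BicliqueFree Γ d (A.map f) (B.map f) := by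
  rintro ⟨X, Y, hX, hY, hXc, hYc, hadj⟩
  obtain ⟨X, hX', rfl⟩ := Finset.subset_map_iff.1 hX
  obtain ⟨Y, hY', rfl⟩ := Finset.subset_map_iff.1 hY
  rw [Finset.card_map] at hXc hYc
  exact h ⟨X, Y, hX', hY', hXc, hYc, fun x hx y hy =>
    (hf x y).1 (hadj _ (Finset.mem_map_of_mem f hx) _ (Finset.mem_map_of_mem f hy))⟩

theorem SparseCond.map [DecidableRel H.Adj] [DecidableRel Γ.Adj] {k d : ℕ} {A B : Finset V}
    {S : Sparsity} (h : SparseCond H k d A B S)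
    (f : V ↪ W) (hf : ∀ u v, Γ.Adj (f u) (f v) ↔ H.Adj u v) :
    SparseCond Γ k d (A.map f) (B.map f) S := by
  have key : ∀ {A B : Finset V}, (∀ v ∈ A, (B.filter (H.Adj v)).card ≤ d) →
      ∀ v ∈ A.map f, ((B.map f).filter (Γ.Adj v)).card ≤ d := by
    intro A B hAB v hv
    obtain ⟨w, hw, rfl⟩ := Finset.mem_map.1 hv
    rw [filter_adj_map f hf, Finset.card_map]
    exact hAB w hw
  cases S with
  | almostDisconnected => exact ⟨key h.1, key h.2⟩
  | oneSidedAlmostDisconnected => exact ⟨by rw [Finset.card_map]; exact h.1, key h.2⟩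
  | weaklyConnected =>
    exact ⟨by rw [Finset.card_map]; exact h.1, by rw [Finset.card_map]; exact h.2.1,
      h.2.2.map f hf⟩

end Transfer

theorem sparseCond_of_isSparseWitness {S : Sparsity} {m : ℕ} {H : SimpleGraph (Fin m)}
    [DecidableRel H.Adj] {T : Tripartition (Fin m)} {k g d : ℕ} (h : IsSparseWitness S H T k g d) :
    T.Nontrivial ∧ T.R.card ≤ g ∧ SparseCond H k d T.A T.B S := by
  have key : ∀ {A B : Finset (Fin m)} {v : Fin m},
      (@Finset.filter _ (fun w => H.Adj v w) (fun _ => Classical.propDecidable _) B).card ≤ d →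
      (B.filter (H.Adj v)).card ≤ d := by
    intro A B v h
    convert h
  cases S with
  | almostDisconnected =>
    exact ⟨h.1, h.2.1, fun v hv => key (A := ∅) (h.2.2.1 v hv), fun v hv =>
      key (A := ∅) (h.2.2.2 v hv)⟩
  | oneSidedAlmostDisconnected =>
    exact ⟨h.1, h.2.1, h.2.2.1, fun v hv => key (A := ∅) (h.2.2.2 v hv)⟩
  | weaklyConnected => exact ⟨h.1, h.2.1, h.2.2.1, h.2.2.2.1, h.2.2.2.2⟩

/-- The labels of the vertices that encode a tripartition. -/
def Tripartition.label {m : ℕ} (T : Tripartition (Fin m)) (v : Fin m) : ℕ :=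
  if v ∈ T.A then 0 else if v ∈ T.B then 1 else 2

theorem Tripartition.enc_labels {m : ℕ} (T : Tripartition (Fin m)) :
    enc (List.ofFn T.label) = T.encode := by
  rw [enc_ofFn]; rfl

theorem Tripartition.label_eq_zero {m : ℕ} (T : Tripartition (Fin m)) (v : Fin m) :
    T.label v = 0 ↔ v ∈ T.A := by
  unfold label; split_ifs <;> simp_all

theorem Tripartition.label_eq_one {m : ℕ} (T : Tripartition (Fin m)) (v : Fin m) :
    T.label v = 1 ↔ v ∈ T.B := by
  have := fun h : v ∈ T.A => Finset.disjoint_left.1 T.disjoint_AB h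
  unfold label; split_ifs <;> simp_all

theorem Tripartition.label_eq_two {m : ℕ} (T : Tripartition (Fin m)) (v : Fin m) :
    T.label v = 2 ↔ v ∈ T.R := by
  have h1 := fun h : v ∈ T.A => Finset.disjoint_left.1 T.disjoint_AR h
  have h2 := fun h : v ∈ T.B => Finset.disjoint_left.1 T.disjoint_BR h
  have h3 : v ∈ T.A ∪ T.B ∪ T.R := by rw [T.cover]; exact Finset.mem_univ v
  simp only [Finset.mem_union] at h3
  unfold label; split_ifs <;> simp_all

/-- The positions in a list without repetitions, as an embedding. -/
def getEmb (X : List ℕ) (hX : X.Nodup) : Fin X.length ↪ ℕ :=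
  ⟨fun i => X[i], fun _ _ h => Fin.ext ((hX.getElem_inj_iff).1 h)⟩

theorem mem_part_ofFn {X : List ℕ} (hX : X.Nodup) (lab : Fin X.length → ℕ) {a v : ℕ} :
    v ∈ part X (List.ofFn lab) a ↔ ∃ i, lab i = a ∧ getEmb X hX i = v := by
  rw [part, List.mem_filter, decide_eq_true_eq, headD_drop, pos_eq_idxOf]
  constructor
  · rintro ⟨hv, h⟩
    have hlt := List.idxOf_lt_length_of_mem hv
    refine ⟨⟨X.idxOf v, hlt⟩, ?_, List.getElem_idxOf hlt⟩
    simpa [List.getElem?_ofFn, hlt] using h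
  · rintro ⟨i, hi, rfl⟩
    have : X.idxOf (getEmb X hX i) = i := hX.idxOf_getElem i i.2
    refine ⟨List.getElem_mem _, ?_⟩
    rw [this]
    simpa [List.getElem?_ofFn] using hi

theorem toFinset_part {X : List ℕ} (hX : X.Nodup) (lab : Fin X.length → ℕ) {a : ℕ}
    {A : Finset (Fin X.length)} (hA : ∀ i, lab i = a ↔ i ∈ A) :
    (part X (List.ofFn lab) a).toFinset = A.map (getEmb X hX) := by
  ext v
  rw [List.mem_toFinset, mem_part_ofFn hX lab, Finset.mem_map]
  simp only [hA]

theorem length_part {X : List ℕ} (hX : X.Nodup) (lab : Fin X.length → ℕ) {a : ℕ}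
    {A : Finset (Fin X.length)} (hA : ∀ i, lab i = a ↔ i ∈ A) :
    (part X (List.ofFn lab) a).length = A.card := by
  rw [← List.toFinset_card_of_nodup (l := part X (List.ofFn lab) a)
      (hX.filter _), toFinset_part hX lab hA,
    Finset.card_map]

theorem length_nonAdj {V : Type} {M : List (List Bool)} {Γ : SimpleGraph ℕ} (hM : IsMatrix M Γ)
    {H : SimpleGraph V} (f : V ↪ ℕ) (hf : ∀ u v, Γ.Adj (f u) (f v) ↔ H.Adj u v) {l : List ℕ}
    (hl : l.Nodup) {B : Finset V} (hB : l.toFinset = B.map f) (v : V)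
    [DecidablePred fun w => ¬ H.Adj v w] :
    (nonAdj M (f v) l).length = (B.filter fun w => ¬ H.Adj v w).card := by
  rw [← List.toFinset_card_of_nodup (l := nonAdj M (f v) l) (hl.filter _), ← Finset.card_map f]
  congr 1
  ext u
  rw [List.mem_toFinset, mem_nonAdj hM, ← List.mem_toFinset, hB]
  simp only [Finset.mem_map, Finset.mem_filter]
  constructor
  · rintro ⟨⟨w, hw, rfl⟩, h⟩
    exact ⟨w, ⟨hw, fun h' => h ((hf v w).2 h')⟩, rfl⟩
  · rintro ⟨w, ⟨hw, h⟩, rfl⟩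
    exact ⟨⟨w, hw, rfl⟩, fun h' => h ((hf v w).1 h')⟩

theorem enc_subInstance {n : ℕ} {G : SimpleGraph (Fin n)} {X : List ℕ} (hX : ∀ v ∈ X, v < n)
    (k t : ℕ) : enc (subInstance (mIn (matrixOf G, k) X t)) =
      encodeInstance (G.comap fun i : Fin X.length => (⟨X[i], hX _
          (List.getElem_mem _)⟩ : Fin n)) k := by
  classical
  rw [← enc_instance]
  congr 1
  change (X.map fun u => X.map fun v => adjM (matrixOf G) u v, k) = _
  congr 1
  have hmap : ∀ {β : Type} (g : ℕ → β), X.map g = List.ofFn fun i : Fin X.length => g X[i] := by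
    intro β g
    conv_lhs => rw [← List.ofFn_getElem (xs := X)]
    rw [List.map_ofFn]
    rfl
  rw [hmap]
  conv_rhs => rw [matrixOf]
  congr 1
  funext i
  rw [hmap]
  congr 1
  funext j
  refine Bool.eq_iff_iff.2 ((isMatrix_matrixOf G _ _).trans ?_)
  simp only [decide_eq_true_eq, natGraph, SimpleGraph.comap_adj]
  exact ⟨fun ⟨_, _, h⟩ => h, fun h => ⟨_, _, h⟩⟩

theorem Sol.take {Γ : SimpleGraph ℕ} {X I : List ℕ} {s t : ℕ} (h : Sol Γ X t I) (hst : s ≤ t) :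
    Sol Γ X s (I.take s) :=
  ⟨h.nodup.sublist (List.take_sublist _ _), by rw [List.length_take, h.length]; omega,
    fun v hv => h.subset v (List.mem_of_mem_take hv),
    fun u hu v hv => h.indep u (List.mem_of_mem_take hu) v (List.mem_of_mem_take hv)⟩

theorem findsNodes {O : Oracle} {S : Sparsity} {N : Noise} {C : GraphClass}
    (hC : IsNoisyCographClass S N C) {q : Prog} {h : ℕ → ℕ} {γ : ℕ}
    (hq : ∀ (n : ℕ) (G : SimpleGraph (Fin n)) (k : ℕ), 2 ≤ n → G ∈ C n → G.indepNum ≤ k →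
      ∃ T : Tripartition (Fin n), IsWitness S N G k T ∧
        ∃ t : ℕ, t ≤ h k * n ^ γ ∧ Runs O q (encodeInstance G k) T.encode t)
    {n : ℕ} {G : SimpleGraph (Fin n)} (hG : G ∈ C n) (k : ℕ) [DecidableRel (natGraph G).Adj] :
    FindsNodes O q (matrixOf G, k) (natGraph G) S n (h k * n ^ γ) (N.g₁ k) (N.d₁ k) (N.g₂ k)
      (N.d₂ k) := by
  intro X hX hXn hX2 hα
  set fn : Fin X.length → Fin n := fun i => ⟨X[i], hXn _ (List.getElem_mem _)⟩ with hfn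
  have hinj : Function.Injective fn := fun i j hij =>
    (getEmb X hX).injective (congrArg Fin.val hij)
  set H : SimpleGraph (Fin X.length) := G.comap fn with hH
  have hHC : H ∈ C X.length := hC.1 _ _ H G hG ⟨⟨⟨fn, hinj⟩, Iff.rfl⟩⟩
  have hadj : ∀ i j, (natGraph G).Adj (getEmb X hX i) (getEmb X hX j) ↔ H.Adj i j := fun i j =>
    ⟨fun ⟨_, _, h⟩ => h, fun h => ⟨_, _, h⟩⟩
  have hlen : X.length ≤ n := by
    have hs : X ⊆ List.range n := fun v hv => List.mem_range.2 (hXn v hv)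
    simpa using (List.subperm_of_subset hX hs).length_le
  have hind : H.indepNum ≤ k := by
    obtain ⟨s, hs⟩ := H.exists_isNIndepSet_indepNum
    rw [SimpleGraph.isNIndepSet_iff] at hs
    refine hα _ ((s.map (getEmb X hX)).toList) ⟨Finset.nodup_toList _, ?_, fun v hv => ?_,
      fun u hu v hv huv => ?_⟩
    · rw [Finset.length_toList, Finset.card_map, hs.2]
    · rw [Finset.mem_toList, Finset.mem_map] at hv
      obtain ⟨i, -, rfl⟩ := hv
      exact List.getElem_mem _
    · rw [Finset.mem_toList, Finset.mem_map] at hu hv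
      obtain ⟨i, hi, rfl⟩ := hu
      obtain ⟨j, hj, rfl⟩ := hv
      exact hs.1 hi hj (fun hij => (natGraph G).loopless.irrefl _ (hij ▸ huv)) ((hadj i j).1 huv)
  obtain ⟨T, hT, s, hs, hrun⟩ := hq X.length H k hX2 hHC hind
  have : DecidableRel H.Adj := Classical.decRel _
  have lA := length_part hX T.label T.label_eq_zero
  have lB := length_part hX T.label T.label_eq_one
  have lR := length_part hX T.label T.label_eq_two
  have hnt : T.Nontrivial := hT.elim (fun h => h.1) fun h => (sparseCond_of_isSparseWitness h).1
  have hRlt := lt_min_iff.1 hnt.2.2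
  refine ⟨List.ofFn T.label, fun t => ⟨s, hs.trans ?_, ?_⟩, ?_, ⟨fun v hv => ?_, ?_, ?_, ?_⟩, ?_⟩
  · exact Nat.mul_le_mul_left _ (Nat.pow_le_pow_left hlen γ)
  · rw [enc_subInstance hXn, T.enc_labels]
    exact hrun
  · refine (sz_list_le (m := 2) fun a ha => ?_).trans ?_
    · obtain ⟨i, rfl⟩ := List.mem_ofFn.1 ha
      rw [sz_nat, Tripartition.label]
      split_ifs <;> omega
    · rw [List.length_ofFn]; omega
  · obtain ⟨i, hi, rfl⟩ := List.getElem_of_mem hv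
    have hc : (⟨i, hi⟩ : Fin X.length) ∈ T.A ∪ T.B ∪ T.R := by rw [T.cover]; exact Finset.mem_univ _
    simp only [Finset.mem_union] at hc
    simp only [List.mem_append, mem_part_ofFn hX T.label]
    rcases hc with (hc | hc) | hc
    · exact Or.inl (Or.inl ⟨_, (T.label_eq_zero _).2 hc, rfl⟩)
    · exact Or.inl (Or.inr ⟨_, (T.label_eq_one _).2 hc, rfl⟩)
    · exact Or.inr ⟨_, (T.label_eq_two _).2 hc, rfl⟩
  · rw [lA, lR]; exact hRlt.1
  · rw [lB, lR]; exact hRlt.2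
  · rw [lA, lB, lR]
    have h1 := Finset.card_union_of_disjoint T.disjoint_AB
    have h2 : (T.A ∪ T.B ∪ T.R).card = (T.A ∪ T.B).card + T.R.card :=
      Finset.card_union_of_disjoint (Finset.disjoint_union_left.2 ⟨T.disjoint_AR, T.disjoint_BR⟩)
    rw [T.cover, Finset.card_univ, Fintype.card_fin] at h2
    omega
  · rcases hT with hT | hT
    · refine Or.inl ⟨by rw [lR]; exact hT.2.1, fun v hv => ?_, fun w hw => ?_⟩
      · obtain ⟨i, hi, rfl⟩ := (mem_part_ofFn hX T.label).1 hv
        refine (length_nonAdj (isMatrix_matrixOf G) (getEmb X hX) hadj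
          (l := part X (List.ofFn T.label) 1) (hX.filter _)
          (toFinset_part hX T.label T.label_eq_one) i).le.trans ?_
        refine le_of_eq_of_le ?_ (hT.2.2.1 i ((T.label_eq_zero i).1 hi))
        congr
      · obtain ⟨i, hi, rfl⟩ := (mem_part_ofFn hX T.label).1 hw
        refine (length_nonAdj (isMatrix_matrixOf G) (getEmb X hX) hadj
          (l := part X (List.ofFn T.label) 0) (hX.filter _)
          (toFinset_part hX T.label T.label_eq_zero) i).le.trans ?_
        refine le_of_eq_of_le ?_ (hT.2.2.2 i ((T.label_eq_one i).1 hi))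
        congr
    · obtain ⟨-, hR, hsp⟩ := sparseCond_of_isSparseWitness hT
      refine Or.inr ⟨by rw [lR]; exact hR, ?_⟩
      rw [toFinset_part hX T.label T.label_eq_zero,
        toFinset_part hX T.label T.label_eq_one]
      exact hsp.map _ hadj

end NoisyCographs

namespace NoisyCographs
open Enc

/-! ### Computability of the bounds -/

theorem computable_add {f g : ℕ → ℕ} (hf : Computable f) (hg : Computable g) :
    Computable fun k => f k + g k :=
  Primrec.nat_add.to_comp.comp hf hg

theorem computable_mul {f g : ℕ → ℕ} (hf : Computable f) (hg : Computable g) :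
    Computable fun k => f k * g k :=
  Primrec.nat_mul.to_comp.comp hf hg

theorem primrec₂_pow : Primrec₂ fun a b : ℕ => a ^ b := by
  have h : Primrec₂ fun a b : ℕ => Nat.rec (motive := fun _ => ℕ) 1 (fun _ r => r * a) b :=
    Primrec.nat_rec (f := fun _ : ℕ => 1) (g := fun (a : ℕ) (p : ℕ × ℕ) => p.2 * a)
      (Primrec.const 1)
      (Primrec.nat_mul.comp (Primrec.snd.comp Primrec.snd) Primrec.fst)
  refine h.of_eq fun a b => ?_
  induction b with
  | zero => rfl
  | succ b ih => rw [pow_succ, ← ih]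

theorem computable_pow {f g : ℕ → ℕ} (hf : Computable f) (hg : Computable g) :
    Computable fun k => f k ^ g k :=
  primrec₂_pow.to_comp.comp hf hg

/-- Vertex sets with fewer vertices than this are searched exhaustively. -/
def smallSize (N : Noise) (k : ℕ) : ℕ := 2 ^ (2 * N.d₁ k + N.g₁ k) + 1

/-- Bounds the length of the family of subproblems of a sparse node. -/
def familySize (N : Noise) (k : ℕ) : ℕ :=
  smallSize N k + ((N.d₂ k + 1) * k + (N.d₂ k + 1) * 2 ^ ((N.d₂ k + 1) * k * k))

/-- Bounds the number of branches of a state of the search at a sparse node. -/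
def branching (N : Noise) (k : ℕ) : ℕ :=
  (2 * familySize N k * k + (smallSize N k + N.g₂ k)) * k * (familySize N k + 1) + 1

/-- Bounds the factor by which the running time grows at a sparse node. -/
def nodeFactor (N : Noise) (k : ℕ) : ℕ :=
  3 * ((k + 1) * (familySize N k + branching N k ^ k)) + 1

/-- Bounds the number of nested sparse nodes. -/
def nesting (N : Noise) (k : ℕ) : ℕ :=
  k * (N.d₂ k * 2 ^ (k * N.d₂ k) + 1) + N.d₂ k * 2 ^ (k * N.d₂ k)

/-- The polynomial overhead, as a function of the parameter. -/
def overhead (N : Noise) (c k : ℕ) : ℕ := (2 * familySize N k + 3 * k + 40) ^ c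

/-- The dependence of the running time on the parameter. -/
def parameterBound (N : Noise) (h : ℕ → ℕ) (c k : ℕ) : ℕ :=
  (h k + overhead N c k + 40) * nodeFactor N k ^ (nesting N k + smallSize N k) +
    3 * overhead N c k + 100

theorem computable_parameterBound (N : Noise) {h : ℕ → ℕ} (hh : Computable h) (c : ℕ) :
    Computable (parameterBound N h c) := by
  have h1 := N.computable_g₁
  have h2 := N.computable_d₁
  have h3 := N.computable_g₂
  have h4 := N.computable_d₂
  have hid : Computable fun k : ℕ => k := Computable.id
  have hc : ∀ a : ℕ, Computable fun _ : ℕ => a := Computable.const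
  have hs : Computable (smallSize N) :=
    computable_add (computable_pow (hc 2) (computable_add (computable_mul (hc 2) h2) h1)) (hc 1)
  have hd := computable_add h4 (hc 1)
  have hm : Computable (familySize N) :=
    computable_add hs (computable_add (computable_mul hd hid) (computable_mul hd
      (computable_pow (hc 2) (computable_mul (computable_mul hd hid) hid))))
  have hb : Computable (branching N) :=
    computable_add (computable_mul (computable_mul (computable_add
      (computable_mul (computable_mul (hc 2) hm) hid) (computable_add hs h3)) hid)
        (computable_add hm (hc 1))) (hc 1)
  have hf : Computable (nodeFactor N) :=
    computable_add (computable_mul (hc 3) (computable_mul (computable_add hid (hc 1))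
      (computable_add hm (computable_pow hb hid)))) (hc 1)
  have he := computable_mul h4 (computable_pow (hc 2) (computable_mul hid h4))
  have hn : Computable (nesting N) :=
    computable_add (computable_mul hid (computable_add he (hc 1))) he
  have ho : Computable (overhead N c) :=
    computable_pow (computable_add (computable_add (computable_mul (hc 2) hm)
      (computable_mul (hc 3) hid)) (hc 40)) (hc c)
  exact computable_add (computable_add (computable_mul (computable_add (computable_add hh ho)
    (hc 40)) (computable_pow hf (computable_add hn hs))) (computable_mul (hc 3) ho)) (hc 100)

/-! ### The whole program -/

/-- The main function solves the problem on suffixes of the vertex list whose independence number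
does not exceed the parameter; this body first tries the tail of the list. -/
def topBody (F mk : Prog) : Prog :=
  Prog.cond Prog.tl
    (Prog.orElse (Prog.comp Prog.self (Prog.cons Prog.hd (Prog.comp Prog.tl Prog.tl)))
      (Prog.comp (Prog.fn F) mk))
    (Prog.comp (Prog.fn F) mk)

theorem Sol.indepNum_cons_le {Γ : SimpleGraph ℕ} {v : ℕ} {l : List ℕ} {k : ℕ}
    (h : ∀ I, ¬ Sol Γ l k I) : ∀ t I, Sol Γ (v :: l) t I → t ≤ k := by
  intro t I hI
  by_contra! hlt
  have hs : Sol Γ l (I.erase v).length (I.erase v) := by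
    refine ⟨hI.nodup.erase v, rfl, fun u hu => ?_, fun u hu w hw =>
      hI.indep u (List.mem_of_mem_erase hu) w (List.mem_of_mem_erase hw)⟩
    have hu' := (hI.nodup.mem_erase_iff).1 hu
    exact (List.mem_cons.1 (hI.subset u hu'.2)).resolve_left hu'.1
  have hlen : k ≤ (I.erase v).length := by
    have h2 := hI.length
    rw [List.length_erase]
    split_ifs <;> omega
  exact h _ (hs.take hlen)

theorem topBody_spec {O : Oracle} {F mk : Prog} {Γ : SimpleGraph ℕ} {e : Env} {n Tm P : ℕ}
    (hmain : ∀ X : List ℕ, X.Nodup → (∀ v ∈ X, v < n) → (∀ t I, Sol Γ X t I → t ≤ e.2) →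
      ∃ r, Ev O F F (enc (mIn e X e.2)) (enc r) Tm ∧ Correct Γ X e.2 r)
    (hmk : ∀ X : List ℕ, X.Nodup → (∀ v ∈ X, v < n) →
      Ev O (topBody F mk) mk (enc (e, X)) (enc (mIn e X e.2)) P) :
    ∀ X : List ℕ, X.Nodup → (∀ v ∈ X, v < n) →
      ∃ r, Ev O (topBody F mk) (topBody F mk) (enc (e, X)) (enc r)
        ((X.length + 1) * (Tm + P + 40)) ∧ Correct Γ X e.2 r := by
  intro X hX hXn
  induction X with
  | nil =>
    obtain ⟨r, hr, hc⟩ := hmain [] hX hXn fun t I hI => by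
      have hnil : I = [] := List.eq_nil_iff_forall_not_mem.2 fun v hv => by
        simpa using hI.subset v hv
      rw [← hI.length, hnil]
      exact Nat.zero_le _
    exact ⟨r, (Ev.cond_false Ev.tl ((hmk [] hX hXn).comp hr.fn)).mono
      (by rw [List.length_nil]; omega), hc⟩
  | cons v l ih =>
    obtain ⟨r₁, hr₁, hc₁⟩ := ih (List.nodup_cons.1 hX).2 fun u hu => hXn u
        (List.mem_cons_of_mem v hu)
    have htail : Ev O (topBody F mk) (Prog.cons Prog.hd (Prog.comp Prog.tl Prog.tl))
        (enc (e, v :: l)) (enc (e, l)) 5 := Ev.cons Ev.hd (Ev.comp Ev.tl Ev.tl)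
    have key : ∃ r₂, (r₁ = none → Ev O (topBody F mk) (Prog.comp (Prog.fn F) mk)
        (enc (e, v :: l)) (enc r₂) (P + (Tm + 1) + 1)) ∧ Correct Γ (v :: l) e.2 (r₁.or r₂) := by
      cases h₁ : r₁ with
      | none =>
        obtain ⟨r₂, hr₂, hc₂⟩ := hmain (v :: l) hX hXn
          (Sol.indepNum_cons_le (hc₁.complete h₁))
        refine ⟨r₂, fun _ => (hmk _ hX hXn).comp hr₂.fn, ?_⟩
        rw [Option.none_or]
        exact hc₂
      | some I =>
        refine ⟨none, fun h => by simp at h, ?_, fun h => by simp at h⟩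
        rintro J hJ
        rw [Option.some_or] at hJ
        exact (hc₁.sound J (h₁.trans hJ)).mono fun u hu => List.mem_cons_of_mem v hu
    obtain ⟨r₂, hr₂, hc₂⟩ := key
    refine ⟨r₁.or r₂, (Ev.cond_true Ev.tl (Ev.orElse (htail.comp hr₁.self) hr₂)).mono ?_, hc₂⟩
    rw [List.length_cons, add_mul (l.length + 1)]
    omega

theorem PT.makeMain : PT fun x : Env × List ℕ => mIn x.1 x.2 x.1.2 := by
  unfold mIn
  fun_prop

theorem PT.allVertices : PT fun e : Env => NoisyCographs.downFrom e.1.length := by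
  fun_prop

theorem PT.optionIsSome : PT fun r : Option (List ℕ) => r.isSome := by
  fun_prop

theorem sz_matrixOf_le {n : ℕ} (G : SimpleGraph (Fin n)) : sz (matrixOf G) ≤ n * (n * 2 + 1) := by
  refine (sz_list_le (m := n * 2) fun a ha => ?_).trans (by rw [matrixOf, List.length_ofFn])
  rw [matrixOf, List.mem_ofFn] at ha
  obtain ⟨i, rfl⟩ := ha
  exact (sz_list_le (m := 1) fun b _ => sz_bool_le b).trans (by rw [List.length_ofFn])

theorem exists_sol_iff {n : ℕ} (G : SimpleGraph (Fin n)) (k : ℕ) :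
    (∃ I, Sol (natGraph G) (downFrom n) k I) ↔ ∃ I : Finset (Fin n), G.IsNIndepSet k I := by
  constructor
  · rintro ⟨I, hI⟩
    have hlt : ∀ v ∈ I.toFinset, v < n := fun v hv =>
      mem_downFrom.1 (hI.subset v (List.mem_toFinset.1 hv))
    refine ⟨I.toFinset.attachFin hlt, ?_⟩
    rw [SimpleGraph.isNIndepSet_iff]
    constructor
    · intro u hu v hv _ huv
      rw [Finset.mem_coe, Finset.mem_attachFin, List.mem_toFinset] at hu hv
      exact hI.indep _ hu _ hv ⟨u.2, v.2, huv⟩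
    · rw [Finset.card_attachFin, List.toFinset_card_of_nodup hI.nodup, hI.length]
  · rintro ⟨I, hI⟩
    rw [SimpleGraph.isNIndepSet_iff] at hI
    refine ⟨(I.map Fin.valEmbedding).toList, Finset.nodup_toList _, ?_, fun v hv => ?_,
      fun u hu v hv huv => ?_⟩
    · rw [Finset.length_toList, Finset.card_map, hI.2]
    · rw [Finset.mem_toList, Finset.mem_map] at hv
      obtain ⟨i, -, rfl⟩ := hv
      exact mem_downFrom.2 i.2
    · rw [Finset.mem_toList, Finset.mem_map] at hu hv
      obtain ⟨i, hi, rfl⟩ := hu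
      obtain ⟨j, hj, rfl⟩ := hv
      exact hI.1 hi hj (fun hij => (natGraph G).loopless.irrefl _ (hij ▸ huv)) huv.2.2

theorem not_downChain {Γ : SimpleGraph ℕ} [DecidableRel Γ.Adj] {X : List ℕ} {k e : ℕ}
    (hα : ∀ t I, Sol Γ X t I → t ≤ k) : ¬ DownChain Γ k e (k * (e + 1) + e + 1) X.toFinset := by
  intro h
  obtain ⟨I, hIX, -, hI, hind⟩ := h.exists_indep (W := ∅) (j := k + 1)
    (by rw [Finset.card_empty]; exact (by ring : (k + 1) * (e + 1) + 0 = _).le) le_rfl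
  have := hα (k + 1) I.toList ⟨Finset.nodup_toList _, by rw [Finset.length_toList, hI],
    fun v hv => List.mem_toFinset.1 (hIX (Finset.mem_toList.1 hv)), fun u hu v hv =>
      hind u (Finset.mem_toList.1 hu) v (Finset.mem_toList.1 hv)⟩
  omega

end NoisyCographs

namespace NoisyCographs
open Enc

/-- Polynomial overheads fit into the bound `overhead`. -/
theorem overhead_bound {N : Noise} {s c C k n : ℕ} (hc : c ≤ C)
    (hs : s + 2 ≤ (2 * familySize N k + 3 * k + 40) * (n + 1) ^ 2) :
    (s + 2) ^ c ≤ overhead N C k * (n + 1) ^ (2 * C) := by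
  rw [overhead, pow_mul, ← mul_pow]
  exact (Nat.pow_le_pow_left hs c).trans (Nat.pow_le_pow_right (by positivity) hc)

theorem total_bound {n τ U Y Q Tm P E a b κ : ℕ} (hY : Y = a * Q) (hQ : 1 ≤ Q)
    (hU : U = τ + Y + 40) (hτ : τ = b * (n + 1) ^ E)
    (hT : Tm ≤ U * κ * (n + 1) ^ 2) (hP : P = Y) :
    Y + ((n + 1) * (Tm + P + 40) + 1 + 1) + 1 + Y + 2 ≤
      ((b + a + 40) * κ + 3 * a + 100) * (Q * (n + 1) ^ (E + 3)) := by
  subst hP hY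
  have h1 : 1 ≤ (n + 1) ^ E := Nat.one_le_pow _ _ (by omega)
  have hle : ∀ x : ℕ, x ≤ x * Q := fun x => Nat.le_mul_of_pos_right x hQ
  have hle' : ∀ x : ℕ, x ≤ x * (n + 1) ^ E := fun x => Nat.le_mul_of_pos_right x h1
  have hU' : U ≤ (b + a + 40) * (Q * (n + 1) ^ E) := by
    have e1 : b * (n + 1) ^ E ≤ b * (Q * (n + 1) ^ E) :=
      Nat.mul_le_mul_left _ ((hle _).trans_eq (mul_comm _ _))
    have e2 : a * Q ≤ a * (Q * (n + 1) ^ E) := Nat.mul_le_mul_left _ (hle' Q)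
    have e3 : 40 ≤ 40 * (Q * (n + 1) ^ E) :=
      Nat.le_mul_of_pos_right _ (Nat.mul_pos hQ h1)
    rw [hU, hτ, add_mul, add_mul]
    omega
  have hT' : (n + 1) * Tm ≤ (b + a + 40) * κ * (Q * (n + 1) ^ (E + 3)) :=
    calc (n + 1) * Tm ≤ (n + 1) * ((b + a + 40) * (Q * (n + 1) ^ E) * κ * (n + 1) ^ 2) :=
          Nat.mul_le_mul_left _ (hT.trans (Nat.mul_le_mul_right _ (Nat.mul_le_mul_right _ hU')))
      _ = _ := by ring
  have hR : (n + 1) ≤ (n + 1) ^ (E + 3) := Nat.le_self_pow (by omega) _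
  have hS : (n + 1) * (a * Q) ≤ a * (Q * (n + 1) ^ (E + 3)) :=
    calc (n + 1) * (a * Q) = a * (Q * (n + 1)) := by ring
      _ ≤ _ := Nat.mul_le_mul_left _ (Nat.mul_le_mul_left _ hR)
  have hQS : a * Q ≤ a * (Q * (n + 1) ^ (E + 3)) :=
    Nat.mul_le_mul_left _ (Nat.le_mul_of_pos_right _ (by positivity))
  have hN : n + 1 ≤ Q * (n + 1) ^ (E + 3) := hR.trans ((hle _).trans_eq (mul_comm _ _))
  generalize Q * (n + 1) ^ (E + 3) = W at *
  have e1 : (n + 1) * (Tm + a * Q + 40) = (n + 1) * Tm + (n + 1) * (a * Q) + 40 * (n + 1) := by ring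
  have e2 : ((b + a + 40) * κ + 3 * a + 100) * W =
      (b + a + 40) * κ * W + 3 * (a * W) + 100 * W := by ring
  rw [e1, e2]
  omega

theorem misIsFPT {S : Sparsity} {N : Noise} {C : GraphClass} (hC : IsNoisyCographClass S N C)
    {O : Oracle} (hO : FindsTripartitionsFPT O S N C) : MISIsFPT O C := by
  obtain ⟨q, h, γ, hh, hq⟩ := hO
  obtain ⟨F, c₁, hF⟩ := exists_isBody O q
  obtain ⟨mk, c₂, hmk⟩ := PT.makeMain.exists_prog
  obtain ⟨vs, c₃, hvs⟩ := PT.allVertices.exists_prog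
  obtain ⟨is, c₄, his⟩ := PT.optionIsSome.exists_prog
  set c := c₁ + c₂ + c₃ + c₄ with hc
  refine ⟨Prog.comp is (Prog.comp (Prog.fn (topBody F mk)) (Prog.cons Prog.id vs)),
    parameterBound N h c, 2 * c + (γ + 3), computable_parameterBound N hh c, fun n G k hG => ?_⟩
  have : DecidableRel (natGraph G).Adj := Classical.decRel _
  set e : Env := (matrixOf G, k) with he
  set m := familySize N k with hm
  have hsze : sz e ≤ n * (n * 2 + 1) + k + 1 := by
    rw [he, sz_pair, sz_nat]
    have := sz_matrixOf_le G
    omega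
  have hvert : ∀ {X : List ℕ}, X.Nodup → (∀ v ∈ X, v < n) → sz X ≤ n * (n + 1) := sz_vertices_le
  have hsize : ∀ s : ℕ, s ≤ sz e + 2 * k + (2 * m + 6) * (n * (n + 1) + 1) + 3 * n + 20 →
      s + 2 ≤ (2 * m + 3 * k + 40) * (n + 1) ^ 2 := by
    intro s hs
    nlinarith [Nat.zero_le (m * n), Nat.zero_le (k * n), Nat.zero_le (k * n * n)]
  have hn2 : n * (n + 1) + 1 ≤ (2 * m + 6) * (n * (n + 1) + 1) :=
    Nat.le_mul_of_pos_left _ (by omega)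
  set Y := overhead N c k * (n + 1) ^ (2 * c) with hY
  set Z := sz e + 2 * k + (2 * m + 6) * (n * (n + 1) + 1) + 3 * n + 20 with hZ
  set τ := h k * (n + 1) ^ γ with hτ
  set U := τ + Y + 40 with hU
  set κ := nodeFactor N k ^ (nesting N k + smallSize N k) with hκ
  have hmain : ∀ X : List ℕ, X.Nodup → (∀ v ∈ X, v < n) →
      (∀ t I, Sol (natGraph G) X t I → t ≤ e.2) →
      ∃ r, Ev O F F (enc (mIn e X e.2)) (enc r) (U * κ * (n + 1) ^ 2) ∧
        Correct (natGraph G) X e.2 r := by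
    intro X hX hXn hα
    obtain ⟨r, hr, hcor⟩ := main_spec hF (isMatrix_matrixOf G) (findsNodes hC hq hG k)
      (N₀ := smallSize N k) (m := m) (K := branching N k) (κ := nodeFactor N k) (Z := Z) (U := U)
      (Nat.lt_succ_self _) le_rfl le_rfl le_rfl le_rfl
      (Nat.add_le_add_right (Nat.add_le_add
        (Nat.mul_le_mul_left _ (Nat.pow_le_pow_left n.le_succ γ))
        (overhead_bound (by omega) (hsize Z le_rfl))) 40)
      X.length (nesting N k) X k rfl hX hXn hα le_rfl (not_downChain hα)
    have hlen : X.length ≤ n := by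
      have hs : X ⊆ List.range n := fun v hv => List.mem_range.2 (hXn v hv)
      simpa using (List.subperm_of_subset hX hs).length_le
    exact ⟨r, hr.mono (Nat.mul_le_mul (Nat.mul_le_mul_left _ (Nat.pow_le_pow_right
      (Nat.succ_pos _) (Nat.add_le_add_left (min_le_right _ _) _)))
      (Nat.pow_le_pow_left (Nat.succ_le_succ hlen) 2)), hcor⟩
  have hmk' : ∀ X : List ℕ, X.Nodup → (∀ v ∈ X, v < n) →
      Ev O (topBody F mk) mk (enc (e, X)) (enc (mIn e X e.2)) Y := fun X hX hXn =>
    (hmk c₂ le_rfl O _ (e, X)).mono (overhead_bound (by omega) (hsize _ (by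
      have := hvert hX hXn
      rw [sz_pair]
      omega)))
  have hnod := nodup_downFrom n
  have hlt : ∀ v ∈ downFrom n, v < n := fun v hv => mem_downFrom.1 hv
  obtain ⟨r, hr, hcor⟩ := topBody_spec hmain hmk' (downFrom n) hnod hlt
  have hszr : sz r ≤ n * (n + 1) + 1 := by
    cases hr' : r with
    | none => rw [sz_none]; omega
    | some I =>
      have hI := hcor.sound I hr'
      have := hvert hI.nodup fun v hv => hlt v (hI.subset v hv)
      rw [sz_some]
      omega
  have hans : enc r.isSome = Data.ofProp (∃ I : Finset (Fin n), G.IsNIndepSet k I) := by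
    classical
    rw [← exists_sol_iff, ← enc_decide]
    congr 1
    cases hr' : r with
    | none => exact (decide_eq_false fun ⟨I, hI⟩ => hcor.complete hr' I hI).symm
    | some I => exact (decide_eq_true ⟨I, hcor.sound I hr'⟩).symm
  have hverts : ∀ F', Ev O F' vs (enc e) (enc (downFrom n)) Y := fun F' => by
    have := (hvs c₃ le_rfl O F' e).mono (t := Y)
      (overhead_bound (by omega) (hsize _ (by omega)))
    rwa [he, matrixOf, List.length_ofFn] at this
  have hlast : ∀ F', Ev O F' is (enc r) (enc r.isSome) Y := fun F' =>
    (his c₄ le_rfl O F' r).mono (overhead_bound (by omega) (hsize _ (by omega)))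
  obtain ⟨t, ht, hev⟩ := ((Ev.id.cons (hverts _)).comp hr.fn).comp (hlast
    (Prog.comp is (Prog.comp (Prog.fn (topBody F mk)) (Prog.cons Prog.id vs))))
  rw [hans, he, enc_instance] at hev
  refine ⟨t, ht.trans ?_, hev⟩
  rw [length_downFrom, pow_add]
  refine le_trans ?_ (total_bound (κ := κ) hY (Nat.one_le_pow _ _ (by omega)) hU hτ le_rfl rfl)
  omega

end NoisyCographs

theorem mainTheorem8 (S : NoisyCographs.Sparsity) (N : NoisyCographs.Noise)
    (C : NoisyCographs.GraphClass) (hC : NoisyCographs.IsNoisyCographClass S N C)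
    (O : NoisyCographs.Oracle) (hO : NoisyCographs.FindsTripartitionsFPT O S N C) :
    NoisyCographs.MISIsFPT O C :=
  NoisyCographs.misIsFPT hC hO
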